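/- **Setting.** Let $l_P,q,M_0>0$ and put $r_q=l_Pq$, $r_S=2M_0$, $r_c=\sqrt{\sqrt2\,l_Pr_q}$, $\delta_1=r_q^2/(r_Sr_c)$. For $x\in\mathbb R$ let $$r(x)^2=\tfrac12\Big(x^2+\sqrt{x^4+4r_c^4}\Big),\qquad \sigma_+(x)=1+\frac{r_c^4}{r^4},\qquad A(x)=1-\frac{r_S}{|x|}+\frac{r_q^2}{r^2}-\frac{2r_q^2}{r_c}\frac{G(r/r_c)}{|x|},$$ $$G(z)=\tfrac23z^3\Big[{}_2F_1\big(-\tfrac34,\tfrac12;\tfrac14;z^{-4}\big)-(1-z^{-4})^{3/2}\Big],\qquad \delta_c=-\frac1{2G(1)}\approx0.572$$ (if $\delta_1=\delta_c$, $A$ extends smoothly to $x=0$ with $A(0)=1-r_q^2/r_c^2$). The geonic wormhole metric is $$g=-\frac{A}{\sigma_+}dt^2+\frac{dx^2}{A\,\sigma_+}+r(x)^2d\Omega^2,\qquad x\in\mathbb R,$$ with throat $x=0$. It is extended across the horizons ($A(x)=0$, with $x\ne0$ unless $\delta_1=\delta_c$) by ingoing and outgoing Eddington–Finkelstein coordinates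 and, at non-degenerate horizons, by Kruskal-type coordinates around the bifurcation sphere. A *causal geodesic* on an open interval $I$ is an affinely parametrized geodesic of the Levi-Civita connection with nowhere zero tangent $u$, $g(u,u)=-\kappa$, $\kappa=1$ (time-like) or $\kappa=0$ (null), with $E=-g(\partial_t,u)$, not contained in a horizon. Only if $\delta_1\neq\delta_c$ is the metric singular at the throat; there a geodesic is required to be continuous, to have momenta $\frac{A}{\sigma_+}\dot t$ and $r^2\dot n$ (with $n\in S^2$ the angular position) that are continuous across the throat (the condition for extremal length at a corner), and to have $x$ strictly monotone. Geodesics are identified when they have the same $\kappa$, $E$, $x(\lambda)$ and $n(\lambda)$ (that is, up to the isometries $t\mapsto t+\mathrm{const}$). Put $V(x)=\frac{A}{\sigma_+}\big(\kappa+\frac{L^2}{r^2}\big)$. **Theorem.** For all values of the parameters, in particular for every $\delta_1>0$: 1. *Completeness.* Through every point with $A\ne0$ (and $x\neq0$ unless $\delta_1=\delta_c$), with every non-zero time-like (normalized) or null initial velocity, there passes a causal geodesic defined for all $\lambda\in\mathbb R$. Every causal geodesic on an open interval extends to exactly one causal geodesic, with the same $\kappa$ and $E$, on $\mathbb R$.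 The causal geodesics contained in a horizon also extend to all $\lambda\in\mathbb R$ within that horizon, in the Kruskal-type chart if it is non-degenerate and in the Eddington–Finkelstein charts otherwise. 2. *Radial equation.* Along every causal geodesic $L=r^2|\dot n|\ge0$ is constant, and $(\dot x/\sigma_+)^2=E^2-V(x)$ (off the throat if $\delta_1\ne\delta_c$). 3. *Radial null geodesics.* If $\kappa=0$ and $L=0$, then $E\ne0$, and for some choice of the sign and of the origin of $\lambda$ $$\pm E\lambda=\begin{cases}{}_2F_1\big(-\frac14,\frac12;\frac34;\frac{r_c^4}{r^4}\big)\,r,& x\ge0,\\ 2\lambda_0-{}_2F_1\big(-\frac14,\frac12;\frac34;\frac{r_c^4}{r^4}\big)\,r,& x\le0,\end{cases}\qquad\lambda_0={}_2F_1\big(-\tfrac14,\tfrac12;\tfrac34;1\big)r_c .$$ If it is defined on $\mathbb R$, $x(\lambda)$ is strictly monotone and onto $\mathbb R$, so the geodesic crosses the throat. 4. *Reissner–Nordström-like case* $\delta_1>\delta_c$. For every other causal geodesic ($\kappa=1$ or $L\ne0$), $V(x)\to+\infty$ as $x\to0$, and there is $\varepsilon>0$ with $V>E^2$ for $0<|x|<\varepsilon$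 and $|x(\lambda)|\ge\varepsilon$ along the geodesic: it is repelled before the throat. 5. *Schwarzschild-like case* $\delta_1<\delta_c$ *and smooth case* $\delta_1=\delta_c$. Consider a causal geodesic on $\mathbb R$ with $x(\lambda_1)>0$, $\dot x(\lambda_1)<0$, and suppose that it is radial ($L=0$), or that $A(x(\lambda_1))\le0$ (it is at or inside the horizon), or that $\sup_{0<x\le x(\lambda_1)}V<E^2$ (it is above the potential barrier). Then it reaches $x=0$ at a finite $\lambda_2>\lambda_1$, with $x$ strictly decreasing on $[\lambda_1,\lambda_2]$, and $x<0$ just after $\lambda_2$. 6. *Unique extension through a singular throat.* Let $\delta_1\ne\delta_c$, and let $(t,x,n)$ be a causal geodesic in the coordinates $(t,x)$ on $(\lambda_2-\varepsilon,\lambda_2)$ with $x>0$, $A(x)\neq0$ and $x\to0$ as $\lambda\to\lambda_2$. Then it extends (with its time coordinate $t$) to a geodesic on $(\lambda_2-\varepsilon,\lambda_2+\varepsilon)$ through the throat in the above sense, with $x<0$ for $\lambda>\lambda_2$, and this extension is unique. -/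

import Mathlib

open Set Filter Topology

noncomputable section

/-- Euclidean three-space; the directions on the two-sphere are its unit vectors. -/
abbrev Vec3 : Type := EuclideanSpace ℝ (Fin 3)

/-- The parameters of the geonic wormhole: Planck length, charge and (geometric) mass. -/
structure Geon where
  lP : ℝ
  q : ℝ
  M₀ : ℝ
  lP_pos : 0 < lP
  q_pos : 0 < q
  M₀_pos : 0 < M₀

/-- The dimensionless function `G(z) = (2 z³ / 3) (₂F₁(-3/4, 1/2; 1/4; z⁻⁴) - (1 - z⁻⁴)^(3/2))`. -/
def geonG (z : ℝ) : ℝ :=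
  2 * z ^ 3 / 3 *
    (ordinaryHypergeometric (-3 / 4 : ℝ) (1 / 2) (1 / 4) (1 / z ^ 4)
      - (1 - 1 / z ^ 4) ^ (3 / 2 : ℝ))

/-- The critical value `δ_c = -1 / (2 G(1)) ≈ 0.57207`. -/
def deltaC : ℝ := -1 / (2 * geonG 1)

/-- A coordinate patch, with coordinates `p = (a, b)`, of the two-dimensional base (the orbit space
of the rotations) of a static spherically symmetric space-time: the base metric is
`qaa da² + 2 qab da db + qbb db²`, `X` is the radial coordinate `x` as a function of `(a, b)`, and
`Ka ∂_a + Kb ∂_b` is the Killing field `∂_t`. -/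
structure Chart where
  dom : Set (ℝ × ℝ)
  X : ℝ × ℝ → ℝ
  qaa : ℝ × ℝ → ℝ
  qab : ℝ × ℝ → ℝ
  qbb : ℝ × ℝ → ℝ
  Ka : ℝ × ℝ → ℝ
  Kb : ℝ × ℝ → ℝ

/-- Partial derivative with respect to the first coordinate. -/
def pdA (f : ℝ × ℝ → ℝ) (p : ℝ × ℝ) : ℝ := deriv (fun u => f (u, p.2)) p.1

/-- Partial derivative with respect to the second coordinate. -/
def pdB (f : ℝ × ℝ → ℝ) (p : ℝ × ℝ) : ℝ := deriv (fun u => f (p.1, u)) p.2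

namespace Geon

/-- The charge radius. -/
def rq (W : Geon) : ℝ := W.lP * W.q

/-- The Schwarzschild radius. -/
def rS (W : Geon) : ℝ := 2 * W.M₀

/-- The radius of the throat, `r_c = √(√2 l_P r_q)`. -/
def rc (W : Geon) : ℝ := √(√2 * W.lP * W.rq)

/-- The charge-to-mass parameter `δ₁ = r_q² / (r_S r_c)`. -/
def delta1 (W : Geon) : ℝ := W.rq ^ 2 / (W.rS * W.rc)

/-- The areal radius: `r² = (x² + √(x⁴ + 4 r_c⁴)) / 2`, that is, `|x| = r √(1 - r_c⁴ / r⁴)`. -/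
def radius (W : Geon) (x : ℝ) : ℝ := √((x ^ 2 + √(x ^ 4 + 4 * W.rc ^ 4)) / 2)

/-- `σ₊ = 1 + r_c⁴ / r⁴`. -/
def sigmaP (W : Geon) (x : ℝ) : ℝ := 1 + W.rc ^ 4 / W.radius x ^ 4

/-- The metric function `A = 1 - 2 M / |x|`, on both sides of the throat, where the mass function
`M = M₀ - r_q² |x| / (2 r²) + (r_q² / r_c) G(r / r_c)` solves `dM/d|x| = r_q² / (2 r²)`. At `x = 0` it is given its limit in the
case `δ₁ = δ_c`; in the other cases `A` diverges there and the value at `0` is never used. -/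
def A (W : Geon) (x : ℝ) : ℝ :=
  if x = 0 then 1 - W.rq ^ 2 / W.rc ^ 2
  else 1 - W.rS / |x| + W.rq ^ 2 / W.radius x ^ 2
    - 2 * W.rq ^ 2 / W.rc * geonG (W.radius x / W.rc) / |x|

/-- `F = A / σ₊ = -g_tt`. -/
def F (W : Geon) (x : ℝ) : ℝ := W.A x / W.sigmaP x

/-- The effective potential `V = (A / σ₊) (κ + L² / r²)`. -/
def V (W : Geon) (κ L x : ℝ) : ℝ := W.F x * (κ + L ^ 2 / W.radius x ^ 2)

/-- The values of `x` at which the metric is smooth (possibly after a change of coordinates at a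
horizon): all values but the throat `x = 0`, and the throat as well if `δ₁ = δ_c`. -/
def Reg (W : Geon) (x : ℝ) : Prop := x ≠ 0 ∨ W.delta1 = deltaC

/-- Coordinates `(t, x)`: `g = -(A / σ₊) dt² + dx² / (A σ₊) + r² dΩ²`. -/
def static (W : Geon) : Chart where
  dom := {p | W.Reg p.2 ∧ W.A p.2 ≠ 0}
  X p := p.2
  qaa p := -(W.A p.2 / W.sigmaP p.2)
  qab _ := 0
  qbb p := 1 / (W.A p.2 * W.sigmaP p.2)
  Ka _ := 1
  Kb _ := 0

/-- Eddington-Finkelstein coordinates `(w, x)`, `dw = dt + e dx / A` with `e = 1` (ingoing) or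
`e = -1` (outgoing), regular across the horizons: `g = -(A / σ₊) dw² + (2 e / σ₊) dw dx + r² dΩ²`. -/
def eddington (W : Geon) (e : ℝ) : Chart where
  dom := {p | W.Reg p.2}
  X p := p.2
  qaa p := -(W.A p.2 / W.sigmaP p.2)
  qab p := e / W.sigmaP p.2
  qbb _ := 0
  Ka _ := 1
  Kb _ := 0

/-- Kruskal-type coordinates `(U, V)` around the bifurcation sphere `U = V = 0` of a non-degenerate
horizon `x = h`: with `k = A'(h) / 2` the surface gravity, `|U| = exp (k w)` for the ingoing
Eddington-Finkelstein coordinate `w`, and `x = h + U V`. In these coordinates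
`σ₊ g = (2 / k) dU dV + (V² / k²) ((A'(h) s - A(h + s)) / s²) dU² + σ₊ r² dΩ²` with `s = U V`, and the
quotient, which is minus an iterated difference quotient of `A`, is smooth through `s = 0`. -/
def bifurcate (W : Geon) (h : ℝ) : Chart where
  dom := {p | W.Reg (h + p.1 * p.2)}
  X p := h + p.1 * p.2
  qaa p := -(p.2 ^ 2 * dslope (dslope W.A h) h (h + p.1 * p.2))
    / ((deriv W.A h / 2) ^ 2 * W.sigmaP (h + p.1 * p.2))
  qab p := 1 / (deriv W.A h / 2 * W.sigmaP (h + p.1 * p.2))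
  qbb _ := 0
  Ka p := deriv W.A h / 2 * p.1
  Kb p := -(deriv W.A h / 2 * p.2)

/-- The charts that together cover the extension of the space-time across its horizons. -/
def atlas (W : Geon) : Set Chart :=
  {c | c = W.static ∨ c = W.eddington 1 ∨ c = W.eddington (-1) ∨
    ∃ h, W.Reg h ∧ W.A h = 0 ∧ deriv W.A h ≠ 0 ∧ c = W.bifurcate h}

/-- The curve `s ↦ (a s, b s, n s)`, `s ∈ J`, is an affinely parametrized geodesic of the metric
`qaa da² + 2 qab da db + qbb db² + r² |dn|²` (`n` a unit vector of three-space), with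
nowhere vanishing tangent `u`, `g(u, u) = -κ` and `E = -g(∂_t, u)`. The geodesic equation is written
with lowered index, `d/ds (g_{αμ} u^μ) = (1/2) (∂_α g_{μν}) u^μ u^ν`; its angular part is the
geodesic equation on the round sphere embedded in three-space. -/
structure IsGeodesicOn (W : Geon) (c : Chart) (κ E : ℝ) (a b : ℝ → ℝ) (n : ℝ → Vec3)
    (J : Set ℝ) : Prop where
  mem : ∀ s ∈ J, (a s, b s) ∈ c.dom
  unit : ∀ s ∈ J, ‖n s‖ = 1
  diff_a : ∀ s ∈ J, DifferentiableAt ℝ a s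
  diff_b : ∀ s ∈ J, DifferentiableAt ℝ b s
  diff_n : ∀ s ∈ J, DifferentiableAt ℝ n s
  eqn_a : ∀ s ∈ J, HasDerivAt
    (fun s => c.qaa (a s, b s) * deriv a s + c.qab (a s, b s) * deriv b s)
    ((pdA c.qaa (a s, b s) * deriv a s ^ 2 + 2 * pdA c.qab (a s, b s) * (deriv a s * deriv b s)
      + pdA c.qbb (a s, b s) * deriv b s ^ 2
      + pdA (fun p => W.radius (c.X p) ^ 2) (a s, b s) * ‖deriv n s‖ ^ 2) / 2) s
  eqn_b : ∀ s ∈ J, HasDerivAt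
    (fun s => c.qab (a s, b s) * deriv a s + c.qbb (a s, b s) * deriv b s)
    ((pdB c.qaa (a s, b s) * deriv a s ^ 2 + 2 * pdB c.qab (a s, b s) * (deriv a s * deriv b s)
      + pdB c.qbb (a s, b s) * deriv b s ^ 2
      + pdB (fun p => W.radius (c.X p) ^ 2) (a s, b s) * ‖deriv n s‖ ^ 2) / 2) s
  eqn_n : ∀ s ∈ J, HasDerivAt
    (fun s => W.radius (c.X (a s, b s)) ^ 2 • deriv n s)
    (-(W.radius (c.X (a s, b s)) ^ 2 * ‖deriv n s‖ ^ 2) • n s) s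
  tangent_ne_zero : ∀ s ∈ J, ¬(deriv a s = 0 ∧ deriv b s = 0 ∧ deriv n s = 0)
  norm_tangent : ∀ s ∈ J,
    c.qaa (a s, b s) * deriv a s ^ 2 + 2 * c.qab (a s, b s) * (deriv a s * deriv b s)
      + c.qbb (a s, b s) * deriv b s ^ 2
      + W.radius (c.X (a s, b s)) ^ 2 * ‖deriv n s‖ ^ 2 = -κ
  energy : ∀ s ∈ J,
    -(c.qaa (a s, b s) * (c.Ka (a s, b s) * deriv a s)
      + c.qab (a s, b s) * (c.Ka (a s, b s) * deriv b s + c.Kb (a s, b s) * deriv a s)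
      + c.qbb (a s, b s) * (c.Kb (a s, b s) * deriv b s)) = E

/-- The continuous curve `(t, x, n)` passes at parameter `s₀` from one side of a singular throat
`x = 0` to the other and extremizes the length there: on both sides it is a geodesic with the same
norm of the tangent, and the momenta `(A / σ₊) t'` and `r² n'` conjugate to the coordinates along the
throat have no jump (this is the condition that the first variation vanishes at the corner).
The sign of `x'` is the same on both sides. -/
structure IsThroatCrossing (W : Geon) (κ E : ℝ) (t x : ℝ → ℝ) (n : ℝ → Vec3) (s₀ ε : ℝ) :
    Prop where
  pos : 0 < ε
  left : ∃ E', W.IsGeodesicOn W.static κ E' t x n (Ioo (s₀ - ε) s₀)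
  right : ∃ E', W.IsGeodesicOn W.static κ E' t x n (Ioo s₀ (s₀ + ε))
  zero : x s₀ = 0
  cont_t : ContinuousAt t s₀
  cont_x : ContinuousAt x s₀
  cont_n : ContinuousAt n s₀
  momentum_t : Tendsto (fun s => W.F (x s) * deriv t s) (𝓝[≠] s₀) (𝓝 E)
  momentum_n : ∃ m : Vec3, Tendsto (fun s => W.radius (x s) ^ 2 • deriv n s) (𝓝[≠] s₀) (𝓝 m)
  crosses : StrictMonoOn x (Ioo (s₀ - ε) (s₀ + ε)) ∨ StrictAntiOn x (Ioo (s₀ - ε) (s₀ + ε))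

/-- A time-like (`κ = 1`) or null (`κ = 0`) geodesic with energy `E`, with affine parameter running
through the open interval `I`, in the wormhole space-time extended across its horizons. It is given by
its radial coordinate `x` and its direction `n`; the remaining coordinate (`t`, `w`, or one of
`U`, `V`) is then determined by `E` up to the isometries `t ↦ t + const`, and is asked for locally.
The curve is required to meet the region where the coordinates `(t, x)` are defined, that is, not to
lie entirely in a horizon. -/
structure IsCausalGeodesic (W : Geon) (κ E : ℝ) (I : Set ℝ) (x : ℝ → ℝ) (n : ℝ → Vec3) :
    Prop where
  causal : κ = 0 ∨ κ = 1
  isOpen : IsOpen I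
  ordConnected : I.OrdConnected
  meets : ∃ s ∈ I, W.Reg (x s) ∧ W.A (x s) ≠ 0
  regular : ∀ s₀ ∈ I, W.Reg (x s₀) → ∃ c ∈ W.atlas, ∃ ε > 0, ∃ a b : ℝ → ℝ,
    Ioo (s₀ - ε) (s₀ + ε) ⊆ I ∧
    W.IsGeodesicOn c κ E a b n (Ioo (s₀ - ε) (s₀ + ε)) ∧
    ∀ s ∈ Ioo (s₀ - ε) (s₀ + ε), x s = c.X (a s, b s)
  throat : ∀ s₀ ∈ I, ¬W.Reg (x s₀) → ∃ ε > 0, ∃ t : ℝ → ℝ,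
    Ioo (s₀ - ε) (s₀ + ε) ⊆ I ∧ W.IsThroatCrossing κ E t x n s₀ ε

/-- `c` is a chart containing the horizon `x = h` up to its ends: the Kruskal-type chart for a
non-degenerate horizon, an Eddington-Finkelstein chart for a degenerate one. -/
def IsHorizonChart (W : Geon) (h : ℝ) (c : Chart) : Prop :=
  W.Reg h ∧ W.A h = 0 ∧
    ((deriv W.A h ≠ 0 ∧ c = W.bifurcate h) ∨
      (deriv W.A h = 0 ∧ (c = W.eddington 1 ∨ c = W.eddington (-1))))

/-- `r ₂F₁(-1/4, 1/2; 3/4; r_c⁴ / r⁴)` as a function of `x`. -/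
def rayBranch (W : Geon) (x : ℝ) : ℝ :=
  ordinaryHypergeometric (-1 / 4 : ℝ) (1 / 2) (3 / 4) (W.rc ^ 4 / W.radius x ^ 4) * W.radius x

/-- The affine parameter (times `± E`) of a radial null geodesic as a function of `x`. -/
def rayParam (W : Geon) (x : ℝ) : ℝ :=
  if 0 ≤ x then W.rayBranch x
  else 2 * (ordinaryHypergeometric (-1 / 4 : ℝ) (1 / 2) (3 / 4) (1 : ℝ) * W.rc) - W.rayBranch x

end Geon

end

/-!
The radial coordinate of a geodesic moves like a particle in one dimension: with `y = x' / σ₊` the geodesic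
equations reduce, in every chart, to `y² = E² - V(x)` and `y' = -σ₊ V'(x) / 2` (`RadialAt`), together with the
equation of a great circle for the direction `n`, traversed with `r² |n'| = L` (`AngularAt`). These equations
have no singularity at the horizons. Conversely a solution lifts to a geodesic: where `A ≠ 0` the time is an
integral; at a horizon with `E ≠ 0` one has `y = ± E`, and one of the two Eddington-Finkelstein coordinates is
an integral; a solution with `E = 0` reaches only non-degenerate horizons, by uniqueness, and there it passes
through the bifurcation sphere (`exists_bifurcate_lift`).

The geometry enters through the decomposition `A = 1 - N(x) / x - m₀ / |x|` (`A_eq`), where `N` is the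
primitive of `r_q² / r²` that vanishes at the throat, an analytic odd function, and
`m₀ = r_S (1 - δ₁ / δ_c)`. It follows from the first order differential equation
`f + (z / a) f' = (1 - z)^(-1/2)` of `f = ₂F₁(a, 1/2; a + 1; ·)`, with `a = -3/4`; with `a = -1/4` the same
equation gives the affine parameter of the radial null geodesics. So `A` is analytic off the throat, and at the
throat if `m₀ = 0`, while `A` tends to `+∞` or to `-∞` there according to the sign of `-m₀`.

Completeness (`exists_motion_univ`) is a continuation argument. Away from a singular throat the potential is
bounded, so that a motion on a bounded interval stays in a compact set of regular states, or returns to it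
infinitely often, and is continued by the local existence theorem. Otherwise it tends to the throat. Then it is
not slow near the throat (`exists_speed_bound`), hence it is monotone, and it continues by the point reflection
`x(T + s) = -x(T - s)`, a symmetry of the equations since `V` is even (`exists_reflection`). A monotone motion
out of the throat is unique, because two of them differ by a translation of the parameter
(`eqOn_of_strictMonoOn_right`). The momenta conjugate to `t` and `n` are continuous at the throat exactly if
`E` and `L` are the same on both sides (`IsThroatCrossing.exists_motion`, `isThroatCrossing_of_motion`).

For `m₀ < 0` the potential tends to `+∞` at the throat unless it vanishes identically, which repels all
geodesics other than the radial null ones. For `m₀ ≥ 0` the function `A` increases with `x > 0` (`A_le_A`),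
which excludes potential barriers ahead of an infalling geodesic that is radial or inside the horizon
(`exists_barrier_lt`); without a barrier the speed is bounded from below and the throat is reached in finite
time.
-/

noncomputable section

/-! ### Hypergeometric functions with parameters `a, 1/2, a + 1` -/

/-- The coefficients `(1/2)ₙ / n!` of the binomial series of `(1 - z)^(-1/2)`. -/
def halfCoeff (n : ℕ) : ℝ := (n.factorial : ℝ)⁻¹ * (ascPochhammer ℝ n).eval (1 / 2 : ℝ)

lemma halfCoeff_zero : halfCoeff 0 = 1 := by simp [halfCoeff]

lemma halfCoeff_succ (n : ℕ) :
    halfCoeff (n + 1) = halfCoeff n * ((2 * n + 1) / (2 * n + 2)) := by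
  simp only [halfCoeff, ascPochhammer_succ_eval, Nat.factorial_succ]
  push_cast
  have : (n.factorial : ℝ) ≠ 0 := by exact_mod_cast n.factorial_ne_zero
  field_simp
  ring

lemma halfCoeff_pos (n : ℕ) : 0 < halfCoeff n := by
  induction n with
  | zero => simp [halfCoeff_zero]
  | succ n ih => rw [halfCoeff_succ]; positivity

lemma halfCoeff_le_one (n : ℕ) : halfCoeff n ≤ 1 := by
  induction n with
  | zero => simp [halfCoeff_zero]
  | succ n ih =>
    rw [halfCoeff_succ]
    have h1 : ((2 * n + 1) / (2 * n + 2) : ℝ) ≤ 1 := by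
      rw [div_le_one (by positivity)]; linarith
    have := halfCoeff_pos n
    have h0 : (0 : ℝ) ≤ (2 * n + 1) / (2 * n + 2) := by positivity
    nlinarith

/-- The series telescopes, since `bₙ / (2 n + 2) = bₙ - bₙ₊₁`. -/
lemma summable_halfCoeff_div : Summable fun n : ℕ => halfCoeff n / (2 * n + 2) := by
  refine summable_of_sum_range_le (c := 1) (fun n => by have := halfCoeff_pos n; positivity) ?_
  intro n
  have h : ∀ n : ℕ, halfCoeff n / (2 * n + 2) = halfCoeff n - halfCoeff (n + 1) := by
    intro n
    rw [halfCoeff_succ]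
    field_simp
    ring
  simp_rw [h]
  rw [Finset.sum_range_sub', halfCoeff_zero]
  linarith [halfCoeff_pos n]

lemma hasSum_halfCoeff {z : ℝ} (hz : |z| < 1) :
    HasSum (fun n => halfCoeff n * z ^ n) (1 / √(1 - z)) := by
  have h := (Real.one_div_one_sub_rpow_hasFPowerSeriesOnBall_zero (1 / 2)).hasSum
    (y := z) (by simpa [enorm_eq_nnnorm, ← NNReal.coe_lt_one] using hz)
  have hc : ∀ n : ℕ, Ring.choose ((1 / 2 : ℝ) + n - 1) n = halfCoeff n := by
    intro n
    have h1 := Ring.factorial_nsmul_multichoose_eq_ascPochhammer (1 / 2 : ℝ) n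
    have h2 : Ring.choose ((1 / 2 : ℝ) + n - 1) n = Ring.multichoose (1 / 2 : ℝ) n := by
      rw [Ring.choose]; congr 1; ring
    rw [h2, halfCoeff, ← Polynomial.ascPochhammer_smeval_eq_eval,
      Polynomial.ascPochhammer_smeval_cast, ← h1, nsmul_eq_mul]
    have : (n.factorial : ℝ) ≠ 0 := by exact_mod_cast n.factorial_ne_zero
    field_simp
  rw [zero_add, ← Real.sqrt_eq_rpow] at h
  refine h.congr_fun ?_
  intro n
  rw [FormalMultilinearSeries.ofScalars_apply_eq, hc, smul_eq_mul]

/-- The coefficients of `₂F₁(a, 1/2; a + 1; ·)`. -/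
def hypCoeff (a : ℝ) (n : ℕ) : ℝ := halfCoeff n * (a / (a + n))

lemma add_natCast_ne_zero {a : ℝ} (h0 : -1 < a) (h1 : a < 0) (n : ℕ) : a + n ≠ 0 := by
  rcases n with _ | n
  · simpa using h1.ne
  · push_cast
    have : (0 : ℝ) ≤ n := Nat.cast_nonneg n
    linarith

/-- With the parameters `a` and `a + 1` the quotient of the Pochhammer symbols collapses:
`(a)ₙ / (a + 1)ₙ = a / (a + n)`. -/
lemma hypergeometric_eq_tsum {a : ℝ} (h0 : -1 < a) (h1 : a < 0) (z : ℝ) :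
    ordinaryHypergeometric a (1 / 2) (a + 1) z = ∑' n : ℕ, hypCoeff a n * z ^ n := by
  rw [ordinaryHypergeometric_eq_tsum]
  refine tsum_congr fun n => ?_
  rw [smul_eq_mul]
  congr 1
  have key : (ascPochhammer ℝ n).eval a * (a + n) = a * (ascPochhammer ℝ n).eval (a + 1) := by
    rw [← ascPochhammer_succ_eval, ascPochhammer_succ_left]
    simp
  have hne := add_natCast_ne_zero h0 h1 n
  have hpos : (ascPochhammer ℝ n).eval (a + 1) ≠ 0 :=
    (ascPochhammer_pos n (a + 1) (by linarith)).ne'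
  rw [hypCoeff, halfCoeff]
  have : (ascPochhammer ℝ n).eval a = a * (ascPochhammer ℝ n).eval (a + 1) / (a + n) := by
    rw [← key]; field_simp
  rw [this]
  field_simp

/-- Comparison with the telescoping series, for the convergence at `z = 1`. -/
lemma abs_hypCoeff_le {a : ℝ} (h0 : -1 < a) (h1 : a < 0) (n : ℕ) :
    |hypCoeff a n| ≤ 4 / (1 + a) * (halfCoeff n / (2 * n + 2)) := by
  have hb := halfCoeff_pos n
  rw [hypCoeff, abs_mul, abs_of_pos hb, abs_div, abs_of_neg h1]
  have h3 : (0 : ℝ) < 1 + a := by linarith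
  have : -a / |a + n| ≤ 4 / (1 + a) / (2 * n + 2) := by
    rcases n with _ | n
    · simp only [Nat.cast_zero, add_zero, abs_of_neg h1, mul_zero, zero_add]
      rw [div_self (by linarith), le_div_iff₀ (by norm_num), le_div_iff₀ h3]
      linarith
    · push_cast
      have hn : (0 : ℝ) ≤ n := Nat.cast_nonneg n
      rw [abs_of_pos (by linarith), div_div, div_le_div_iff₀ (by linarith) (by positivity)]
      nlinarith [mul_nonneg hn h3.le, mul_nonneg (mul_nonneg hn h3.le) h3.le]
  calc halfCoeff n * (-a / |a + n|) ≤ halfCoeff n * (4 / (1 + a) / (2 * n + 2)) := by gcongr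
    _ = _ := by ring

/-- The series converges uniformly up to the end point `z = 1`, the value of the argument at the throat. -/
lemma continuousOn_hypergeometric {a : ℝ} (h0 : -1 < a) (h1 : a < 0) :
    ContinuousOn (fun z : ℝ => ordinaryHypergeometric a (1 / 2) (a + 1) z) (Icc 0 1) := by
  simp_rw [hypergeometric_eq_tsum h0 h1]
  refine continuousOn_tsum (u := fun n : ℕ => 4 / (1 + a) * (halfCoeff n / (2 * n + 2)))
    (fun n => by fun_prop) (summable_halfCoeff_div.mul_left _) ?_
  intro n z hz
  rw [Real.norm_eq_abs, abs_mul]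
  have : |z ^ n| ≤ 1 := by
    rw [abs_of_nonneg (pow_nonneg hz.1 n)]; exact pow_le_one₀ hz.1 hz.2
  calc |hypCoeff a n| * |z ^ n| ≤ |hypCoeff a n| * 1 := by gcongr
    _ ≤ _ := by rw [mul_one]; exact abs_hypCoeff_le h0 h1 n

/-- The first order differential equation `f + (z / a) f' = (1 - z)^(-1/2)` of
`f = ₂F₁(a, 1/2; a + 1; ·)`, read off from the coefficients. -/
lemma hasDerivAt_hypergeometric {a : ℝ} (h0 : -1 < a) (h1 : a < 0) {z : ℝ} (hz : |z| < 1) :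
    ∃ d, HasDerivAt (fun z : ℝ => ordinaryHypergeometric a (1 / 2) (a + 1) z) d z ∧
      ordinaryHypergeometric a (1 / 2) (a + 1) z + z / a * d = 1 / √(1 - z) := by
  -- differentiate the series term by term on `|z| < ρ < 1`
  obtain ⟨ρ, hρ1, hρ2⟩ := exists_between hz
  have hρ0 : 0 < ρ := (abs_nonneg z).trans_lt hρ1
  simp_rw [hypergeometric_eq_tsum h0 h1]
  have hC : ∀ n, |hypCoeff a n| ≤ 4 / (1 + a) := by
    intro n
    refine (abs_hypCoeff_le h0 h1 n).trans ?_
    have h3 : (0 : ℝ) < 1 + a := by linarith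
    have : halfCoeff n / (2 * n + 2) ≤ 1 := by
      rw [div_le_one (by positivity)]
      have : (0 : ℝ) ≤ n := Nat.cast_nonneg n
      linarith [halfCoeff_le_one n]
    calc _ ≤ 4 / (1 + a) * 1 := by gcongr
      _ = _ := mul_one _
  have hu : Summable fun n : ℕ => 4 / (1 + a) * (n * ρ ^ (n - 1)) := by
    refine Summable.mul_left _ ?_
    have := summable_pow_mul_geometric_of_norm_lt_one (R := ℝ) 1
      (r := ρ) (by rwa [Real.norm_eq_abs, abs_of_pos hρ0])
    refine (this.mul_right ρ⁻¹).congr fun n => ?_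
    rcases n with _ | n
    · simp
    · simp [pow_succ]; field_simp
  have hderiv : ∀ (n : ℕ) (y : ℝ), y ∈ Ioo (-ρ) ρ →
      HasDerivAt (fun z : ℝ => hypCoeff a n * z ^ n) (hypCoeff a n * (n * y ^ (n - 1))) y :=
    fun n y _ => (hasDerivAt_pow n y).const_mul _
  have hbound : ∀ (n : ℕ) (y : ℝ), y ∈ Ioo (-ρ) ρ →
      ‖hypCoeff a n * (n * y ^ (n - 1))‖ ≤ 4 / (1 + a) * (n * ρ ^ (n - 1)) := by
    intro n y hy
    rw [Real.norm_eq_abs, abs_mul, abs_mul, abs_pow, Nat.abs_cast]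
    have hy' : |y| ≤ ρ := (abs_lt.2 hy).le
    have := hC n
    have h3 : 0 ≤ 4 / (1 + a) := (abs_nonneg _).trans this
    gcongr
  have hz0 : Summable fun n => hypCoeff a n * (0 : ℝ) ^ n := by
    refine summable_of_ne_finset_zero (s := {0}) fun n hn => ?_
    simp at hn
    simp [hn]
  have hzm : z ∈ Ioo (-ρ) ρ := abs_lt.1 hρ1
  have hd := hasDerivAt_tsum_of_isPreconnected hu isOpen_Ioo isPreconnected_Ioo hderiv hbound
    (y₀ := 0) ⟨by linarith, hρ0⟩ hz0 hzm
  have hs := summable_of_summable_hasDerivAt_of_isPreconnected hu isOpen_Ioo isPreconnected_Ioo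
    hderiv hbound (y₀ := 0) ⟨by linarith, hρ0⟩ hz0 hzm
  refine ⟨_, hd, ?_⟩
  have hs' : Summable fun n : ℕ => hypCoeff a n * (n * z ^ (n - 1)) :=
    Summable.of_norm_bounded hu fun n => hbound n z hzm
  rw [← tsum_mul_left, ← hs.tsum_add (hs'.mul_left _), ← (hasSum_halfCoeff hz).tsum_eq]
  -- both sides have the same coefficients, since `(a / (a + n)) (1 + n / a) = 1`
  refine tsum_congr fun n => ?_
  have hne := add_natCast_ne_zero h0 h1 n
  rw [hypCoeff]
  rcases n with _ | n
  · simp [h1.ne]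
  · simp only [Nat.add_sub_cancel, pow_succ]
    push_cast at hne ⊢
    field_simp [h1.ne]

/-- `₂F₁(-3/4, 1/2; 1/4; 1) < 0`: the terms of order `0` and `1` add up to `-1/2` and all others are
negative. -/
lemma hypergeometric_neg_three_quarters_one_neg :
    ordinaryHypergeometric (-3 / 4 : ℝ) (1 / 2) (1 / 4) (1 : ℝ) < 0 := by
  have h : (1 / 4 : ℝ) = -3 / 4 + 1 := by norm_num
  rw [h, hypergeometric_eq_tsum (by norm_num) (by norm_num)]
  simp only [one_pow, mul_one]
  have hs : Summable (hypCoeff (-3 / 4)) :=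
    Summable.of_norm_bounded (summable_halfCoeff_div.mul_left _)
      fun n => abs_hypCoeff_le (by norm_num) (by norm_num) n
  rw [← hs.sum_add_tsum_nat_add 2]
  have h1 : ∑ i ∈ Finset.range 2, hypCoeff (-3 / 4) i = -1 / 2 := by
    simp [Finset.sum_range_succ, hypCoeff, halfCoeff_zero, halfCoeff_succ 0]
    norm_num
  have h2 : ∑' n : ℕ, hypCoeff (-3 / 4) (n + 2) ≤ 0 := by
    refine tsum_nonpos fun n => ?_
    rw [hypCoeff]
    refine mul_nonpos_of_nonneg_of_nonpos (halfCoeff_pos _).le ?_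
    push_cast
    exact div_nonpos_of_nonpos_of_nonneg (by norm_num)
      (by have : (0 : ℝ) ≤ n := Nat.cast_nonneg n; linarith)
  linarith

/-! ### Primitives of real analytic functions -/

/-- A real analytic function of one variable is locally the restriction of a holomorphic function. -/
lemma AnalyticAt.exists_complex_extension {f : ℝ → ℝ} {x₀ : ℝ} (hf : AnalyticAt ℝ f x₀) :
    ∃ g : ℂ → ℂ, ∃ r > 0, DifferentiableOn ℂ g (Metric.ball 0 r) ∧
      ∀ y : ℝ, |y| < r → g y = f (x₀ + y) := by
  obtain ⟨p, ρ, hp⟩ := hf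
  obtain ⟨s, hs0, hsρ⟩ := ENNReal.lt_iff_exists_nnreal_btwn.1 hp.r_pos
  have hs0' : (0 : ℝ) < s := by exact_mod_cast hs0
  obtain ⟨C, hC0, hC⟩ := p.norm_mul_pow_le_of_lt_radius (hsρ.trans_le hp.r_le)
  -- the same power series, with its argument in `ℂ`
  set P := FormalMultilinearSeries.ofScalars ℂ (fun n => (p.coeff n : ℂ)) with hP
  have hrad : (s : ENNReal) ≤ P.radius := by
    refine P.le_radius_of_bound C fun n => ?_
    have h1 : ‖P n‖ = ‖p n‖ := by
      rw [hP, FormalMultilinearSeries.ofScalars_norm, Complex.norm_real,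
        FormalMultilinearSeries.norm_apply_eq_norm_coef]
    rw [h1]
    exact hC n
  have hPs := P.hasFPowerSeriesOnBall (by
    refine lt_of_lt_of_le ?_ hrad
    exact_mod_cast hs0')
  refine ⟨P.sum, s, hs0', ?_, ?_⟩
  · refine hPs.differentiableOn.mono fun z hz => ?_
    have h2 : (‖z‖ₑ) < s := by
      have : ‖z‖ < s := by simpa using hz
      rw [enorm_eq_nnnorm]
      exact_mod_cast this
    simpa using h2.trans_le hrad
  · intro y hy
    have h1 := hp.hasSum (y := y) (by
      have : (‖y‖ₑ) < s := by
        rw [enorm_eq_nnnorm]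
        exact_mod_cast (show ‖y‖ < (s : ℝ) from hy)
      simpa using this.trans hsρ)
    have h2 : HasSum (fun n => (P n fun _ => (y : ℂ))) ((f (x₀ + y) : ℝ) : ℂ) := by
      have := Complex.hasSum_ofReal.2 h1
      refine this.congr_fun fun n => ?_
      rw [hP, FormalMultilinearSeries.ofScalars_apply_eq, p.apply_eq_pow_smul_coeff]
      simp [mul_comm]
    exact h2.tsum_eq

/-- A primitive of a real analytic function is real analytic: it differs by a constant from the real part of
a primitive of a holomorphic extension. -/
lemma AnalyticAt.of_hasDerivAt {F f : ℝ → ℝ} {x₀ : ℝ} (hf : AnalyticAt ℝ f x₀)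
    (hF : ∀ᶠ x in 𝓝 x₀, HasDerivAt F (f x) x) : AnalyticAt ℝ F x₀ := by
  obtain ⟨g, r, hr, hg, hgf⟩ := hf.exists_complex_extension
  obtain ⟨G, hG⟩ := hg.isExactOn_ball
  obtain ⟨δ, hδ, hFδ⟩ := Metric.eventually_nhds_iff_ball.1 hF
  set H : ℝ → ℝ := fun x => (G ((x - x₀ : ℝ) : ℂ)).re with hH
  have hHan : AnalyticAt ℝ H x₀ := by
    have h1 : AnalyticAt ℂ G ((Complex.ofRealCLM (x₀ - x₀))) := by
      have : DifferentiableOn ℂ G (Metric.ball 0 r) :=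
        fun z hz => (hG z hz).differentiableAt.differentiableWithinAt
      exact this.analyticAt (by simpa using Metric.ball_mem_nhds (0 : ℂ) hr)
    have h2 : AnalyticAt ℝ (fun x : ℝ => Complex.ofRealCLM (x - x₀)) x₀ :=
      (Complex.ofRealCLM.analyticAt _).comp (analyticAt_id.sub analyticAt_const)
    have h3 : AnalyticAt ℝ (fun x : ℝ => G (Complex.ofRealCLM (x - x₀))) x₀ :=
      h1.restrictScalars.fun_comp_of_eq h2 rfl
    exact (Complex.reCLM.analyticAt _).comp h3
  have hHd : ∀ x ∈ Metric.ball x₀ (min r δ), HasDerivAt H (f x) x := by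
    intro x hx
    have hx' : |x - x₀| < r := by
      have := (Metric.mem_ball.1 hx).trans_le (min_le_left _ _)
      rwa [Real.dist_eq] at this
    have h1 := hG ((x - x₀ : ℝ) : ℂ) (by
      rw [mem_ball_zero_iff, Complex.norm_real]; exact hx')
    rw [hgf _ hx', add_sub_cancel] at h1
    have h2 : HasDerivAt (fun y : ℂ => G (y - x₀)) (f x : ℂ) (x : ℂ) := by
      have h3 : HasDerivAt (fun y : ℂ => y - x₀) 1 (x : ℂ) := (hasDerivAt_id _).sub_const _
      rw [Complex.ofReal_sub] at h1
      simpa [Function.comp_def] using HasDerivAt.comp (x : ℂ) h1 h3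
    simpa [hH] using h2.real_of_complex
  have hcon : ∀ x ∈ Metric.ball x₀ (min r δ), F x = H x + (F x₀ - H x₀) := by
    intro x hx
    have h0 : x₀ ∈ Metric.ball x₀ (min r δ) := Metric.mem_ball_self (lt_min hr hδ)
    have := (convex_ball x₀ (min r δ)).isPreconnected
    have h1 : ∀ z ∈ Metric.ball x₀ (min r δ), HasDerivAt (fun x => F x - H x) 0 z := by
      intro z hz
      simpa using (hFδ z (Metric.ball_subset_ball (min_le_right _ _) hz)).fun_sub (hHd z hz)
    have h2 := Metric.isOpen_ball.is_const_of_deriv_eq_zero this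
      (fun z hz => (h1 z hz).differentiableAt.differentiableWithinAt)
      (fun z hz => (h1 z hz).deriv) hx h0
    linarith
  refine (hHan.fun_add (analyticAt_const (v := F x₀ - H x₀))).congr ?_
  filter_upwards [Metric.ball_mem_nhds x₀ (lt_min hr hδ)] with x hx
  exact (hcon x hx).symm

lemma AnalyticAt.dslope_self {f : ℝ → ℝ} {x₀ : ℝ} (hf : AnalyticAt ℝ f x₀) :
    AnalyticAt ℝ (dslope f x₀) x₀ := by
  obtain ⟨p, hp⟩ := hf
  exact ⟨_, hp.has_fpower_series_dslope_fslope⟩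

lemma AnalyticAt.dslope_of_analyticAt {f : ℝ → ℝ} {x₀ x : ℝ} (hf : AnalyticAt ℝ f x) (hf₀ : AnalyticAt ℝ f x₀) :
    AnalyticAt ℝ (dslope f x₀) x := by
  rcases eq_or_ne x x₀ with rfl | h
  · exact hf.dslope_self
  · have : (fun y => (y - x₀)⁻¹ * (f y - f x₀)) =ᶠ[𝓝 x] dslope f x₀ := by
      filter_upwards [isOpen_ne.mem_nhds h] with y hy
      rw [dslope_of_ne _ hy, slope_def_field, div_eq_inv_mul]
    refine AnalyticAt.congr ?_ this
    exact ((analyticAt_id.sub analyticAt_const).inv (sub_ne_zero.2 h)).mul (hf.sub analyticAt_const)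

lemma AnalyticAt.real_sqrt {f : ℝ → ℝ} {x : ℝ} (hf : AnalyticAt ℝ f x) (h : f x ≠ 0) :
    AnalyticAt ℝ (fun y => √(f y)) x :=
  (Real.contDiffAt_sqrt (n := ⊤) h).analyticAt.comp hf

namespace Geon

/-! ### The areal radius and `σ₊` -/

lemma rq_pos (W : Geon) : 0 < W.rq := mul_pos W.lP_pos W.q_pos

lemma rS_pos (W : Geon) : 0 < W.rS := mul_pos two_pos W.M₀_pos

lemma rc_pos (W : Geon) : 0 < W.rc := by
  have := W.rq_pos
  have := W.lP_pos
  unfold rc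
  positivity

lemma radius_sq (W : Geon) (x : ℝ) :
    W.radius x ^ 2 = (x ^ 2 + √(x ^ 4 + 4 * W.rc ^ 4)) / 2 := by
  rw [radius, Real.sq_sqrt (by positivity)]

lemma radius_pos (W : Geon) (x : ℝ) : 0 < W.radius x := by
  have := W.rc_pos
  unfold radius
  positivity

/-- The algebraic equation `x² = r² - r_c⁴ / r²` between `x` and `r`, without denominators. -/
lemma sq_mul_radius_sq (W : Geon) (x : ℝ) :
    x ^ 2 * W.radius x ^ 2 = W.radius x ^ 4 - W.rc ^ 4 := by
  have h := W.radius_sq x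
  have hs : √(x ^ 4 + 4 * W.rc ^ 4) ^ 2 = x ^ 4 + 4 * W.rc ^ 4 :=
    Real.sq_sqrt (by have := W.rc_pos; positivity)
  have h4 : W.radius x ^ 4 = (W.radius x ^ 2) ^ 2 := by ring
  rw [h4, h]
  nlinarith

lemma radius_le_of_abs_le (W : Geon) {x y : ℝ} (h : |x| ≤ |y|) : W.radius x ≤ W.radius y := by
  have h2 : x ^ 2 ≤ y ^ 2 := sq_le_sq.2 h
  have h4 : x ^ 4 ≤ y ^ 4 := by nlinarith [sq_nonneg x, sq_nonneg y]
  unfold radius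
  gcongr

lemma radius_neg (W : Geon) (x : ℝ) : W.radius (-x) = W.radius x :=
  le_antisymm (W.radius_le_of_abs_le (by simp)) (W.radius_le_of_abs_le (by simp))

lemma radius_zero (W : Geon) : W.radius 0 = W.rc := by
  have h := W.sq_mul_radius_sq 0
  have := W.radius_pos 0
  have := W.rc_pos
  have h4 : W.radius 0 ^ 4 = W.rc ^ 4 := by linarith
  exact (pow_left_inj₀ (by positivity) (by positivity) (by norm_num)).1 h4

lemma rc_le_radius (W : Geon) (x : ℝ) : W.rc ≤ W.radius x := by
  rw [← W.radius_zero]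
  exact W.radius_le_of_abs_le (by simp)

lemma rc_lt_radius (W : Geon) {x : ℝ} (hx : x ≠ 0) : W.rc < W.radius x := by
  refine lt_of_le_of_ne (W.rc_le_radius x) fun h => ?_
  have h1 := W.sq_mul_radius_sq x
  rw [← h] at h1
  have := W.rc_pos
  have : 0 < x ^ 2 * W.rc ^ 2 := by positivity
  linarith

lemma sigmaP_pos (W : Geon) (x : ℝ) : 0 < W.sigmaP x := by
  have := W.radius_pos x
  unfold sigmaP
  positivity

lemma one_le_sigmaP (W : Geon) (x : ℝ) : 1 ≤ W.sigmaP x := by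
  have := W.radius_pos x
  unfold sigmaP
  have : 0 ≤ W.rc ^ 4 / W.radius x ^ 4 := by positivity
  linarith

lemma sigmaP_le_two (W : Geon) (x : ℝ) : W.sigmaP x ≤ 2 := by
  have h := W.radius_pos x
  have : W.rc ^ 4 / W.radius x ^ 4 ≤ 1 := by
    rw [div_le_one (by positivity)]
    exact pow_le_pow_left₀ W.rc_pos.le (W.rc_le_radius x) 4
  unfold sigmaP
  linarith

lemma sigmaP_neg (W : Geon) (x : ℝ) : W.sigmaP (-x) = W.sigmaP x := by
  simp [sigmaP, radius_neg]

lemma sigmaP_le_of_abs_le (W : Geon) {x y : ℝ} (h : |x| ≤ |y|) : W.sigmaP y ≤ W.sigmaP x := by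
  have := W.radius_pos x
  have := W.radius_le_of_abs_le h
  unfold sigmaP
  have := W.rc_pos
  gcongr

lemma analyticAt_radius (W : Geon) (x : ℝ) : AnalyticAt ℝ W.radius x := by
  have h4 : x ^ 4 + 4 * W.rc ^ 4 ≠ 0 := by have := W.rc_pos; positivity
  have h1 : AnalyticAt ℝ (fun x : ℝ => √(x ^ 4 + 4 * W.rc ^ 4)) x :=
    AnalyticAt.real_sqrt (by fun_prop) h4
  have h2 : AnalyticAt ℝ (fun x : ℝ => (x ^ 2 + √(x ^ 4 + 4 * W.rc ^ 4)) / 2) x := by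
    refine AnalyticAt.fun_div (AnalyticAt.fun_add (by fun_prop) h1) (by fun_prop) two_ne_zero
  refine AnalyticAt.real_sqrt h2 ?_
  have := W.rc_pos
  positivity

lemma analyticAt_sigmaP (W : Geon) (x : ℝ) : AnalyticAt ℝ W.sigmaP x := by
  have h := W.analyticAt_radius x
  have : W.radius x ^ 4 ≠ 0 := by have := W.radius_pos x; positivity
  exact analyticAt_const.fun_add (analyticAt_const.fun_div (h.fun_pow 4) this)

lemma continuous_radius (W : Geon) : Continuous W.radius :=
  continuous_iff_continuousAt.2 fun x => (W.analyticAt_radius x).continuousAt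

lemma continuous_sigmaP (W : Geon) : Continuous W.sigmaP :=
  continuous_iff_continuousAt.2 fun x => (W.analyticAt_sigmaP x).continuousAt

lemma sigmaP_mul (W : Geon) (x : ℝ) :
    W.sigmaP x * W.radius x ^ 4 = W.radius x ^ 4 + W.rc ^ 4 := by
  have := W.radius_pos x
  unfold sigmaP
  field_simp

lemma hasDerivAt_radius (W : Geon) (x : ℝ) :
    HasDerivAt W.radius (x / (W.radius x * W.sigmaP x)) x := by
  have hd := (W.analyticAt_radius x).differentiableAt.hasDerivAt
  have hr := W.radius_pos x
  have hσ := W.sigmaP_pos x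
  -- differentiate the algebraic equation between `x` and `r`
  have h1 : HasDerivAt (fun x => x ^ 2 * W.radius x ^ 2)
      (2 * x * W.radius x ^ 2 + x ^ 2 * (2 * W.radius x * deriv W.radius x)) x := by
    simpa using (hasDerivAt_pow 2 x).fun_mul (hd.fun_pow 2)
  have h2 : HasDerivAt (fun x => x ^ 2 * W.radius x ^ 2)
      (4 * W.radius x ^ 3 * deriv W.radius x) x := by
    simp_rw [W.sq_mul_radius_sq]
    simpa using (hd.fun_pow 4).sub_const (W.rc ^ 4)
  have h3 := h1.unique h2
  have h4 := W.sq_mul_radius_sq x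
  have h5 := W.sigmaP_mul x
  have : deriv W.radius x = x / (W.radius x * W.sigmaP x) := by
    rw [eq_div_iff (by positivity)]
    have h6 : (deriv W.radius x * (W.radius x * W.sigmaP x) - x) * W.radius x ^ 4 = 0 := by
      linear_combination W.radius x * deriv W.radius x * h5 - W.radius x ^ 2 / 2 * h3
        + W.radius x * deriv W.radius x * h4
    rcases mul_eq_zero.1 h6 with h | h
    · linarith
    · exact absurd h (by positivity)
  rwa [this] at hd

/-! ### The mass function and the regular part of `A` -/

/-- The primitive of `r_q² / r²` that vanishes at the throat. -/
def chargeMass (W : Geon) (x : ℝ) : ℝ := ∫ t in (0 : ℝ)..x, W.rq ^ 2 / W.radius t ^ 2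

lemma continuous_rq_div_radius (W : Geon) : Continuous fun t => W.rq ^ 2 / W.radius t ^ 2 :=
  continuous_const.div (W.continuous_radius.pow 2) fun t => by have := W.radius_pos t; positivity

lemma hasDerivAt_chargeMass (W : Geon) (x : ℝ) :
    HasDerivAt W.chargeMass (W.rq ^ 2 / W.radius x ^ 2) x :=
  intervalIntegral.integral_hasDerivAt_right (W.continuous_rq_div_radius.intervalIntegrable _ _)
    (W.continuous_rq_div_radius.stronglyMeasurableAtFilter _ _) W.continuous_rq_div_radius.continuousAt

lemma chargeMass_zero (W : Geon) : W.chargeMass 0 = 0 := by simp [chargeMass]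

lemma analyticAt_chargeMass (W : Geon) (x : ℝ) : AnalyticAt ℝ W.chargeMass x := by
  refine AnalyticAt.of_hasDerivAt ?_ (Eventually.of_forall W.hasDerivAt_chargeMass)
  exact analyticAt_const.fun_div ((W.analyticAt_radius x).fun_pow 2)
    (by have := W.radius_pos x; positivity)

lemma chargeMass_neg (W : Geon) (x : ℝ) : W.chargeMass (-x) = -W.chargeMass x := by
  have h := intervalIntegral.integral_comp_neg (fun t => W.rq ^ 2 / W.radius t ^ 2)
    (a := 0) (b := x)
  simp only [radius_neg, neg_zero] at h
  rw [chargeMass, chargeMass, h, intervalIntegral.integral_symm]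

/-- Twice the mass that remains at the throat, `m₀`: the coefficient of the singular term `-m₀ / |x|` of
`A`. Its sign is that of `δ_c - δ₁`. -/
def throatMass (W : Geon) : ℝ := W.rS + 2 * W.rq ^ 2 / W.rc * geonG 1

/-- The part `1 - N(x) / x` of `A` that is regular at the throat, where `N` is `chargeMass`. -/
def regA (W : Geon) (x : ℝ) : ℝ := 1 - dslope W.chargeMass 0 x

lemma geonG_one_neg : geonG 1 < 0 := by
  have := hypergeometric_neg_three_quarters_one_neg
  unfold geonG
  norm_num at this ⊢
  linarith

/-- The defining formula, with the last parameter of `₂F₁` written as `a + 1` for `a = -3/4`. -/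
lemma geonG_eq (z : ℝ) : geonG z = 2 / 3 * (z ^ 3 *
    ordinaryHypergeometric (-3 / 4 : ℝ) (1 / 2) (-3 / 4 + 1) (1 / z ^ 4)
      - z ^ 3 * (1 - 1 / z ^ 4) ^ (3 / 2 : ℝ)) := by
  rw [geonG]
  norm_num
  ring

/-- The differential equation of the hypergeometric function turns into an algebraic expression for `G'`. -/
lemma hasDerivAt_geonG {z : ℝ} (hz : 1 < z) :
    HasDerivAt geonG (2 / (z ^ 6 * √(1 - 1 / z ^ 4))) z := by
  have hz0 : 0 < z := by linarith
  have hz4 : 1 < z ^ 4 := one_lt_pow₀ hz (by norm_num)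
  have hw1 : 1 / z ^ 4 < 1 := by rw [div_lt_one (by positivity)]; exact hz4
  have hw0 : 0 < 1 / z ^ 4 := by positivity
  obtain ⟨d, hd, hode⟩ := hasDerivAt_hypergeometric (a := -3 / 4) (by norm_num) (by norm_num)
    (z := 1 / z ^ 4) (by rw [abs_of_pos hw0]; exact hw1)
  have hw : HasDerivAt (fun z : ℝ => 1 / z ^ 4) (-4 / z ^ 5) z := by
    have := (hasDerivAt_const z (1 : ℝ)).fun_div (hasDerivAt_pow 4 z) (by positivity)
    refine this.congr_deriv ?_
    rw [div_eq_div_iff (by positivity) (by positivity)]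
    push_cast
    ring
  set s := √(1 - 1 / z ^ 4) with hs
  have hs0 : 0 < s := Real.sqrt_pos.2 (by linarith)
  have hs2 : s ^ 2 = 1 - 1 / z ^ 4 := Real.sq_sqrt (by linarith)
  have h1 := (hasDerivAt_pow 3 z).fun_mul (hd.comp z hw)
  have h2 := (hasDerivAt_pow 3 z).fun_mul
    ((hw.const_sub 1).rpow_const (p := (3 / 2 : ℝ)) (Or.inl (by linarith)))
  have h3 := (h1.fun_sub h2).const_mul (2 / 3)
  have h4 : HasDerivAt geonG _ z := h3.congr_of_eventuallyEq (Eventually.of_forall geonG_eq)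
  convert h4 using 1
  have e1 : (1 - 1 / z ^ 4) ^ (3 / 2 - 1 : ℝ) = s := by
    rw [hs, Real.sqrt_eq_rpow]; norm_num
  have e2 : (1 - 1 / z ^ 4) ^ (3 / 2 : ℝ) = s ^ 3 := by
    rw [hs, Real.sqrt_eq_rpow, ← Real.rpow_mul_natCast (by linarith)]; norm_num
  rw [e1, e2]
  have h5 : ordinaryHypergeometric (-3 / 4 : ℝ) (1 / 2) (-3 / 4 + 1) (1 / z ^ 4)
      = 1 / s + 4 / 3 * (1 / z ^ 4) * d := by
    rw [← hode]; ring
  simp only [Function.comp_apply]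
  rw [h5]
  have hz4' : z ^ 4 * (1 - s ^ 2) = 1 := by rw [hs2]; field_simp; ring
  norm_num
  field_simp
  linear_combination -(6 * z ^ 4 * (1 + s ^ 2) + 6) * hz4'

lemma continuousWithinAt_geonG_one : ContinuousWithinAt geonG (Ici 1) 1 := by
  have h : ContinuousOn geonG (Ici 1) := by
    have h0 : ContinuousOn (fun z : ℝ => 1 / z ^ 4) (Ici 1) :=
      continuousOn_const.div (by fun_prop) fun z hz => by
        have : (1 : ℝ) ≤ z := hz
        positivity
    have hm : MapsTo (fun z : ℝ => 1 / z ^ 4) (Ici 1) (Icc 0 1) := fun z hz => by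
      have : (1 : ℝ) ≤ z := hz
      refine ⟨by positivity, ?_⟩
      rw [div_le_one (by positivity)]
      exact one_le_pow₀ this
    have h1 := (continuousOn_hypergeometric (a := -3 / 4) (by norm_num) (by norm_num)).comp h0 hm
    have h2 : ContinuousOn (fun z : ℝ => (1 - 1 / z ^ 4) ^ (3 / 2 : ℝ)) (Ici 1) :=
      (continuousOn_const.sub h0).rpow_const fun z _ => Or.inr (by norm_num)
    have h3 : ContinuousOn (fun z : ℝ => 2 / 3 * (z ^ 3 *
        ordinaryHypergeometric (-3 / 4 : ℝ) (1 / 2) (-3 / 4 + 1) (1 / z ^ 4)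
          - z ^ 3 * (1 - 1 / z ^ 4) ^ (3 / 2 : ℝ))) (Ici 1) :=
      continuousOn_const.mul (((continuousOn_pow 3).mul h1).sub ((continuousOn_pow 3).mul h2))
    exact h3.congr fun z _ => geonG_eq z
  exact h 1 self_mem_Ici

lemma eq_radius_mul_sqrt (W : Geon) {x : ℝ} (hx : 0 ≤ x) :
    x = W.radius x * √(1 - W.rc ^ 4 / W.radius x ^ 4) := by
  have hr := W.radius_pos x
  have h := W.sq_mul_radius_sq x
  have h2 : x ^ 2 = W.radius x ^ 2 * (1 - W.rc ^ 4 / W.radius x ^ 4) := by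
    field_simp
    linarith
  calc x = √(x ^ 2) := (Real.sqrt_sq hx).symm
    _ = √(W.radius x ^ 2) * √(1 - W.rc ^ 4 / W.radius x ^ 4) := by
      rw [h2, Real.sqrt_mul (by positivity)]
    _ = _ := by rw [Real.sqrt_sq hr.le]

/-- The mass function of the metric function `A` has derivative `r_q² / r²`. -/
lemma hasDerivAt_massFunction (W : Geon) {x : ℝ} (hx : 0 < x) :
    HasDerivAt (fun x => W.rS - W.rq ^ 2 * x / W.radius x ^ 2
      + 2 * W.rq ^ 2 / W.rc * geonG (W.radius x / W.rc)) (W.rq ^ 2 / W.radius x ^ 2) x := by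
  have hr := W.radius_pos x
  have hc := W.rc_pos
  have hσ := W.sigmaP_pos x
  have hrd := W.hasDerivAt_radius x
  have hz : 1 < W.radius x / W.rc := by rw [one_lt_div hc]; exact W.rc_lt_radius hx.ne'
  have h1 := ((hasDerivAt_id x).const_mul (W.rq ^ 2)).fun_div (hrd.fun_pow 2) (by positivity)
  have h2 := ((hasDerivAt_geonG hz).comp x (hrd.div_const W.rc)).const_mul (2 * W.rq ^ 2 / W.rc)
  have h3 := (h1.const_sub W.rS).fun_add h2
  refine h3.congr_deriv ?_
  have hw : 1 / (W.radius x / W.rc) ^ 4 = W.rc ^ 4 / W.radius x ^ 4 := by field_simp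
  have hx' := W.eq_radius_mul_sqrt hx.le
  rw [hw]
  -- `x = r s`, and all quantities become rational functions of `r`, `s` and `r_c`
  set s := √(1 - W.rc ^ 4 / W.radius x ^ 4) with hs
  have hs0 : 0 < s := by
    rw [hs]
    refine Real.sqrt_pos.2 (sub_pos.2 ((div_lt_one (by positivity)).2 ?_))
    exact pow_lt_pow_left₀ (W.rc_lt_radius hx.ne') hc.le (by norm_num)
  have hsm := W.sigmaP_mul x
  have hsq := W.sq_mul_radius_sq x
  set r := W.radius x
  set c := W.rc
  set σ := W.sigmaP x
  simp only [id]
  push_cast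
  have hσ' : σ = (r ^ 4 + c ^ 4) / r ^ 4 := by field_simp; linarith
  rw [hx'] at hsq ⊢
  rw [hσ']
  have hrc : 0 < r ^ 4 + c ^ 4 := by positivity
  have hs4 : s ^ 2 * r ^ 4 = r ^ 4 - c ^ 4 := by linarith
  field_simp
  linear_combination 2 * W.rq ^ 2 * hs4

/-- Both sides have the same derivative for `x > 0` and the same limit at the throat. -/
lemma massFunction_eq (W : Geon) {x : ℝ} (hx : 0 < x) :
    W.rS - W.rq ^ 2 * x / W.radius x ^ 2 + 2 * W.rq ^ 2 / W.rc * geonG (W.radius x / W.rc)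
      = W.throatMass + W.chargeMass x := by
  have hc := W.rc_pos
  set f : ℝ → ℝ := fun x => W.rS - W.rq ^ 2 * x / W.radius x ^ 2
      + 2 * W.rq ^ 2 / W.rc * geonG (W.radius x / W.rc) - W.chargeMass x with hf
  have hd : ∀ y ∈ Ioo 0 (x + 1), HasDerivAt f 0 y := fun y hy => by
    simpa using (W.hasDerivAt_massFunction hy.1).fun_sub (W.hasDerivAt_chargeMass y)
  -- at the throat `G` is only continuous from the right, at `z = 1`
  have hcont : ContinuousOn f (Icc 0 x) := by
    intro y hy
    refine ContinuousWithinAt.sub (ContinuousWithinAt.add ?_ ?_)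
      (W.hasDerivAt_chargeMass y).continuousAt.continuousWithinAt
    · have : W.radius y ^ 2 ≠ 0 := by have := W.radius_pos y; positivity
      have hr := W.continuous_radius
      exact (continuousWithinAt_const.sub
        (((by fun_prop : Continuous fun y : ℝ => W.rq ^ 2 * y).continuousWithinAt).div
          (by fun_prop : Continuous fun y : ℝ => W.radius y ^ 2).continuousWithinAt this))
    · refine continuousWithinAt_const.mul ?_
      have hr : Continuous fun y => W.radius y / W.rc := W.continuous_radius.div_const _
      rcases hy.1.eq_or_lt with rfl | h0
      · have h1 : W.radius 0 / W.rc = 1 := by rw [W.radius_zero, div_self hc.ne']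
        have := continuousWithinAt_geonG_one
        rw [← h1] at this
        refine ContinuousWithinAt.comp (f := fun y => W.radius y / W.rc) this
          hr.continuousWithinAt fun z _ => ?_
        rw [mem_Ici, h1, le_div_iff₀ hc, one_mul]
        exact W.rc_le_radius z
      · have h1 : 1 < W.radius y / W.rc := by rw [one_lt_div hc]; exact W.rc_lt_radius h0.ne'
        exact (ContinuousAt.comp (f := fun y => W.radius y / W.rc)
          (hasDerivAt_geonG h1).continuousAt hr.continuousAt).continuousWithinAt
  have hconst : f x = f 0 := by
    rcases exists_hasDerivAt_eq_slope f (fun _ => 0) hx hcont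
      (fun y hy => hd y ⟨hy.1, by linarith [hy.2]⟩) with ⟨y, _, h⟩
    have := (eq_div_iff (by linarith)).1 h
    linarith
  have e0 : f 0 = W.throatMass := by
    simp [hf, throatMass, W.radius_zero, W.chargeMass_zero, div_self hc.ne']
  rw [e0] at hconst
  simp only [hf] at hconst
  linarith

lemma dslope_chargeMass_neg (W : Geon) (x : ℝ) :
    dslope W.chargeMass 0 (-x) = dslope W.chargeMass 0 x := by
  rcases eq_or_ne x 0 with rfl | hx
  · simp
  · rw [dslope_of_ne _ (neg_ne_zero.2 hx), dslope_of_ne _ hx, slope_def_field, slope_def_field,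
      W.chargeMass_neg, W.chargeMass_zero]
    simp only [sub_zero, neg_div_neg_eq]

lemma regA_neg (W : Geon) (x : ℝ) : W.regA (-x) = W.regA x := by
  simp [regA, dslope_chargeMass_neg]

lemma radius_abs (W : Geon) (x : ℝ) : W.radius |x| = W.radius x :=
  le_antisymm (W.radius_le_of_abs_le (by simp)) (W.radius_le_of_abs_le (by simp))

/-- The decomposition of `A` into a regular part and `-m₀ / |x|`. It holds at `x = 0` as well, where
the second term is zero by convention. -/
lemma A_eq (W : Geon) (x : ℝ) : W.A x = W.regA x - W.throatMass / |x| := by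
  rcases eq_or_ne x 0 with rfl | hx
  · simp [A, regA, dslope_same, (W.hasDerivAt_chargeMass 0).deriv, W.radius_zero]
  · have h1 := W.massFunction_eq (abs_pos.2 hx)
    have h2 : dslope W.chargeMass 0 x = dslope W.chargeMass 0 |x| := by
      rcases abs_choice x with h | h <;> rw [h]
      rw [W.dslope_chargeMass_neg]
    rw [regA, h2, dslope_of_ne _ (abs_pos.2 hx).ne', slope_def_field, W.chargeMass_zero]
    rw [W.radius_abs] at h1
    rw [A, if_neg hx]
    have h3 := abs_pos.2 hx
    have hr := W.radius_pos x
    have hc := W.rc_pos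
    have h4 : W.chargeMass |x| = W.rS - W.rq ^ 2 * |x| / W.radius x ^ 2
      + 2 * W.rq ^ 2 / W.rc * geonG (W.radius x / W.rc) - W.throatMass := by linarith
    rw [h4]
    field_simp
    ring

lemma A_neg (W : Geon) (x : ℝ) : W.A (-x) = W.A x := by
  rw [A_eq, A_eq, regA_neg, abs_neg]

lemma analyticAt_regA (W : Geon) (x : ℝ) : AnalyticAt ℝ W.regA x :=
  analyticAt_const.fun_sub
    ((W.analyticAt_chargeMass x).dslope_of_analyticAt (W.analyticAt_chargeMass 0))

lemma throatMass_eq (W : Geon) : W.throatMass = W.rS * (1 - W.delta1 / deltaC) := by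
  have := geonG_one_neg
  have := W.rS_pos
  have := W.rc_pos
  rw [throatMass, delta1, deltaC]
  field_simp
  ring

lemma deltaC_pos : 0 < deltaC := by
  have := geonG_one_neg
  unfold deltaC
  exact div_pos_of_neg_of_neg (by norm_num) (by linarith)

lemma throatMass_eq_zero_iff (W : Geon) : W.throatMass = 0 ↔ W.delta1 = deltaC := by
  rw [throatMass_eq, mul_eq_zero, or_iff_right W.rS_pos.ne', sub_eq_zero, eq_comm,
    div_eq_one_iff_eq deltaC_pos.ne']

lemma throatMass_neg_iff (W : Geon) : W.throatMass < 0 ↔ deltaC < W.delta1 := by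
  rw [throatMass_eq, mul_neg_iff, ← one_lt_div deltaC_pos]
  have := W.rS_pos
  constructor
  · rintro (h | h) <;> linarith [h.1, h.2]
  · intro h; left; constructor <;> linarith

lemma throatMass_nonneg_iff (W : Geon) : 0 ≤ W.throatMass ↔ W.delta1 ≤ deltaC := by
  rw [← not_lt, throatMass_neg_iff, not_lt]

lemma reg_iff (W : Geon) (x : ℝ) : W.Reg x ↔ x ≠ 0 ∨ W.throatMass = 0 := by
  rw [Reg, throatMass_eq_zero_iff]

lemma isOpen_setOf_reg (W : Geon) : IsOpen {x | W.Reg x} := by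
  by_cases h : W.delta1 = deltaC
  · simp [Reg, h]
  · simpa [Reg, h] using isOpen_ne

lemma reg_neg (W : Geon) {x : ℝ} : W.Reg (-x) ↔ W.Reg x := by simp [Reg]

lemma analyticAt_A (W : Geon) {x : ℝ} (hx : W.Reg x) : AnalyticAt ℝ W.A x := by
  have h1 : W.A = fun x => W.regA x - W.throatMass / |x| := funext W.A_eq
  rw [h1]
  rcases (W.reg_iff x).1 hx with h | h
  · have habs : AnalyticAt ℝ (fun y : ℝ => |y|) x := by
      simp_rw [← Real.sqrt_sq_eq_abs]
      exact AnalyticAt.real_sqrt (by fun_prop) (pow_ne_zero 2 h)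
    exact (W.analyticAt_regA x).fun_sub (analyticAt_const.fun_div habs
      (abs_pos.2 h).ne')
  · simpa [h] using W.analyticAt_regA x

lemma hasDerivAt_A (W : Geon) {x : ℝ} (hx : W.Reg x) : HasDerivAt W.A (deriv W.A x) x :=
  (W.analyticAt_A hx).differentiableAt.hasDerivAt

/-! ### Derivatives of the metric functions -/

lemma hasDerivAt_sigmaP (W : Geon) (x : ℝ) : HasDerivAt W.sigmaP (deriv W.sigmaP x) x :=
  (W.analyticAt_sigmaP x).differentiableAt.hasDerivAt

lemma hasDerivAt_radius_sq (W : Geon) (x : ℝ) :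
    HasDerivAt (fun u => W.radius u ^ 2) (2 * x / W.sigmaP x) x := by
  refine ((W.hasDerivAt_radius x).fun_pow 2).congr_deriv ?_
  have := W.radius_pos x
  have := W.sigmaP_pos x
  field_simp
  ring

lemma analyticAt_F (W : Geon) {x : ℝ} (hx : W.Reg x) : AnalyticAt ℝ W.F x :=
  (W.analyticAt_A hx).div (W.analyticAt_sigmaP x) (W.sigmaP_pos x).ne'

lemma hasDerivAt_F (W : Geon) {x : ℝ} (hx : W.Reg x) :
    HasDerivAt W.F ((deriv W.A x * W.sigmaP x - W.A x * deriv W.sigmaP x) / W.sigmaP x ^ 2) x :=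
  (W.hasDerivAt_A hx).div (W.hasDerivAt_sigmaP x) (W.sigmaP_pos x).ne'

/-- The factor `κ + L² / r²` of the effective potential. -/
def massTerm (W : Geon) (κ L x : ℝ) : ℝ := κ + L ^ 2 / W.radius x ^ 2

lemma hasDerivAt_massTerm (W : Geon) (κ L x : ℝ) :
    HasDerivAt (W.massTerm κ L) (-(L ^ 2 * (2 * x / W.sigmaP x)) / W.radius x ^ 4) x := by
  have hr := W.radius_pos x
  have := ((hasDerivAt_const x (L ^ 2)).fun_div (W.hasDerivAt_radius_sq x)
    (by positivity)).const_add κ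
  refine this.congr_deriv ?_
  ring

lemma V_eq (W : Geon) (κ L x : ℝ) : W.V κ L x = W.F x * W.massTerm κ L x := rfl

lemma analyticAt_massTerm (W : Geon) (κ L x : ℝ) : AnalyticAt ℝ (W.massTerm κ L) x :=
  analyticAt_const.fun_add (analyticAt_const.fun_div ((W.analyticAt_radius x).fun_pow 2)
    (by have := W.radius_pos x; positivity))

lemma analyticAt_V (W : Geon) (κ L : ℝ) {x : ℝ} (hx : W.Reg x) : AnalyticAt ℝ (W.V κ L) x :=
  (W.analyticAt_F hx).mul (W.analyticAt_massTerm κ L x)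

lemma hasDerivAt_V (W : Geon) (κ L : ℝ) {x : ℝ} (hx : W.Reg x) :
    HasDerivAt (W.V κ L)
      ((deriv W.A x * W.sigmaP x - W.A x * deriv W.sigmaP x) / W.sigmaP x ^ 2 * W.massTerm κ L x
        - W.A x / W.sigmaP x * (L ^ 2 * (2 * x / W.sigmaP x)) / W.radius x ^ 4) x := by
  refine ((W.hasDerivAt_F hx).mul (W.hasDerivAt_massTerm κ L x)).congr_deriv ?_
  rw [F]
  ring

lemma deriv_V (W : Geon) (κ L : ℝ) {x : ℝ} (hx : W.Reg x) :
    deriv (W.V κ L) x =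
      (deriv W.A x * W.sigmaP x - W.A x * deriv W.sigmaP x) / W.sigmaP x ^ 2 * W.massTerm κ L x
        - W.A x / W.sigmaP x * (L ^ 2 * (2 * x / W.sigmaP x)) / W.radius x ^ 4 :=
  (W.hasDerivAt_V κ L hx).deriv

lemma massTerm_nonneg (W : Geon) {κ : ℝ} (hκ : 0 ≤ κ) (L x : ℝ) : 0 ≤ W.massTerm κ L x := by
  have := W.radius_pos x
  unfold massTerm
  positivity

lemma massTerm_pos (W : Geon) {κ L : ℝ} (hκ : κ = 0 ∨ κ = 1) (h : κ = 1 ∨ L ≠ 0) (x : ℝ) :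
    0 < W.massTerm κ L x := by
  have := W.radius_pos x
  unfold massTerm
  by_cases hL : L = 0
  · rcases h with h | h
    · rw [h]; positivity
    · exact absurd hL h
  · rcases hκ with h | h <;> rw [h] <;> positivity

/-! ### The reduced equations of motion -/

/-- At the parameter `s` the radial coordinate is at a regular value of `x`, and the radial equation
`(x' / σ₊)² = E² - V` and its derivative `(x' / σ₊)' = -σ₊ V' / 2` hold. -/
structure RadialAt (W : Geon) (κ E L : ℝ) (x : ℝ → ℝ) (s : ℝ) : Prop where
  reg : W.Reg (x s)
  diff : DifferentiableAt ℝ x s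
  accel : HasDerivAt (fun s => deriv x s / W.sigmaP (x s))
    (-(W.sigmaP (x s) * deriv (W.V κ L) (x s)) / 2) s
  energy : (deriv x s / W.sigmaP (x s)) ^ 2 = E ^ 2 - W.V κ L (x s)

/-- At the parameter `s` the direction `n` satisfies the equation of a great circle traversed with
angular momentum `L = r² |n'|`. -/
structure AngularAt (W : Geon) (L : ℝ) (x : ℝ → ℝ) (n : ℝ → Vec3) (s : ℝ) : Prop where
  unit : ‖n s‖ = 1
  diff : DifferentiableAt ℝ n s
  eqn : HasDerivAt (fun s => W.radius (x s) ^ 2 • deriv n s)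
    (-(W.radius (x s) ^ 2 * ‖deriv n s‖ ^ 2) • n s) s
  momentum : W.radius (x s) ^ 2 * ‖deriv n s‖ = L

lemma RadialAt.congr {W : Geon} {κ E L : ℝ} {x x₁ : ℝ → ℝ} {s : ℝ} (h : W.RadialAt κ E L x s)
    (hx : x₁ =ᶠ[𝓝 s] x) : W.RadialAt κ E L x₁ s := by
  have h0 := hx.eq_of_nhds
  have h1 := hx.deriv
  refine ⟨h0 ▸ h.reg, h.diff.congr_of_eventuallyEq hx, ?_, ?_⟩
  · rw [h0]
    refine h.accel.congr_of_eventuallyEq ?_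
    filter_upwards [hx, h1] with a ha hb
    rw [ha, hb]
  · rw [h0, h1.eq_of_nhds, h.energy]

/-- The radial equation from the first order system for `x` and `y = x' / σ₊`. -/
lemma RadialAt.of_hasDerivAt {W : Geon} {κ E L : ℝ} {x y : ℝ → ℝ} {s : ℝ} (hreg : W.Reg (x s))
    (hx : ∀ᶠ u in 𝓝 s, HasDerivAt x (W.sigmaP (x u) * y u) u)
    (hy : HasDerivAt y (-(W.sigmaP (x s) * deriv (W.V κ L) (x s)) / 2) s)
    (hE : y s ^ 2 = E ^ 2 - W.V κ L (x s)) : W.RadialAt κ E L x s := by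
  have h : (fun u => deriv x u / W.sigmaP (x u)) =ᶠ[𝓝 s] y := by
    filter_upwards [hx] with u hu
    rw [hu.deriv, mul_div_cancel_left₀ _ (W.sigmaP_pos _).ne']
  refine ⟨hreg, hx.self_of_nhds.differentiableAt, hy.congr_of_eventuallyEq h, ?_⟩
  rw [← hE, ← h.eq_of_nhds]

lemma AngularAt.congr {W : Geon} {L : ℝ} {x x₁ : ℝ → ℝ} {n n₁ : ℝ → Vec3} {s : ℝ}
    (h : W.AngularAt L x n s) (hx : x₁ =ᶠ[𝓝 s] x) (hn : n₁ =ᶠ[𝓝 s] n) :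
    W.AngularAt L x₁ n₁ s := by
  have h0 := hx.eq_of_nhds
  have h1 := hn.deriv
  refine ⟨by rw [hn.eq_of_nhds, h.unit], h.diff.congr_of_eventuallyEq hn, ?_, ?_⟩
  · rw [h0, h1.eq_of_nhds, hn.eq_of_nhds]
    refine h.eqn.congr_of_eventuallyEq ?_
    filter_upwards [hx, h1] with a ha hb
    rw [ha, hb]
  · rw [h0, h1.eq_of_nhds, h.momentum]

lemma AngularAt.norm_deriv_sq {W : Geon} {L : ℝ} {x : ℝ → ℝ} {n : ℝ → Vec3} {s : ℝ}
    (h : W.radius (x s) ^ 2 * ‖deriv n s‖ = L) : ‖deriv n s‖ ^ 2 = L ^ 2 / W.radius (x s) ^ 4 := by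
  have := W.radius_pos (x s)
  rw [← h]
  field_simp

/-! ### Geodesics in the coordinates `(t, x)` -/

lemma IsGeodesicOn.deriv_t {W : Geon} {κ E : ℝ} {t x : ℝ → ℝ} {n : ℝ → Vec3} {J : Set ℝ}
    (h : W.IsGeodesicOn W.static κ E t x n J) {s : ℝ} (hs : s ∈ J) :
    deriv t s = E * W.sigmaP (x s) / W.A (x s) := by
  have hA : W.A (x s) ≠ 0 := (h.mem s hs).2
  have hσ := W.sigmaP_pos (x s)
  have := h.energy s hs
  simp only [static] at this
  rw [← this]
  field_simp
  ring

/-- In the coordinates `(t, x)` the norm of the tangent, multiplied by `A / σ₊`, is the radial equation, and the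
`x`-component of the geodesic equation, whose momentum is `(x' / σ₊) / A`, is its derivative. -/
lemma IsGeodesicOn.radialAt_static {W : Geon} {κ E L : ℝ} {t x : ℝ → ℝ} {n : ℝ → Vec3} {J : Set ℝ}
    (h : W.IsGeodesicOn W.static κ E t x n J) (hJ : IsOpen J) {s : ℝ} (hs : s ∈ J)
    (hL : W.radius (x s) ^ 2 * ‖deriv n s‖ = L) : W.RadialAt κ E L x s := by
  have hA : ∀ u ∈ J, W.A (x u) ≠ 0 := fun u hu => (h.mem u hu).2
  have hreg : W.Reg (x s) := (h.mem s hs).1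
  have hσ := W.sigmaP_pos (x s)
  have hr := W.radius_pos (x s)
  have hn2 := AngularAt.norm_deriv_sq hL
  have hAs := hA s hs
  have ht := h.deriv_t hs
  have hnorm := h.norm_tangent s hs
  have hb := h.eqn_b s hs
  have e1 : pdB W.static.qaa (t s, x s) =
      -((deriv W.A (x s) * W.sigmaP (x s) - W.A (x s) * deriv W.sigmaP (x s))
        / W.sigmaP (x s) ^ 2) :=
    (W.hasDerivAt_F hreg).fun_neg.deriv
  have e2 : pdB W.static.qab (t s, x s) = 0 := by simp [pdB, static]
  have e3 : pdB W.static.qbb (t s, x s) =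
      -(deriv W.A (x s) * W.sigmaP (x s) + W.A (x s) * deriv W.sigmaP (x s))
        / (W.A (x s) * W.sigmaP (x s)) ^ 2 := by
    have := (hasDerivAt_const (x s) (1 : ℝ)).fun_div
      ((W.hasDerivAt_A hreg).fun_mul (W.hasDerivAt_sigmaP (x s))) (mul_ne_zero hAs hσ.ne')
    refine this.deriv.trans ?_
    ring
  have e4 : pdB (fun p => W.radius (W.static.X p) ^ 2) (t s, x s) = 2 * x s / W.sigmaP (x s) :=
    (W.hasDerivAt_radius_sq (x s)).deriv
  rw [e1, e2, e3, e4, hn2, ht] at hb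
  have hE : (deriv x s / W.sigmaP (x s)) ^ 2 = E ^ 2 - W.V κ L (x s) := by
    simp only [static] at hnorm
    rw [hn2, ht] at hnorm
    rw [V_eq, F, massTerm]
    field_simp at hnorm ⊢
    linear_combination hnorm
  have hAd := (W.hasDerivAt_A hreg).comp s (h.diff_b s hs).hasDerivAt
  refine ⟨hreg, h.diff_b s hs, ?_, hE⟩
  -- `x' / σ₊` is `A` times the momentum conjugate to `x`
  have hy := hAd.fun_mul hb
  refine (hy.congr_of_eventuallyEq ?_).congr_deriv ?_
  · filter_upwards [hJ.mem_nhds hs] with u hu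
    have := hA u hu
    have := W.sigmaP_pos (x u)
    simp only [static, Function.comp_apply]
    field_simp
    ring
  · rw [W.deriv_V κ L hreg]
    simp only [static, Function.comp_apply]
    rw [V_eq, F] at hE
    rw [massTerm] at hE ⊢
    linear_combination (norm := (field_simp; ring))
      (deriv W.A (x s) * W.sigmaP (x s) - W.A (x s) * deriv W.sigmaP (x s)) / (2 * W.A (x s)) * hE

/-- A solution of the reduced equations, with `t' = E σ₊ / A`, is a geodesic in the coordinates
`(t, x)`. -/
lemma IsGeodesicOn.static_of_radialAt {W : Geon} {κ E L : ℝ} {t x : ℝ → ℝ} {n : ℝ → Vec3}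
    {J : Set ℝ} (hJ : IsOpen J) (hne : κ ≠ 0 ∨ L ≠ 0 ∨ E ≠ 0)
    (hA : ∀ s ∈ J, W.A (x s) ≠ 0) (hR : ∀ s ∈ J, W.RadialAt κ E L x s)
    (hN : ∀ s ∈ J, W.AngularAt L x n s)
    (ht : ∀ s ∈ J, HasDerivAt t (E * W.sigmaP (x s) / W.A (x s)) s) :
    W.IsGeodesicOn W.static κ E t x n J := by
  refine ⟨fun s hs => ⟨(hR s hs).reg, hA s hs⟩, fun s hs => (hN s hs).unit,
    fun s hs => (ht s hs).differentiableAt, fun s hs => (hR s hs).diff,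
    fun s hs => (hN s hs).diff, ?_, ?_, fun s hs => (hN s hs).eqn, ?_, ?_, ?_⟩
  · intro s hs
    refine ((hasDerivAt_const s (-E)).congr_of_eventuallyEq ?_).congr_deriv ?_
    · filter_upwards [hJ.mem_nhds hs] with u hu
      have := hA u hu
      have := W.sigmaP_pos (x u)
      rw [(ht u hu).deriv]
      simp only [static]
      field_simp
      ring
    · simp [pdA, static]
  · intro s hs
    have hσ := W.sigmaP_pos (x s)
    have hr := W.radius_pos (x s)
    have hAs := hA s hs
    have hreg := (hR s hs).reg
    have hE := (hR s hs).energy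
    have e1 : pdB W.static.qaa (t s, x s) =
        -((deriv W.A (x s) * W.sigmaP (x s) - W.A (x s) * deriv W.sigmaP (x s))
          / W.sigmaP (x s) ^ 2) :=
      (W.hasDerivAt_F hreg).fun_neg.deriv
    have e2 : pdB W.static.qab (t s, x s) = 0 := by simp [pdB, static]
    have e3 : pdB W.static.qbb (t s, x s) =
        -(deriv W.A (x s) * W.sigmaP (x s) + W.A (x s) * deriv W.sigmaP (x s))
          / (W.A (x s) * W.sigmaP (x s)) ^ 2 := by
      have := (hasDerivAt_const (x s) (1 : ℝ)).fun_div
        ((W.hasDerivAt_A hreg).fun_mul (W.hasDerivAt_sigmaP (x s))) (mul_ne_zero hAs hσ.ne')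
      refine this.deriv.trans ?_
      ring
    have e4 : pdB (fun p => W.radius (W.static.X p) ^ 2) (t s, x s) = 2 * x s / W.sigmaP (x s) :=
      (W.hasDerivAt_radius_sq (x s)).deriv
    have hAd := (W.hasDerivAt_A hreg).comp s (hR s hs).diff.hasDerivAt
    have hp := (hR s hs).accel.fun_div hAd hAs
    rw [e1, e2, e3, e4, AngularAt.norm_deriv_sq (hN s hs).momentum, (ht s hs).deriv]
    refine (hp.congr_of_eventuallyEq ?_).congr_deriv ?_
    · filter_upwards [hJ.mem_nhds hs] with u hu
      have := hA u hu
      have := W.sigmaP_pos (x u)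
      simp only [static, Function.comp_apply]
      field_simp
      ring
    · rw [W.deriv_V κ L hreg]
      simp only [Function.comp_apply]
      rw [V_eq, F] at hE
      rw [massTerm] at hE ⊢
      linear_combination (norm := (field_simp; ring))
        -(deriv W.A (x s) * W.sigmaP (x s) - W.A (x s) * deriv W.sigmaP (x s))
          / (2 * W.A (x s) ^ 2) * hE
  · rintro s hs ⟨h1, h2, h3⟩
    have hσ := W.sigmaP_pos (x s)
    have hAs := hA s hs
    have hL : L = 0 := by rw [← (hN s hs).momentum, h3]; simp
    have hE0 : E = 0 := by
      rw [(ht s hs).deriv, div_eq_zero_iff, or_iff_left hAs, mul_eq_zero, or_iff_left hσ.ne'] at h1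
      exact h1
    have hE := (hR s hs).energy
    rw [h2, hE0, hL, V_eq, F, massTerm] at hE
    have hκ : κ = 0 := by
      have : W.A (x s) / W.sigmaP (x s) * κ = 0 := by simpa using hE
      rcases mul_eq_zero.1 this with h | h
      · exact absurd h (div_ne_zero hAs hσ.ne')
      · exact h
    rcases hne with h | h | h <;> contradiction
  · intro s hs
    have hσ := W.sigmaP_pos (x s)
    have hr := W.radius_pos (x s)
    have hAs := hA s hs
    have hE := (hR s hs).energy
    rw [V_eq, F, massTerm] at hE
    rw [AngularAt.norm_deriv_sq (hN s hs).momentum, (ht s hs).deriv]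
    simp only [static]
    linear_combination (norm := (field_simp; ring)) W.sigmaP (x s) / W.A (x s) * hE
  · intro s hs
    have hσ := W.sigmaP_pos (x s)
    have hAs := hA s hs
    rw [(ht s hs).deriv]
    simp only [static]
    field_simp
    ring

/-! ### Geodesics in Eddington-Finkelstein coordinates -/

lemma pdB_eddington_qaa (W : Geon) (e w : ℝ) {x : ℝ} (hx : W.Reg x) :
    pdB (W.eddington e).qaa (w, x) =
      -((deriv W.A x * W.sigmaP x - W.A x * deriv W.sigmaP x) / W.sigmaP x ^ 2) :=
  (W.hasDerivAt_F hx).fun_neg.deriv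

lemma pdB_eddington_qab (W : Geon) (e w x : ℝ) :
    pdB (W.eddington e).qab (w, x) = -(e * deriv W.sigmaP x) / W.sigmaP x ^ 2 := by
  have := (hasDerivAt_const x e).fun_div (W.hasDerivAt_sigmaP x) (W.sigmaP_pos x).ne'
  refine this.deriv.trans ?_
  ring

lemma pdB_eddington_qbb (W : Geon) (e w x : ℝ) : pdB (W.eddington e).qbb (w, x) = 0 := by
  simp [pdB, eddington]

lemma pdB_eddington_radius_sq (W : Geon) (e w x : ℝ) :
    pdB (fun p => W.radius ((W.eddington e).X p) ^ 2) (w, x) = 2 * x / W.sigmaP x :=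
  (W.hasDerivAt_radius_sq x).deriv

/-- In Eddington-Finkelstein coordinates the momentum conjugate to `x` is `e w' / σ₊`, and the energy gives
`x' / σ₊ = A (e w' / σ₊) - e E`, with no division by `A`: the radial equation holds across the horizons. -/
lemma IsGeodesicOn.radialAt_eddington {W : Geon} {κ E L e : ℝ} (he : e = 1 ∨ e = -1)
    {w x : ℝ → ℝ} {n : ℝ → Vec3} {J : Set ℝ}
    (h : W.IsGeodesicOn (W.eddington e) κ E w x n J) (hJ : IsOpen J) {s : ℝ} (hs : s ∈ J)
    (hL : W.radius (x s) ^ 2 * ‖deriv n s‖ = L) : W.RadialAt κ E L x s := by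
  have hreg : ∀ u ∈ J, W.Reg (x u) := fun u hu => h.mem u hu
  have hregs := hreg s hs
  have hσ := W.sigmaP_pos (x s)
  have hr := W.radius_pos (x s)
  have he2 : e ^ 2 = 1 := by rcases he with h | h <;> simp [h]
  have hn2 := AngularAt.norm_deriv_sq hL
  have hnorm := h.norm_tangent s hs
  have hb := h.eqn_b s hs
  rw [W.pdB_eddington_qaa _ _ hregs, pdB_eddington_qab, pdB_eddington_qbb, pdB_eddington_radius_sq,
    hn2] at hb
  have hen : ∀ u ∈ J, -E = -(W.A (x u) / W.sigmaP (x u)) * deriv w u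
      + e / W.sigmaP (x u) * deriv x u := by
    intro u hu
    have := h.energy u hu
    simp only [eddington] at this
    linarith
  have hens := hen s hs
  simp only [eddington] at hnorm
  rw [hn2] at hnorm
  have hE : (deriv x s / W.sigmaP (x s)) ^ 2 = E ^ 2 - W.V κ L (x s) := by
    rw [V_eq, F, massTerm]
    linear_combination (norm := (field_simp; ring))
      -(-E - W.A (x s) / W.sigmaP (x s) * deriv w s + e * (deriv x s / W.sigmaP (x s))) * hens
        - (deriv x s / W.sigmaP (x s)) ^ 2 * he2 + W.A (x s) / W.sigmaP (x s) * hnorm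
  have hAd := (W.hasDerivAt_A hregs).comp s (h.diff_b s hs).hasDerivAt
  refine ⟨hregs, h.diff_b s hs, ?_, hE⟩
  have hy := (hAd.fun_mul hb).sub_const (e * E)
  refine (hy.congr_of_eventuallyEq ?_).congr_deriv ?_
  · filter_upwards [hJ.mem_nhds hs] with u hu
    have := W.sigmaP_pos (x u)
    simp only [eddington, Function.comp_apply]
    linear_combination (norm := (field_simp; ring)) -(deriv x u / W.sigmaP (x u)) * he2 - e * hen u hu
  · rw [W.deriv_V κ L hregs]
    simp only [eddington, Function.comp_apply]
    rw [massTerm]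
    linear_combination (norm := (field_simp; ring))
      (deriv W.A (x s) * W.sigmaP (x s) - W.A (x s) * deriv W.sigmaP (x s)) / W.sigmaP (x s) / 2
        * hnorm

/-- A solution of the reduced equations along which `E - e x' / σ₊` does not vanish is a geodesic
in Eddington-Finkelstein coordinates. -/
lemma IsGeodesicOn.eddington_of_radialAt {W : Geon} {κ E L e : ℝ} (he : e = 1 ∨ e = -1)
    {w x : ℝ → ℝ} {n : ℝ → Vec3} {J : Set ℝ} (hJ : IsOpen J)
    (hE : ∀ s ∈ J, E - e * (deriv x s / W.sigmaP (x s)) ≠ 0)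
    (hR : ∀ s ∈ J, W.RadialAt κ E L x s) (hN : ∀ s ∈ J, W.AngularAt L x n s)
    (hw : ∀ s ∈ J, HasDerivAt w
      (W.massTerm κ L (x s) / (E - e * (deriv x s / W.sigmaP (x s)))) s) :
    W.IsGeodesicOn (W.eddington e) κ E w x n J := by
  have he2 : e ^ 2 = 1 := by rcases he with h | h <;> simp [h]
  -- the momentum conjugate to `w`
  have hpa : ∀ s ∈ J, (W.eddington e).qaa (w s, x s) * deriv w s
      + (W.eddington e).qab (w s, x s) * deriv x s = -E := by
    intro s hs
    have hσ := W.sigmaP_pos (x s)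
    have hEs := hE s hs
    have hen := (hR s hs).energy
    rw [V_eq, F] at hen
    rw [(hw s hs).deriv]
    simp only [eddington]
    set y := deriv x s / W.sigmaP (x s) with hy
    have : e / W.sigmaP (x s) * deriv x s = e * y := by rw [hy]; ring
    rw [this]
    have h2 : W.A (x s) / W.sigmaP (x s) * W.massTerm κ L (x s) = (E - e * y) * (E + e * y) := by
      linear_combination hen + y ^ 2 * he2
    rw [← mul_div_assoc, neg_mul, h2]
    field_simp
    ring
  refine ⟨fun s hs => (hR s hs).reg, fun s hs => (hN s hs).unit,
    fun s hs => (hw s hs).differentiableAt, fun s hs => (hR s hs).diff,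
    fun s hs => (hN s hs).diff, ?_, ?_, fun s hs => (hN s hs).eqn, ?_, ?_, ?_⟩
  · intro s hs
    refine ((hasDerivAt_const s (-E)).congr_of_eventuallyEq ?_).congr_deriv ?_
    · filter_upwards [hJ.mem_nhds hs] with u hu
      exact hpa u hu
    · simp [pdA, eddington]
  · intro s hs
    have hσ := W.sigmaP_pos (x s)
    have hr := W.radius_pos (x s)
    have hreg := (hR s hs).reg
    have hEs := hE s hs
    have hen := (hR s hs).energy
    have hxd := (hR s hs).diff.hasDerivAt
    have h1 := (W.hasDerivAt_massTerm κ L (x s)).comp s hxd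
    have h2 := ((hR s hs).accel.const_mul e).const_sub E
    have h3 := (h1.fun_div h2 hEs)
    rw [W.pdB_eddington_qaa _ _ hreg, pdB_eddington_qab, pdB_eddington_qbb,
      pdB_eddington_radius_sq, AngularAt.norm_deriv_sq (hN s hs).momentum, (hw s hs).deriv]
    have h5 := ((hasDerivAt_const s e).fun_div ((W.hasDerivAt_sigmaP (x s)).comp s hxd)
      hσ.ne').fun_mul h3
    refine (h5.congr_of_eventuallyEq ?_).congr_deriv ?_
    · filter_upwards [hJ.mem_nhds hs] with u hu
      rw [(hw u hu).deriv]
      simp only [eddington, Function.comp_apply]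
      ring
    · rw [W.deriv_V κ L hreg]
      simp only [Function.comp_apply]
      rw [V_eq, F] at hen
      set y := deriv x s / W.sigmaP (x s) with hy
      have hx : deriv x s = W.sigmaP (x s) * y := by rw [hy]; field_simp
      have hκ : κ = W.massTerm κ L (x s) - L ^ 2 / W.radius (x s) ^ 2 := by rw [massTerm]; ring
      rw [hx]
      generalize W.massTerm κ L (x s) = Φ at *
      have hE2 : y ^ 2 - E ^ 2 + W.A (x s) / W.sigmaP (x s) * Φ = 0 := by linarith
      rcases he with rfl | rfl
      · rw [one_mul] at hEs ⊢
        linear_combination (norm := (field_simp; ring))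
          L ^ 2 * x s / (W.sigmaP (x s) * W.radius (x s) ^ 4 * (E - y) ^ 2) * hE2
      · obtain ⟨D, hD⟩ : ∃ D, E - -1 * y = D := ⟨_, rfl⟩
        rw [hD] at hEs ⊢
        have hy' : y = D - E := by linarith
        rw [hy'] at hE2 ⊢
        linear_combination (norm := (field_simp; ring))
          L ^ 2 * x s / (W.sigmaP (x s) * W.radius (x s) ^ 4 * D ^ 2) * hE2
  · rintro s hs ⟨h1, h2, h3⟩
    have hL : L = 0 := by rw [← (hN s hs).momentum, h3]; simp
    have hEs := hE s hs
    have hen := (hR s hs).energy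
    rw [h2, zero_div] at hEs hen
    rw [(hw s hs).deriv, h2, zero_div, div_eq_zero_iff, or_iff_left hEs] at h1
    rw [V_eq, h1] at hen
    apply hEs
    nlinarith
  · intro s hs
    have hσ := W.sigmaP_pos (x s)
    have hr := W.radius_pos (x s)
    have hp := hpa s hs
    have hen := (hR s hs).energy
    have hEs := hE s hs
    rw [V_eq, F] at hen
    rw [AngularAt.norm_deriv_sq (hN s hs).momentum]
    have hwd : (E - e * (deriv x s / W.sigmaP (x s))) * deriv w s = κ + L ^ 2 / W.radius (x s) ^ 2 := by
      rw [(hw s hs).deriv]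
      exact mul_div_cancel₀ _ hEs
    simp only [eddington] at hp ⊢
    linear_combination (norm := (field_simp; ring)) deriv w s * hp - hwd
  · intro s hs
    have := hpa s hs
    simp only [eddington] at this ⊢
    linarith

end Geon

/-- A continuous function on an open interval has a primitive that vanishes at a given point. -/
lemma exists_primitive_of_continuousOn {g : ℝ → ℝ} {J : Set ℝ} (hJ : IsOpen J)
    (hJc : J.OrdConnected) (hg : ContinuousOn g J) {c : ℝ} (hc : c ∈ J) :
    ∃ G : ℝ → ℝ, G c = 0 ∧ ∀ s ∈ J, HasDerivAt G (g s) s := by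
  refine ⟨fun s => ∫ u in c..s, g u, by simp, fun s hs => ?_⟩
  have h1 : uIcc c s ⊆ J := hJc.uIcc_subset hc hs
  exact intervalIntegral.integral_hasDerivAt_right (hg.mono h1).intervalIntegrable
    (hg.stronglyMeasurableAtFilter hJ s hs) (hg.continuousAt (hJ.mem_nhds hs))

namespace Geon

/-! ### Geodesics in Kruskal-type coordinates -/

lemma pdA_comp_add_mul {f : ℝ → ℝ} {f' h U V : ℝ} (hf : HasDerivAt f f' (h + U * V)) :
    HasDerivAt (fun u => f (h + u * V)) (f' * V) U := by
  have h1 : HasDerivAt (fun u => h + u * V) V U := by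
    simpa using ((hasDerivAt_id U).mul_const V).const_add h
  exact hf.comp U h1

lemma pdB_comp_add_mul {f : ℝ → ℝ} {f' h U V : ℝ} (hf : HasDerivAt f f' (h + U * V)) :
    HasDerivAt (fun v => f (h + U * v)) (f' * U) V := by
  have h1 : HasDerivAt (fun v => h + U * v) U V := by
    simpa using ((hasDerivAt_id V).const_mul U).const_add h
  exact hf.comp V h1

/-- The difference quotient `A / (x - h)` at a zero `h` of `A`. -/
def slopeA (W : Geon) (h : ℝ) : ℝ → ℝ := dslope W.A h

/-- The difference quotient `(A / (x - h) - A'(h)) / (x - h)` at a zero `h` of `A`. -/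
def slopeA₂ (W : Geon) (h : ℝ) : ℝ → ℝ := dslope (dslope W.A h) h

lemma analyticAt_slopeA (W : Geon) {h x : ℝ} (hh : W.Reg h) (hx : W.Reg x) :
    AnalyticAt ℝ (W.slopeA h) x :=
  (W.analyticAt_A hx).dslope_of_analyticAt (W.analyticAt_A hh)

lemma analyticAt_slopeA₂ (W : Geon) {h x : ℝ} (hh : W.Reg h) (hx : W.Reg x) :
    AnalyticAt ℝ (W.slopeA₂ h) x :=
  (W.analyticAt_slopeA hh hx).dslope_of_analyticAt (W.analyticAt_slopeA hh hh)

lemma A_eq_mul_slopeA (W : Geon) {h : ℝ} (h0 : W.A h = 0) (x : ℝ) :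
    W.A x = (x - h) * W.slopeA h x := by
  have := sub_smul_dslope W.A h x
  rw [h0, sub_zero, smul_eq_mul] at this
  exact this.symm

lemma slopeA_self (W : Geon) (h : ℝ) : W.slopeA h h = deriv W.A h := dslope_same _ _

lemma slopeA_eq (W : Geon) (h x : ℝ) :
    W.slopeA h x = deriv W.A h + (x - h) * W.slopeA₂ h x := by
  have := sub_smul_dslope (W.slopeA h) h x
  rw [smul_eq_mul, slopeA_self] at this
  rw [slopeA₂]
  change (x - h) * dslope (dslope W.A h) h x = _ at this
  linarith

lemma hasDerivAt_slopeA (W : Geon) {h x : ℝ} (hh : W.Reg h) (hx : W.Reg x) :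
    HasDerivAt (W.slopeA h) (W.slopeA₂ h x + (x - h) * deriv (W.slopeA₂ h) x) x := by
  have h1 := (W.analyticAt_slopeA₂ hh hx).differentiableAt.hasDerivAt
  have h2 := (((hasDerivAt_id x).sub_const h).fun_mul h1).const_add (deriv W.A h)
  refine (h2.congr_of_eventuallyEq (Eventually.of_forall fun u => W.slopeA_eq h u)).congr_deriv ?_
  simp

lemma deriv_A_eq (W : Geon) {h x : ℝ} (hh : W.Reg h) (h0 : W.A h = 0) (hx : W.Reg x) :
    deriv W.A x = W.slopeA h x
      + (x - h) * (W.slopeA₂ h x + (x - h) * deriv (W.slopeA₂ h) x) := by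
  have h1 := ((hasDerivAt_id x).sub_const h).fun_mul (W.hasDerivAt_slopeA hh hx)
  refine ((h1.congr_of_eventuallyEq
    (Eventually.of_forall fun u => W.A_eq_mul_slopeA h0 u)).congr_deriv ?_).deriv
  simp

lemma hasDerivAt_bifurcate_profile (W : Geon) {h x : ℝ} (hh : W.Reg h) (hx : W.Reg x)
    (hk : deriv W.A h ≠ 0) :
    HasDerivAt (fun x => W.slopeA₂ h x / ((deriv W.A h / 2) ^ 2 * W.sigmaP x))
      ((deriv (W.slopeA₂ h) x * W.sigmaP x - W.slopeA₂ h x * deriv W.sigmaP x)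
        / ((deriv W.A h / 2) ^ 2 * W.sigmaP x ^ 2)) x := by
  have h1 := (W.analyticAt_slopeA₂ hh hx).differentiableAt.hasDerivAt
  have hσ := W.sigmaP_pos x
  have := h1.fun_div ((W.hasDerivAt_sigmaP x).const_mul ((deriv W.A h / 2) ^ 2))
    (mul_ne_zero (pow_ne_zero 2 (div_ne_zero hk two_ne_zero)) hσ.ne')
  refine this.congr_deriv ?_
  field_simp

lemma hasDerivAt_bifurcate_qab (W : Geon) {h x : ℝ} (hk : deriv W.A h ≠ 0) :
    HasDerivAt (fun x => 1 / (deriv W.A h / 2 * W.sigmaP x))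
      (-deriv W.sigmaP x / (deriv W.A h / 2 * W.sigmaP x ^ 2)) x := by
  have hσ := W.sigmaP_pos x
  have := (hasDerivAt_const x (1 : ℝ)).fun_div
    ((W.hasDerivAt_sigmaP x).const_mul (deriv W.A h / 2))
    (mul_ne_zero (div_ne_zero hk two_ne_zero) hσ.ne')
  refine this.congr_deriv ?_
  field_simp
  ring

lemma bifurcate_qaa (W : Geon) (h : ℝ) (p : ℝ × ℝ) : (W.bifurcate h).qaa p =
    -(p.2 ^ 2 * (W.slopeA₂ h (h + p.1 * p.2)
      / ((deriv W.A h / 2) ^ 2 * W.sigmaP (h + p.1 * p.2)))) := by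
  simp only [bifurcate, slopeA₂]
  ring

lemma pdA_bifurcate_qaa (W : Geon) {h U V : ℝ} (hh : W.Reg h) (hk : deriv W.A h ≠ 0)
    (hx : W.Reg (h + U * V)) : pdA (W.bifurcate h).qaa (U, V) =
      -(V ^ 2 * ((deriv (W.slopeA₂ h) (h + U * V) * W.sigmaP (h + U * V)
        - W.slopeA₂ h (h + U * V) * deriv W.sigmaP (h + U * V))
        / ((deriv W.A h / 2) ^ 2 * W.sigmaP (h + U * V) ^ 2) * V)) := by
  have := ((pdA_comp_add_mul (W.hasDerivAt_bifurcate_profile hh hx hk)).const_mul (V ^ 2)).fun_neg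
  rw [← this.deriv]
  simp only [pdA, bifurcate_qaa]

lemma pdB_bifurcate_qaa (W : Geon) {h U V : ℝ} (hh : W.Reg h) (hk : deriv W.A h ≠ 0)
    (hx : W.Reg (h + U * V)) : pdB (W.bifurcate h).qaa (U, V) =
      -(2 * V * (W.slopeA₂ h (h + U * V) / ((deriv W.A h / 2) ^ 2 * W.sigmaP (h + U * V)))
        + V ^ 2 * ((deriv (W.slopeA₂ h) (h + U * V) * W.sigmaP (h + U * V)
        - W.slopeA₂ h (h + U * V) * deriv W.sigmaP (h + U * V))
        / ((deriv W.A h / 2) ^ 2 * W.sigmaP (h + U * V) ^ 2) * U)) := by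
  have := ((hasDerivAt_pow 2 V).fun_mul
    (pdB_comp_add_mul (W.hasDerivAt_bifurcate_profile hh hx hk))).fun_neg
  simp only [pdB, bifurcate_qaa]
  refine this.deriv.trans ?_
  push_cast
  ring

lemma pdA_bifurcate_qab (W : Geon) {h : ℝ} (hk : deriv W.A h ≠ 0) (U V : ℝ) :
    pdA (W.bifurcate h).qab (U, V) =
      -deriv W.sigmaP (h + U * V) / (deriv W.A h / 2 * W.sigmaP (h + U * V) ^ 2) * V :=
  (pdA_comp_add_mul (W.hasDerivAt_bifurcate_qab hk)).deriv

lemma pdB_bifurcate_qab (W : Geon) {h : ℝ} (hk : deriv W.A h ≠ 0) (U V : ℝ) :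
    pdB (W.bifurcate h).qab (U, V) =
      -deriv W.sigmaP (h + U * V) / (deriv W.A h / 2 * W.sigmaP (h + U * V) ^ 2) * U :=
  (pdB_comp_add_mul (W.hasDerivAt_bifurcate_qab hk)).deriv

lemma pdA_bifurcate_qbb (W : Geon) (h : ℝ) (p : ℝ × ℝ) : pdA (W.bifurcate h).qbb p = 0 := by
  simp [pdA, bifurcate]

lemma pdB_bifurcate_qbb (W : Geon) (h : ℝ) (p : ℝ × ℝ) : pdB (W.bifurcate h).qbb p = 0 := by
  simp [pdB, bifurcate]

lemma pdA_bifurcate_radius_sq (W : Geon) (h U V : ℝ) :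
    pdA (fun p => W.radius ((W.bifurcate h).X p) ^ 2) (U, V) =
      2 * (h + U * V) / W.sigmaP (h + U * V) * V :=
  (pdA_comp_add_mul (W.hasDerivAt_radius_sq (h + U * V))).deriv

lemma pdB_bifurcate_radius_sq (W : Geon) (h U V : ℝ) :
    pdB (fun p => W.radius ((W.bifurcate h).X p) ^ 2) (U, V) =
      2 * (h + U * V) / W.sigmaP (h + U * V) * U :=
  (pdB_comp_add_mul (W.hasDerivAt_radius_sq (h + U * V))).deriv

/-- In Kruskal-type coordinates, with `A = (x - h) B` and `B` smooth, the momentum `p` conjugate to `V` gives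
`x' / σ₊ = B V p - E`, with no division by `A`. -/
lemma IsGeodesicOn.radialAt_bifurcate {W : Geon} {κ E L h : ℝ} (hh : W.Reg h) (h0 : W.A h = 0)
    (hk : deriv W.A h ≠ 0) {a b : ℝ → ℝ} {n : ℝ → Vec3} {J : Set ℝ}
    (hg : W.IsGeodesicOn (W.bifurcate h) κ E a b n J) (hJ : IsOpen J) {s : ℝ} (hs : s ∈ J)
    (hL : W.radius (h + a s * b s) ^ 2 * ‖deriv n s‖ = L) :
    W.RadialAt κ E L (fun s => h + a s * b s) s := by
  have hreg : ∀ u ∈ J, W.Reg (h + a u * b u) := fun u hu => hg.mem u hu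
  have hregs := hreg s hs
  have hσ := W.sigmaP_pos (h + a s * b s)
  have hr := W.radius_pos (h + a s * b s)
  have hxd : ∀ u ∈ J, HasDerivAt (fun s => h + a s * b s) (deriv a u * b u + a u * deriv b u) u :=
    fun u hu => ((hg.diff_a u hu).hasDerivAt.fun_mul (hg.diff_b u hu).hasDerivAt).const_add h
  have hn2 := AngularAt.norm_deriv_sq (x := fun s => h + a s * b s) hL
  have hnorm := hg.norm_tangent s hs
  have hb := hg.eqn_b s hs
  rw [W.pdB_bifurcate_qaa hh hk hregs, W.pdB_bifurcate_qab hk, pdB_bifurcate_qbb,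
    pdB_bifurcate_radius_sq, hn2] at hb
  have hen : ∀ u ∈ J, -E = -(b u ^ 2 * (W.slopeA₂ h (h + a u * b u)
      / ((deriv W.A h / 2) ^ 2 * W.sigmaP (h + a u * b u)))) * (deriv W.A h / 2 * a u * deriv a u)
      + (a u * deriv b u - b u * deriv a u) / W.sigmaP (h + a u * b u) := by
    intro u hu
    have := hg.energy u hu
    have hσu := W.sigmaP_pos (h + a u * b u)
    rw [bifurcate_qaa] at this
    simp only [bifurcate] at this
    rw [← this]
    field_simp
    ring
  have hens := hen s hs
  rw [bifurcate_qaa] at hnorm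
  simp only [bifurcate] at hnorm
  rw [hn2] at hnorm
  have hE : (deriv (fun s => h + a s * b s) s / W.sigmaP (h + a s * b s)) ^ 2
      = E ^ 2 - W.V κ L (h + a s * b s) := by
    rw [(hxd s hs).deriv, V_eq, F, massTerm, ← neg_sq E, hens, W.A_eq_mul_slopeA h0,
      W.slopeA_eq h, add_sub_cancel_left]
    -- what remains is an identity between rational functions, modulo the norm of the tangent
    clear hb hen hens
    generalize W.sigmaP (h + a s * b s) = σ at *
    generalize W.radius (h + a s * b s) = r at *
    generalize W.slopeA₂ h (h + a s * b s) = D at *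
    linear_combination (norm := (field_simp; ring))
      a s * b s * (deriv W.A h + a s * b s * D) / σ * hnorm
  refine ⟨hregs, (hxd s hs).differentiableAt, ?_, hE⟩
  have hBd := (W.hasDerivAt_slopeA hh hregs).comp s (hxd s hs)
  have hy := ((hBd.fun_mul (hg.diff_b s hs).hasDerivAt).fun_mul hb).sub_const E
  refine (hy.congr_of_eventuallyEq ?_).congr_deriv ?_
  · filter_upwards [hJ.mem_nhds hs] with u hu
    have hσu := W.sigmaP_pos (h + a u * b u)
    rw [(hxd u hu).deriv]
    simp only [bifurcate, Function.comp_apply]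
    rw [W.slopeA_eq h]
    linear_combination (norm := (field_simp; ring)) -hen u hu
  · rw [W.deriv_V κ L hregs, massTerm, W.deriv_A_eq hh h0 hregs, W.A_eq_mul_slopeA h0,
      W.slopeA_eq h]
    simp only [bifurcate, Function.comp_apply]
    rw [W.slopeA_eq h, add_sub_cancel_left]
    clear hy hBd hE hb hen hens
    generalize W.slopeA₂ h (h + a s * b s) = D at *
    generalize deriv (W.slopeA₂ h) (h + a s * b s) = D' at *
    generalize W.sigmaP (h + a s * b s) = σ at *
    generalize deriv W.sigmaP (h + a s * b s) = σ' at *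
    generalize W.radius (h + a s * b s) = r at *
    linear_combination (norm := (field_simp; ring))
      ((deriv W.A h + a s * b s * D + a s * b s * (D + a s * b s * D')) * σ
        - a s * b s * (deriv W.A h + a s * b s * D) * σ') / σ / 2 * hnorm

/-- A solution of the reduced equations with `E = 0` that reaches a non-degenerate horizon `x = h` is,
near that parameter, a geodesic in the Kruskal-type coordinates: it passes through the bifurcation
sphere. With `y = x' / σ₊`, the lift is `U = y P`, `V = (x - h) / U`, where `P` is the exponential of
a primitive chosen such that `U' / U = k x' / A`. -/
lemma exists_bifurcate_lift {W : Geon} {κ L h : ℝ} (hκ : κ = 0 ∨ κ = 1) (hne : κ = 1 ∨ L ≠ 0)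
    (hh : W.Reg h) (h0 : W.A h = 0) (hk : deriv W.A h ≠ 0) {x : ℝ → ℝ} {n : ℝ → Vec3} {J : Set ℝ}
    (hJ : IsOpen J) {s₀ : ℝ} (hs₀ : s₀ ∈ J) (hR : ∀ s ∈ J, W.RadialAt κ 0 L x s)
    (hN : ∀ s ∈ J, W.AngularAt L x n s) (hx₀ : x s₀ = h) :
    ∃ ε > 0, ∃ a b : ℝ → ℝ, Ioo (s₀ - ε) (s₀ + ε) ⊆ J ∧
      W.IsGeodesicOn (W.bifurcate h) κ 0 a b n (Ioo (s₀ - ε) (s₀ + ε)) ∧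
      ∀ s ∈ Ioo (s₀ - ε) (s₀ + ε), x s = h + a s * b s := by
  set k := deriv W.A h / 2 with hkdef
  have hk0 : k ≠ 0 := div_ne_zero hk two_ne_zero
  have h2k : deriv W.A h = 2 * k := by rw [hkdef]; ring
  -- `Num = -k Φ + σ₊ V' / 2`, with `Φ` the mass term, vanishes on the horizon; its quotient `N₁` by `x - h` is
  -- smooth
  set Num : ℝ → ℝ := fun u => -k * W.massTerm κ L u + W.sigmaP u * deriv (W.V κ L) u / 2 with hNum
  have hNuman : ∀ u, W.Reg u → AnalyticAt ℝ Num u := fun u hu =>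
    (analyticAt_const.fun_mul (W.analyticAt_massTerm κ L u)).fun_add
      (((W.analyticAt_sigmaP u).fun_mul (W.analyticAt_V κ L hu).deriv).fun_div analyticAt_const
        two_ne_zero)
  have hNumh : Num h = 0 := by
    have := W.sigmaP_pos h
    simp only [hNum]
    rw [W.deriv_V κ L hh, h0, h2k]
    field_simp
    ring
  set N₁ : ℝ → ℝ := dslope Num h with hN₁
  have hNumeq : ∀ u, Num u = (u - h) * N₁ u := by
    intro u
    have := sub_smul_dslope Num h u
    rw [hNumh, sub_zero, smul_eq_mul] at this
    exact this.symm
  have hN₁c : ∀ u, W.Reg u → ContinuousAt N₁ u := fun u hu =>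
    ((hNuman u hu).dslope_of_analyticAt (hNuman h hh)).continuousAt
  -- a neighbourhood on which `A / (x - h)` does not vanish
  obtain ⟨ε, hε, hεJ⟩ : ∃ ε > 0, Ioo (s₀ - ε) (s₀ + ε) ⊆ {s | s ∈ J ∧ W.slopeA h (x s) ≠ 0} := by
    have h1 : ContinuousAt (fun s => W.slopeA h (x s)) s₀ := by
      refine ContinuousAt.comp (f := x) ?_ (hR s₀ hs₀).diff.continuousAt
      rw [hx₀]
      exact (W.analyticAt_slopeA hh hh).continuousAt
    have h2 : ∀ᶠ s in 𝓝 s₀, s ∈ J ∧ W.slopeA h (x s) ≠ 0 :=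
      (show ∀ᶠ s in 𝓝 s₀, s ∈ J from hJ.mem_nhds hs₀).and
        (h1.eventually_ne (by rw [hx₀, slopeA_self]; exact hk))
    obtain ⟨ε, hε, h3⟩ := Metric.eventually_nhds_iff_ball.1 h2
    refine ⟨ε, hε, fun s hs => h3 s ?_⟩
    rwa [Real.ball_eq_Ioo]
  set I := Ioo (s₀ - ε) (s₀ + ε) with hI
  have hIJ : I ⊆ J := fun s hs => (hεJ hs).1
  have hB0 : ∀ s ∈ I, W.slopeA h (x s) ≠ 0 := fun s hs => (hεJ hs).2
  have hΦ0 : ∀ s, 0 < W.massTerm κ L (x s) := fun s => W.massTerm_pos hκ hne _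
  set y : ℝ → ℝ := fun s => deriv x s / W.sigmaP (x s) with hy
  have hyd : ∀ s ∈ I, HasDerivAt y (-(W.sigmaP (x s) * deriv (W.V κ L) (x s)) / 2) s :=
    fun s hs => (hR s (hIJ hs)).accel
  have hreg : ∀ s ∈ I, W.Reg (x s) := fun s hs => (hR s (hIJ hs)).reg
  have hxd : ∀ s ∈ I, HasDerivAt x (W.sigmaP (x s) * y s) s := by
    intro s hs
    refine (hR s (hIJ hs)).diff.hasDerivAt.congr_deriv ?_
    have := W.sigmaP_pos (x s)
    simp only [hy]
    field_simp
  have hy2 : ∀ s ∈ I, y s ^ 2 = -((x s - h) * W.slopeA h (x s) * W.massTerm κ L (x s)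
      / W.sigmaP (x s)) := by
    intro s hs
    have := (hR s (hIJ hs)).energy
    rw [V_eq, F, W.A_eq_mul_slopeA h0] at this
    simp only [hy]
    rw [this]
    ring
  -- `g` is `Num / y`, written so as to be continuous where `y = 0`: by the radial equation `y²` is a multiple of
  -- `x - h`
  set g : ℝ → ℝ := fun s => -(y s * W.sigmaP (x s) * N₁ (x s)
    / (W.slopeA h (x s) * W.massTerm κ L (x s))) with hg
  have hgc : ContinuousOn g I := by
    intro s hs
    have hxc := (hxd s hs).continuousAt
    have h1 : ContinuousAt (fun s => W.sigmaP (x s)) s :=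
      (W.continuous_sigmaP.continuousAt).comp hxc
    have h2 : ContinuousAt (fun s => N₁ (x s)) s := ContinuousAt.comp (f := x) (hN₁c _ (hreg s hs)) hxc
    have h3 : ContinuousAt (fun s => W.slopeA h (x s)) s :=
      ContinuousAt.comp (f := x) (W.analyticAt_slopeA hh (hreg s hs)).continuousAt hxc
    have h4 : ContinuousAt (fun s => W.massTerm κ L (x s)) s :=
      ContinuousAt.comp (f := x) (W.analyticAt_massTerm κ L _).continuousAt hxc
    exact ((((hyd s hs).continuousAt.mul h1).mul h2).div (h3.mul h4)
      (mul_ne_zero (hB0 s hs) (hΦ0 s).ne')).neg.continuousWithinAt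
  obtain ⟨G, _, hG⟩ := exists_primitive_of_continuousOn isOpen_Ioo ordConnected_Ioo hgc
    (c := s₀) ⟨by linarith, by linarith⟩
  set P : ℝ → ℝ := fun s => Real.exp (G s) with hP
  have hP0 : ∀ s, 0 < P s := fun s => Real.exp_pos _
  have hPd : ∀ s ∈ I, HasDerivAt P (P s * g s) s := fun s hs => (hG s hs).exp
  set a : ℝ → ℝ := fun s => y s * P s with ha
  set b : ℝ → ℝ := fun s => -(W.sigmaP (x s) / (W.slopeA h (x s) * W.massTerm κ L (x s))
    * y s) / P s with hb
  have hab : ∀ s ∈ I, x s = h + a s * b s := by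
    intro s hs
    have h1 := hy2 s hs
    have h2 := hB0 s hs
    have h3 := hΦ0 s
    have h4 := hP0 s
    have h5 := W.sigmaP_pos (x s)
    have : a s * b s = -(W.sigmaP (x s) / (W.slopeA h (x s) * W.massTerm κ L (x s)) * y s ^ 2) := by
      simp only [ha, hb]
      field_simp
    rw [this, h1]
    field_simp
    ring
  -- `U'` does not vanish: the lift passes through `U = 0` with non-zero velocity
  have had : ∀ s ∈ I, HasDerivAt a (-(k * W.massTerm κ L (x s) * P s)) s := by
    intro s hs
    refine ((hyd s hs).fun_mul (hPd s hs)).congr_deriv ?_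
    have h1 : y s * g s = Num (x s) := by
      have h2 := hB0 s hs
      have h3 := hΦ0 s
      have h5 := W.sigmaP_pos (x s)
      have : y s * g s = -(y s ^ 2 * W.sigmaP (x s) * N₁ (x s)
        / (W.slopeA h (x s) * W.massTerm κ L (x s))) := by simp only [hg]; ring
      rw [this, hy2 s hs, hNumeq]
      field_simp
    have : y s * (P s * g s) = P s * Num (x s) := by rw [← h1]; ring
    rw [this]
    simp only [hNum]
    ring
  have hbd : ∀ s ∈ I, HasDerivAt b (W.sigmaP (x s) * (1 - k / W.slopeA h (x s)) / P s) s := by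
    intro s hs
    have e1 := (W.hasDerivAt_sigmaP (x s)).comp s (hxd s hs)
    have e2 := (W.hasDerivAt_slopeA hh (hreg s hs)).comp s (hxd s hs)
    have e3 := (W.hasDerivAt_massTerm κ L (x s)).comp s (hxd s hs)
    have h2 := hB0 s hs
    have h3 := hΦ0 s
    have h4 := hP0 s
    have h5 := W.sigmaP_pos (x s)
    have h6 := W.radius_pos (x s)
    have e4 := ((((e1.fun_div (e2.fun_mul e3) (mul_ne_zero h2 h3.ne')).fun_mul
      (hyd s hs)).fun_neg).fun_div (hPd s hs) h4.ne')
    refine e4.congr_deriv ?_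
    have hg2 : g s * y s = Num (x s) := by
      have : g s * y s = -(y s ^ 2 * W.sigmaP (x s) * N₁ (x s)
        / (W.slopeA h (x s) * W.massTerm κ L (x s))) := by simp only [hg]; ring
      rw [this, hy2 s hs, hNumeq]
      field_simp
    have hy2s := hy2 s hs
    simp only [hNum] at hg2
    rw [W.deriv_V κ L (hreg s hs), W.deriv_A_eq hh h0 (hreg s hs), W.A_eq_mul_slopeA h0] at hg2 ⊢
    simp only [Function.comp_apply]
    clear e1 e2 e3 e4
    generalize g s = g' at *
    generalize y s = y' at *
    generalize P s = P' at *
    generalize W.slopeA₂ h (x s) + (x s - h) * deriv (W.slopeA₂ h) (x s) = B' at *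
    generalize W.slopeA h (x s) = B at *
    generalize L ^ 2 * (2 * x s / W.sigmaP (x s)) = M at *
    generalize W.massTerm κ L (x s) = Φ at *
    generalize W.sigmaP (x s) = σ at *
    generalize W.radius (x s) = r at *
    generalize deriv W.sigmaP (x s) = σ' at *
    generalize x s - h = ξ at *
    -- a rational identity modulo the radial equation and `g y = Num`
    linear_combination (norm := (field_simp; ring))
      -(σ' * σ * B * Φ - σ ^ 2 * B' * Φ + σ ^ 2 * B * M / r ^ 4) / ((B * Φ) ^ 2 * P') * hy2s
        + σ / (B * Φ * P') * hg2
  -- the momenta conjugate to `a` and `b`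
  have hpa : ∀ s ∈ I, (W.bifurcate h).qaa (a s, b s) * deriv a s
      + (W.bifurcate h).qab (a s, b s) * deriv b s = 1 / (W.slopeA h (x s) * P s) := by
    intro s hs
    rw [bifurcate_qaa, (had s hs).deriv, (hbd s hs).deriv]
    simp only [bifurcate]
    rw [← hab s hs, ← hkdef]
    have hB := W.slopeA_eq h (x s)
    rw [h2k] at hB
    have hy2s := hy2 s hs
    have h2 := hB0 s hs
    have h3 := hΦ0 s
    have h4 := hP0 s
    have h5 := W.sigmaP_pos (x s)
    simp only [hb]
    generalize y s = y' at *
    generalize P s = P' at *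
    generalize W.slopeA₂ h (x s) = D at *
    generalize W.slopeA h (x s) = B at *
    generalize W.massTerm κ L (x s) = Φ at *
    generalize W.sigmaP (x s) = σ at *
    generalize x s - h = ξ at *
    linear_combination (norm := (field_simp; ring))
      σ * D / (B ^ 2 * Φ * P' * k) * hy2s + 1 / (k * B * P') * hB
  have hpb : ∀ s ∈ I, (W.bifurcate h).qab (a s, b s) * deriv a s
      = -(W.massTerm κ L (x s) * P s / W.sigmaP (x s)) := by
    intro s hs
    rw [(had s hs).deriv]
    simp only [bifurcate]
    rw [← hab s hs, ← hkdef]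
    have h5 := W.sigmaP_pos (x s)
    field_simp
  have hX : ∀ s ∈ I, (fun u => W.radius ((W.bifurcate h).X (a u, b u)) ^ 2 • deriv n u)
      =ᶠ[𝓝 s] fun u => W.radius (x u) ^ 2 • deriv n u := by
    intro s hs
    filter_upwards [isOpen_Ioo.mem_nhds hs] with u hu
    simp only [bifurcate]
    rw [← hab u hu]
  have hLs : ∀ s ∈ I, ‖deriv n s‖ ^ 2 = L ^ 2 / W.radius (x s) ^ 4 := fun s hs =>
    AngularAt.norm_deriv_sq (hN s (hIJ hs)).momentum
  -- off the bifurcation sphere all quantities are rational functions of those at `x s`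
  have hrel : ∀ s ∈ I, y s ≠ 0 →
      x s - h = -(y s ^ 2 * W.sigmaP (x s) / (W.slopeA h (x s) * W.massTerm κ L (x s))) ∧
      g s = (-k * W.massTerm κ L (x s) + W.sigmaP (x s) *
        (((W.slopeA h (x s) + -(y s ^ 2 * W.sigmaP (x s) / (W.slopeA h (x s) * W.massTerm κ L (x s)))
          * deriv (W.slopeA h) (x s)) * W.sigmaP (x s)
        - -(y s ^ 2 * W.sigmaP (x s) / (W.slopeA h (x s) * W.massTerm κ L (x s)))
          * W.slopeA h (x s) * deriv W.sigmaP (x s)) / W.sigmaP (x s) ^ 2 * W.massTerm κ L (x s)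
        - -(y s ^ 2 * W.sigmaP (x s) / (W.slopeA h (x s) * W.massTerm κ L (x s))) * W.slopeA h (x s)
          / W.sigmaP (x s) * (L ^ 2 * (2 * x s / W.sigmaP (x s))) / W.radius (x s) ^ 4) / 2)
        / y s ∧
      W.slopeA₂ h (x s) = (W.slopeA h (x s) - 2 * k) /
        -(y s ^ 2 * W.sigmaP (x s) / (W.slopeA h (x s) * W.massTerm κ L (x s))) ∧
      deriv (W.slopeA₂ h) (x s) = (deriv (W.slopeA h) (x s) - W.slopeA₂ h (x s)) /
        -(y s ^ 2 * W.sigmaP (x s) / (W.slopeA h (x s) * W.massTerm κ L (x s))) := by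
    intro s hs hy0
    have h2 := hB0 s hs
    have h3 := hΦ0 s
    have h5 := W.sigmaP_pos (x s)
    have e1 : x s - h
        = -(y s ^ 2 * W.sigmaP (x s) / (W.slopeA h (x s) * W.massTerm κ L (x s))) := by
      rw [hy2 s hs]
      field_simp
    have hξ : x s - h ≠ 0 := by
      rw [e1]
      exact neg_ne_zero.2 (div_ne_zero (mul_ne_zero (pow_ne_zero 2 hy0) h5.ne')
        (mul_ne_zero h2 h3.ne'))
    have e2 := W.slopeA_eq h (x s)
    have e3 := (W.hasDerivAt_slopeA hh (hreg s hs)).deriv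
    refine ⟨e1, ?_, ?_, ?_⟩
    · have e4 : g s * y s = Num (x s) := by
        have : g s * y s = -(y s ^ 2 * W.sigmaP (x s) * N₁ (x s)
          / (W.slopeA h (x s) * W.massTerm κ L (x s))) := by simp only [hg]; ring
        rw [this, hy2 s hs, hNumeq]
        field_simp
      rw [eq_div_iff hy0, e4, ← e1]
      simp only [hNum]
      rw [W.deriv_V κ L (hreg s hs), W.deriv_A_eq hh h0 (hreg s hs), ← e3, W.A_eq_mul_slopeA h0]
    · rw [← e1, eq_div_iff hξ, e2, h2k]
      ring
    · rw [← e1, eq_div_iff hξ, e3]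
      ring
  refine ⟨ε, hε, a, b, hIJ, ?_, hab⟩
  refine ⟨fun s hs => ?_, fun s hs => (hN s (hIJ hs)).unit,
    fun s hs => (had s hs).differentiableAt, fun s hs => (hbd s hs).differentiableAt,
    fun s hs => (hN s (hIJ hs)).diff, ?_, ?_, ?_, ?_, ?_, ?_⟩
  · change W.Reg (h + a s * b s)
    rw [← hab s hs]
    exact hreg s hs
  · intro s hs
    have hregs : W.Reg (h + a s * b s) := by rw [← hab s hs]; exact hreg s hs
    have e2 := (W.hasDerivAt_slopeA hh (hreg s hs)).comp s (hxd s hs)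
    have h2 := hB0 s hs
    have h3 := hΦ0 s
    have h4 := hP0 s
    have e := (hasDerivAt_const s (1 : ℝ)).fun_div (e2.fun_mul (hPd s hs)) (mul_ne_zero h2 h4.ne')
    refine (e.congr_of_eventuallyEq ?_).congr_deriv ?_
    · filter_upwards [isOpen_Ioo.mem_nhds hs] with u hu
      exact hpa u hu
    · rw [W.pdA_bifurcate_qaa hh hk hregs, W.pdA_bifurcate_qab hk, pdA_bifurcate_qbb,
        pdA_bifurcate_radius_sq, hLs s hs, (had s hs).deriv, (hbd s hs).deriv, ← hab s hs, ← hkdef]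
      simp only [Function.comp_apply]
      -- at the bifurcation sphere itself both sides vanish
      rcases eq_or_ne (y s) 0 with hy0 | hy0
      · simp [hg, hb, hy0]
      · obtain ⟨-, hg2, hD, hD'⟩ := hrel s hs hy0
        rw [show W.slopeA₂ h (x s) + (x s - h) * deriv (W.slopeA₂ h) (x s) = deriv (W.slopeA h) (x s)
          from (W.hasDerivAt_slopeA hh (hreg s hs)).deriv.symm]
        rw [hg2, hD', hD]
        clear hg2 hD hD' e e2
        simp only [hb]
        have h2 := hB0 s hs
        have h3 := hΦ0 s
        have h4 := hP0 s
        have h5 := W.sigmaP_pos (x s)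
        have h6 := W.radius_pos (x s)
        generalize y s = y' at *
        generalize P s = P' at *
        generalize deriv (W.slopeA h) (x s) = B' at *
        generalize W.slopeA h (x s) = B at *
        generalize W.massTerm κ L (x s) = Φ at *
        generalize deriv W.sigmaP (x s) = σ' at *
        generalize W.sigmaP (x s) = σ at *
        generalize W.radius (x s) = r at *
        generalize x s = x' at *
        field_simp
        ring
  · intro s hs
    have hregs : W.Reg (h + a s * b s) := by rw [← hab s hs]; exact hreg s hs
    have e1 := (W.hasDerivAt_sigmaP (x s)).comp s (hxd s hs)
    have e3 := (W.hasDerivAt_massTerm κ L (x s)).comp s (hxd s hs)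
    have h5 := W.sigmaP_pos (x s)
    have e := ((e3.fun_mul (hPd s hs)).fun_div e1 h5.ne').fun_neg
    refine (e.congr_of_eventuallyEq ?_).congr_deriv ?_
    · filter_upwards [isOpen_Ioo.mem_nhds hs] with u hu
      have : (W.bifurcate h).qbb (a u, b u) = 0 := rfl
      rw [hpb u hu, this, zero_mul, add_zero]
      rfl
    · rw [W.pdB_bifurcate_qaa hh hk hregs, W.pdB_bifurcate_qab hk, pdB_bifurcate_qbb,
        pdB_bifurcate_radius_sq, hLs s hs, (had s hs).deriv, (hbd s hs).deriv, ← hab s hs, ← hkdef]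
      simp only [Function.comp_apply]
      rcases eq_or_ne (y s) 0 with hy0 | hy0
      · simp [hg, ha, hb, hy0]
      · obtain ⟨-, hg2, hD, hD'⟩ := hrel s hs hy0
        rw [hg2, hD', hD]
        clear hg2 hD hD' e e1 e3
        simp only [ha, hb]
        have h2 := hB0 s hs
        have h3 := hΦ0 s
        have h4 := hP0 s
        have h5 := W.sigmaP_pos (x s)
        have h6 := W.radius_pos (x s)
        generalize y s = y' at *
        generalize P s = P' at *
        generalize deriv (W.slopeA h) (x s) = B' at *
        generalize W.slopeA h (x s) = B at *
        generalize W.massTerm κ L (x s) = Φ at *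
        generalize deriv W.sigmaP (x s) = σ' at *
        generalize W.sigmaP (x s) = σ at *
        generalize W.radius (x s) = r at *
        generalize x s = x' at *
        field_simp
        ring
  · intro s hs
    have := (hN s (hIJ hs)).eqn.congr_of_eventuallyEq (hX s hs)
    simp only [bifurcate] at this ⊢
    rwa [← hab s hs]
  · rintro s hs ⟨h1, -, -⟩
    rw [(had s hs).deriv, neg_eq_zero] at h1
    exact mul_ne_zero (mul_ne_zero hk0 (hΦ0 s).ne') (hP0 s).ne' h1
  · intro s hs
    have e1 := hpa s hs
    have e2 := hpb s hs
    have e3 : (W.bifurcate h).qbb (a s, b s) = 0 := rfl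
    have e4 : W.radius ((W.bifurcate h).X (a s, b s)) = W.radius (x s) := by rw [hab s hs]; rfl
    have h2 := hB0 s hs
    have h3 := hΦ0 s
    have h4 := hP0 s
    have h5 := W.sigmaP_pos (x s)
    have h6 := W.radius_pos (x s)
    rw [e3, e4, hLs s hs]
    have h7 : W.massTerm κ L (x s) = κ + L ^ 2 / W.radius (x s) ^ 2 := rfl
    have h8 : deriv a s * (1 / (W.slopeA h (x s) * P s)) + deriv b s *
        -(W.massTerm κ L (x s) * P s / W.sigmaP (x s)) = -W.massTerm κ L (x s) := by
      rw [(had s hs).deriv, (hbd s hs).deriv]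
      field_simp
      ring
    have h9 : W.radius (x s) ^ 2 * (L ^ 2 / W.radius (x s) ^ 4) = L ^ 2 / W.radius (x s) ^ 2 := by
      field_simp
    rw [h9]
    linear_combination deriv a s * e1 + deriv b s * e2 + h8 - h7
  · intro s hs
    have e1 := hpa s hs
    have e2 := hpb s hs
    have e3 : (W.bifurcate h).qbb (a s, b s) = 0 := rfl
    have e4 : (W.bifurcate h).Ka (a s, b s) = k * a s := rfl
    have e5 : (W.bifurcate h).Kb (a s, b s) = -(k * b s) := rfl
    have h2 := hB0 s hs
    have h3 := hΦ0 s
    have h4 := hP0 s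
    have h5 := W.sigmaP_pos (x s)
    rw [e3, e4, e5]
    have h8 : a s * (1 / (W.slopeA h (x s) * P s)) - b s *
        -(W.massTerm κ L (x s) * P s / W.sigmaP (x s)) = 0 := by
      simp only [ha, hb]
      field_simp
      ring
    linear_combination -k * a s * e1 + k * b s * e2 - k * h8

end Geon

/-! ### Propagation of equality along an interval -/

/-- Two curves with equal germs at one parameter of a connected open set agree on that set, if equality of
germs passes to limits of parameters. -/
lemma eqOn_of_eventuallyEq_of_frequently {β : Type*} {f g : ℝ → β} {J : Set ℝ} (hJ : IsPreconnected J)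
    {s₀ : ℝ} (hs₀ : s₀ ∈ J) (h₀ : f =ᶠ[𝓝 s₀] g)
    (hstep : ∀ s ∈ J, (∃ᶠ u in 𝓝 s, f =ᶠ[𝓝 u] g) → f =ᶠ[𝓝 s] g) :
    ∀ s ∈ J, f =ᶠ[𝓝 s] g := by
  have h : J ⊆ {s | f =ᶠ[𝓝 s] g} :=
    hJ.subset_of_closure_inter_subset (isOpen_setOfPred_eventually_nhds) ⟨s₀, hs₀, h₀⟩
      fun s hs => hstep s hs.2 (mem_closure_iff_frequently.1 hs.1)
  exact h

lemma ContinuousAt.eq_of_frequently_eq {β : Type*} [TopologicalSpace β] [T2Space β] {f g : ℝ → β}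
    {s : ℝ} (hf : ContinuousAt f s) (hg : ContinuousAt g s) (h : ∃ᶠ u in 𝓝 s, f u = g u) :
    f s = g s := by
  by_contra hne
  exact h ((hf.prodMk_nhds hg).eventually (isClosed_diagonal.isOpen_compl.mem_nhds hne))

namespace Geon

/-! ### The radial equation as an autonomous system -/

/-- The vector field of the radial motion, in the variables `x` and `y = x' / σ₊`. -/
def field (W : Geon) (κ L : ℝ) (p : ℝ × ℝ) : ℝ × ℝ :=
  (W.sigmaP p.1 * p.2, -(W.sigmaP p.1 * deriv (W.V κ L) p.1) / 2)

lemma contDiffAt_field (W : Geon) (κ L : ℝ) {p : ℝ × ℝ} (hp : W.Reg p.1) :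
    ContDiffAt ℝ 1 (W.field κ L) p := by
  have h1 : AnalyticAt ℝ (fun p : ℝ × ℝ => W.sigmaP p.1) p :=
    (W.analyticAt_sigmaP p.1).comp analyticAt_fst
  have h2 : AnalyticAt ℝ (fun p : ℝ × ℝ => deriv (W.V κ L) p.1) p :=
    (W.analyticAt_V κ L hp).deriv.comp analyticAt_fst
  exact ((h1.fun_mul analyticAt_snd).prod
    ((h1.fun_mul h2).fun_neg.fun_div analyticAt_const two_ne_zero)).contDiffAt

lemma RadialAt.hasDerivAt {W : Geon} {κ E L : ℝ} {x : ℝ → ℝ} {s : ℝ} (h : W.RadialAt κ E L x s) :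
    HasDerivAt (fun u => (x u, deriv x u / W.sigmaP (x u)))
      (W.field κ L (x s, deriv x s / W.sigmaP (x s))) s := by
  refine HasDerivAt.prodMk ?_ h.accel
  have := W.sigmaP_pos (x s)
  refine h.diff.hasDerivAt.congr_deriv ?_
  field_simp

/-- Local uniqueness for the autonomous system, whose vector field is of class `C¹`. -/
lemma RadialAt.eventuallyEq {W : Geon} {κ E₁ E₂ L : ℝ} {x₁ x₂ : ℝ → ℝ} {s : ℝ}
    (h₁ : ∀ᶠ u in 𝓝 s, W.RadialAt κ E₁ L x₁ u) (h₂ : ∀ᶠ u in 𝓝 s, W.RadialAt κ E₂ L x₂ u)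
    (hx : x₁ s = x₂ s) (hd : deriv x₁ s = deriv x₂ s) : x₁ =ᶠ[𝓝 s] x₂ := by
  obtain ⟨K, U, hU, hl⟩ := (W.contDiffAt_field κ L
    (p := (x₁ s, deriv x₁ s / W.sigmaP (x₁ s))) h₁.self_of_nhds.reg).exists_lipschitzOnWith
  have c₁ := h₁.self_of_nhds.hasDerivAt.continuousAt
  have c₂ := h₂.self_of_nhds.hasDerivAt.continuousAt
  have h := ODE_solution_unique_of_eventually (t₀ := s) (K := K) (s := fun _ => U)
    (v := fun _ => W.field κ L) (f := fun u => (x₁ u, deriv x₁ u / W.sigmaP (x₁ u)))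
    (g := fun u => (x₂ u, deriv x₂ u / W.sigmaP (x₂ u))) (Eventually.of_forall fun _ => hl)
    (by filter_upwards [h₁, c₁.preimage_mem_nhds hU] with u h3 h4 using ⟨h3.hasDerivAt, h4⟩)
    (by
      have hU' : U ∈ 𝓝 (x₂ s, deriv x₂ s / W.sigmaP (x₂ s)) := by rw [← hd, ← hx]; exact hU
      filter_upwards [h₂, c₂.preimage_mem_nhds hU'] with u h3 h4 using ⟨h3.hasDerivAt, h4⟩)
    (by simp only [hx, hd])
  filter_upwards [h] with u hu using congrArg Prod.fst hu

/-- Near a regular state all initial value problems are solvable for a common time. -/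
lemma exists_radialAt_of_mem_nhds (W : Geon) (κ L η : ℝ) {ξ : ℝ} (hξ : W.Reg ξ) :
    ∃ δ > 0, ∃ U ∈ 𝓝 (ξ, η), ∀ p ∈ U, ∀ E : ℝ, p.2 ^ 2 = E ^ 2 - W.V κ L p.1 → ∀ s₁ : ℝ,
      ∃ z : ℝ → ℝ, z s₁ = p.1 ∧ deriv z s₁ = W.sigmaP p.1 * p.2 ∧
        ∀ s ∈ Ioo (s₁ - δ) (s₁ + δ), W.RadialAt κ E L z s := by
  -- `α` is the local flow of the vector field
  obtain ⟨ε, hε, a, r, M, K, hr, hPL⟩ :=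
    IsPicardLindelof.of_contDiffAt_one (W.contDiffAt_field κ L (p := (ξ, η)) hξ)
  obtain ⟨α, hα, hαc⟩ :=
    (hPL 0).exists_forall_mem_closedBall_eq_hasDerivWithinAt_continuousOn
  simp only at hα hαc
  have hr' : (0 : ℝ) < r := hr
  have hmem : Metric.closedBall (ξ, η) r ×ˢ Icc (0 - ε) (0 + ε) ∈ 𝓝 ((ξ, η), (0 : ℝ)) :=
    prod_mem_nhds (Metric.closedBall_mem_nhds _ hr') (Icc_mem_nhds (by linarith) (by linarith))
  have hc := hαc.continuousAt hmem
  have h0 : α ((ξ, η), 0) = (ξ, η) := (hα _ (Metric.mem_closedBall_self hr'.le)).1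
  -- by continuity the flow stays in the regular region for a uniform time
  have hev : ∀ᶠ q in 𝓝 ((ξ, η), (0 : ℝ)), W.Reg (α q).1 :=
    hc.eventually (by
      rw [h0]
      exact continuousAt_fst.preimage_mem_nhds (W.isOpen_setOf_reg.mem_nhds hξ))
  rw [nhds_prod_eq] at hev
  obtain ⟨pU, hU, pT, hT, hUT⟩ := eventually_prod_iff.1 hev
  obtain ⟨δ', hδ', hδ⟩ := Metric.eventually_nhds_iff_ball.1 hT
  have hmin : 0 < min δ' ε := lt_min hδ' hε
  refine ⟨min δ' ε, hmin, {p | pU p} ∩ Metric.closedBall (ξ, η) r,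
    inter_mem hU (Metric.closedBall_mem_nhds _ hr'), ?_⟩
  rintro p ⟨hp1, hp2⟩ E hE s₁
  set b : ℝ → ℝ × ℝ := fun s => α (p, s - s₁) with hb
  have hreg : ∀ s ∈ Ioo (s₁ - min δ' ε) (s₁ + min δ' ε), W.Reg (b s).1 := by
    intro s hs
    refine hUT hp1 (hδ _ ?_)
    rw [Metric.mem_ball, Real.dist_0_eq_abs, abs_lt]
    have := min_le_left δ' ε
    constructor <;> linarith [hs.1, hs.2]
  have hbd : ∀ s ∈ Ioo (s₁ - min δ' ε) (s₁ + min δ' ε), HasDerivAt b (W.field κ L (b s)) s := by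
    intro s hs
    have := min_le_right δ' ε
    have h1 : s - s₁ ∈ Ioo (0 - ε) (0 + ε) := ⟨by linarith [hs.1], by linarith [hs.2]⟩
    have h2 := ((hα p hp2).2 (s - s₁) ⟨h1.1.le, h1.2.le⟩).hasDerivAt (Icc_mem_nhds h1.1 h1.2)
    exact h2.comp_sub_const s s₁
  have hx : ∀ s ∈ Ioo (s₁ - min δ' ε) (s₁ + min δ' ε),
      HasDerivAt (fun s => (b s).1) (W.sigmaP (b s).1 * (b s).2) s := fun s hs =>
    (hasFDerivAt_fst (𝕜 := ℝ) (p := b s)).comp_hasDerivAt s (hbd s hs)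
  have hy : ∀ s ∈ Ioo (s₁ - min δ' ε) (s₁ + min δ' ε),
      HasDerivAt (fun s => (b s).2) (-(W.sigmaP (b s).1 * deriv (W.V κ L) (b s).1) / 2) s :=
    fun s hs => (hasFDerivAt_snd (𝕜 := ℝ) (p := b s)).comp_hasDerivAt s (hbd s hs)
  have hs₁ : s₁ ∈ Ioo (s₁ - min δ' ε) (s₁ + min δ' ε) := ⟨by linarith, by linarith⟩
  have hb0 : b s₁ = p := by
    simp only [hb, sub_self]
    exact (hα p hp2).1
  -- the energy is conserved
  have hen : ∀ s ∈ Ioo (s₁ - min δ' ε) (s₁ + min δ' ε),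
      (b s).2 ^ 2 + W.V κ L (b s).1 = E ^ 2 := by
    have hd : ∀ s ∈ Ioo (s₁ - min δ' ε) (s₁ + min δ' ε),
        HasDerivAt (fun s => (b s).2 ^ 2 + W.V κ L (b s).1) 0 s := by
      intro s hs
      have h1 := ((hy s hs).fun_pow 2).fun_add
        ((W.analyticAt_V κ L (hreg s hs)).differentiableAt.hasDerivAt.comp s (hx s hs))
      refine h1.congr_deriv ?_
      push_cast
      ring
    intro s hs
    have := isOpen_Ioo.is_const_of_deriv_eq_zero isPreconnected_Ioo
      (fun s hs => (hd s hs).differentiableAt.differentiableWithinAt)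
      (fun s hs => (hd s hs).deriv) hs hs₁
    rw [this, hb0, hE]
    ring
  refine ⟨fun s => (b s).1, by simp [hb0], ?_, fun s hs => ?_⟩
  · rw [(hx s₁ hs₁).deriv, hb0]
  · refine RadialAt.of_hasDerivAt (y := fun s => (b s).2) (hreg s hs) ?_ (hy s hs) ?_
    · filter_upwards [isOpen_Ioo.mem_nhds hs] with u hu using hx u hu
    · linear_combination hen s hs

/-! ### Symmetries of the radial equation -/

lemma F_neg (W : Geon) (x : ℝ) : W.F (-x) = W.F x := by rw [F, F, A_neg, sigmaP_neg]

lemma V_neg (W : Geon) (κ L x : ℝ) : W.V κ L (-x) = W.V κ L x := by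
  rw [V, V, F_neg, radius_neg]

lemma deriv_V_neg (W : Geon) (κ L x : ℝ) : deriv (W.V κ L) (-x) = -deriv (W.V κ L) x := by
  have h : W.V κ L = fun u => W.V κ L (-u) := funext fun u => (W.V_neg κ L u).symm
  conv_rhs => rw [h]
  rw [deriv_comp_neg (W.V κ L) x, neg_neg]

lemma RadialAt.comp_add_const {W : Geon} {κ E L : ℝ} {x : ℝ → ℝ} {s d : ℝ}
    (h : W.RadialAt κ E L x (s + d)) : W.RadialAt κ E L (fun u => x (u + d)) s := by
  have hd : ∀ u, deriv (fun u => x (u + d)) u = deriv x (u + d) := fun u => deriv_comp_add_const x d u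
  refine ⟨h.reg, (h.diff.hasDerivAt.comp_add_const s d).differentiableAt, ?_, ?_⟩
  · simp only [hd]
    exact h.accel.comp_add_const s d
  · rw [hd]
    exact h.energy

lemma RadialAt.comp_neg {W : Geon} {κ E L : ℝ} {x : ℝ → ℝ} {s : ℝ}
    (h : W.RadialAt κ E L x (-s)) : W.RadialAt κ E L (fun u => x (-u)) s := by
  have hd : ∀ u, deriv (fun u => x (-u)) u = -deriv x (-u) := fun u => deriv_comp_neg x u
  refine ⟨h.reg, ?_, ?_, ?_⟩
  · exact (h.diff.hasDerivAt.comp s (hasDerivAt_neg s)).differentiableAt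
  · simp only [hd, neg_div]
    exact (h.accel.comp s (hasDerivAt_neg s)).fun_neg.congr_deriv (by ring)
  · rw [hd, neg_div, neg_sq]
    exact h.energy

lemma RadialAt.neg {W : Geon} {κ E L : ℝ} {x : ℝ → ℝ} {s : ℝ}
    (h : W.RadialAt κ E L x s) : W.RadialAt κ E L (fun u => -x u) s := by
  have hd : ∀ u, deriv (fun u => -x u) u = -deriv x u := fun u => deriv.fun_neg
  refine ⟨W.reg_neg.2 h.reg, h.diff.fun_neg, ?_, ?_⟩
  · simp only [hd, neg_div, sigmaP_neg, deriv_V_neg]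
    exact h.accel.fun_neg.congr_deriv (by ring)
  · rw [hd, neg_div, neg_sq, sigmaP_neg, V_neg]
    exact h.energy

/-! ### The potential near the throat and away from it -/

/-- The mean value inequality for `chargeMass`, whose derivative is at most `r_q² / r_c²`. -/
lemma abs_regA_le (W : Geon) (x : ℝ) : |W.regA x| ≤ 1 + W.rq ^ 2 / W.rc ^ 2 := by
  have hq : 0 < W.rq ^ 2 / W.rc ^ 2 := div_pos (pow_pos W.rq_pos 2) (pow_pos W.rc_pos 2)
  have hb : ∀ u : ℝ, ‖W.rq ^ 2 / W.radius u ^ 2‖ ≤ W.rq ^ 2 / W.rc ^ 2 := by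
    intro u
    have h1 := W.rc_pos
    have h2 := W.rc_le_radius u
    rw [Real.norm_of_nonneg (by positivity)]
    gcongr
  have h : |dslope W.chargeMass 0 x| ≤ W.rq ^ 2 / W.rc ^ 2 := by
    rcases eq_or_ne x 0 with rfl | hx
    · rw [dslope_same, (W.hasDerivAt_chargeMass 0).deriv]
      exact hb 0
    · rw [dslope_of_ne _ hx, slope_def_field, sub_zero, abs_div, div_le_iff₀ (abs_pos.2 hx)]
      have := convex_univ.norm_image_sub_le_of_norm_hasDerivWithin_le (f := W.chargeMass)
        (fun u _ => (W.hasDerivAt_chargeMass u).hasDerivWithinAt) (fun u _ => hb u)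
        (mem_univ 0) (mem_univ x)
      simpa using this
  rw [regA]
  calc |1 - dslope W.chargeMass 0 x| ≤ |1| + |dslope W.chargeMass 0 x| := abs_sub _ _
    _ ≤ _ := by rw [abs_one]; linarith

lemma abs_massTerm_le (W : Geon) (κ L x : ℝ) :
    |W.massTerm κ L x| ≤ |κ| + L ^ 2 / W.rc ^ 2 := by
  have h1 := W.rc_pos
  have h2 := W.rc_le_radius x
  refine (abs_add_le _ _).trans (add_le_add le_rfl ?_)
  rw [abs_of_nonneg (by positivity)]
  gcongr

/-- At a distance from a singular throat the potential is bounded, and everywhere if the throat is regular. -/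
lemma exists_abs_V_le (W : Geon) (κ L : ℝ) {ρ : ℝ} (hρ : 0 < ρ) :
    ∃ C, 0 ≤ C ∧ ∀ x, ρ ≤ |x| ∨ W.throatMass = 0 → |W.V κ L x| ≤ C := by
  have hc := W.rc_pos
  refine ⟨(1 + W.rq ^ 2 / W.rc ^ 2 + |W.throatMass| / ρ) * (|κ| + L ^ 2 / W.rc ^ 2), by positivity,
    fun x hx => ?_⟩
  have hA : |W.A x| ≤ 1 + W.rq ^ 2 / W.rc ^ 2 + |W.throatMass| / ρ := by
    rw [A_eq]
    refine (abs_sub _ _).trans (add_le_add (W.abs_regA_le x) ?_)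
    rw [abs_div, abs_abs]
    rcases hx with hx | hx
    · gcongr
    · simp [hx]
  have hF : |W.F x| ≤ |W.A x| := by
    rw [F, abs_div, abs_of_pos (W.sigmaP_pos x)]
    exact div_le_self (abs_nonneg _) (W.one_le_sigmaP x)
  rw [V_eq, abs_mul]
  exact mul_le_mul (hF.trans hA) (W.abs_massTerm_le κ L x) (abs_nonneg _) (by positivity)

lemma V_eq_A_mul (W : Geon) (κ L x : ℝ) :
    W.V κ L x = W.A x * (W.massTerm κ L x / W.sigmaP x) := by
  rw [V_eq, F]
  ring

lemma tendsto_massTerm_div_sigmaP (W : Geon) (κ L : ℝ) :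
    Tendsto (fun x => W.massTerm κ L x / W.sigmaP x) (𝓝[≠] 0)
      (𝓝 (W.massTerm κ L 0 / W.sigmaP 0)) :=
  (((W.analyticAt_massTerm κ L 0).continuousAt.div W.continuous_sigmaP.continuousAt
    (W.sigmaP_pos 0).ne').tendsto).mono_left nhdsWithin_le_nhds

lemma tendsto_abs_inv : Tendsto (fun x : ℝ => |x|⁻¹) (𝓝[≠] 0) atTop :=
  tendsto_abs_nhdsNE_zero.inv_tendsto_nhdsGT_zero

lemma tendsto_regA (W : Geon) : Tendsto W.regA (𝓝[≠] 0) (𝓝 (W.regA 0)) :=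
  (W.analyticAt_regA 0).continuousAt.tendsto.mono_left nhdsWithin_le_nhds

lemma tendsto_A_atTop {W : Geon} (hm : W.throatMass < 0) : Tendsto W.A (𝓝[≠] 0) atTop := by
  have h : W.A = fun x => W.regA x + -W.throatMass * |x|⁻¹ := by
    funext x
    rw [A_eq]
    ring
  rw [h]
  exact W.tendsto_regA.add_atTop (tendsto_abs_inv.const_mul_atTop (neg_pos.2 hm))

lemma tendsto_A_atBot {W : Geon} (hm : 0 < W.throatMass) : Tendsto W.A (𝓝[≠] 0) atBot := by
  have h : W.A = fun x => W.regA x + -W.throatMass * |x|⁻¹ := by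
    funext x
    rw [A_eq]
    ring
  rw [h]
  exact W.tendsto_regA.add_atBot (tendsto_abs_inv.const_mul_atTop_of_neg (neg_neg_of_pos hm))

lemma tendsto_V_atTop {W : Geon} (hm : W.throatMass < 0) {κ L : ℝ} (hκ : κ = 0 ∨ κ = 1)
    (hne : κ = 1 ∨ L ≠ 0) : Tendsto (W.V κ L) (𝓝[≠] 0) atTop := by
  rw [show W.V κ L = fun x => W.A x * (W.massTerm κ L x / W.sigmaP x) from
    funext fun x => W.V_eq_A_mul κ L x]
  exact (tendsto_A_atTop hm).atTop_mul_pos (div_pos (W.massTerm_pos hκ hne 0) (W.sigmaP_pos 0))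
    (W.tendsto_massTerm_div_sigmaP κ L)

lemma tendsto_V_atBot {W : Geon} (hm : 0 < W.throatMass) {κ L : ℝ} (hκ : κ = 0 ∨ κ = 1)
    (hne : κ = 1 ∨ L ≠ 0) : Tendsto (W.V κ L) (𝓝[≠] 0) atBot := by
  rw [show W.V κ L = fun x => W.A x * (W.massTerm κ L x / W.sigmaP x) from
    funext fun x => W.V_eq_A_mul κ L x]
  exact (tendsto_A_atBot hm).atBot_mul_pos (div_pos (W.massTerm_pos hκ hne 0) (W.sigmaP_pos 0))
    (W.tendsto_massTerm_div_sigmaP κ L)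

lemma V_zero_zero (W : Geon) (x : ℝ) : W.V 0 0 x = 0 := by simp [V]

/-- Close to a singular throat a motion cannot be slow: either the potential diverges to `-∞`, or it
diverges to `+∞` and the throat is out of reach, or the motion is null and radial. -/
lemma exists_speed_bound {W : Geon} (hm : W.throatMass ≠ 0) {κ E L : ℝ} (hκ : κ = 0 ∨ κ = 1)
    (hne : κ = 1 ∨ L ≠ 0 ∨ E ≠ 0) : ∃ δ > 0, ∃ c > 0, ∀ x, x ≠ 0 → |x| < δ →
      0 ≤ E ^ 2 - W.V κ L x → c ≤ E ^ 2 - W.V κ L x := by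
  by_cases h : κ = 1 ∨ L ≠ 0
  · have hev : ∃ c > 0, ∀ᶠ x in 𝓝[≠] 0, 0 ≤ E ^ 2 - W.V κ L x → c ≤ E ^ 2 - W.V κ L x := by
      refine ⟨1, one_pos, ?_⟩
      rcases hm.lt_or_gt with hm | hm
      · filter_upwards [(tendsto_V_atTop hm hκ h).eventually_gt_atTop (E ^ 2)] with x hx h0
        linarith
      · filter_upwards [(tendsto_V_atBot hm hκ h).eventually_le_atBot (E ^ 2 - 1)] with x hx h0
        linarith
    obtain ⟨c, hc, hev⟩ := hev
    obtain ⟨δ, hδ, hb⟩ := Metric.eventually_nhds_iff_ball.1 (eventually_nhdsWithin_iff.1 hev)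
    exact ⟨δ, hδ, c, hc, fun x hx hxδ => hb x (by simpa using hxδ) hx⟩
  · push Not at h
    obtain ⟨h1, rfl⟩ := h
    have hκ0 : κ = 0 := hκ.resolve_right h1
    subst hκ0
    have hE : E ≠ 0 := by tauto
    refine ⟨1, one_pos, E ^ 2, by positivity, fun x _ _ _ => ?_⟩
    rw [V_zero_zero, sub_zero]

/-! ### Motions through the throat -/

/-- The curve `x` crosses a singular throat at the parameter `s₀`: it is continuous, it satisfies the
radial equation just before and just after `s₀`, and it is strictly monotone there. -/
structure ThroatAt (W : Geon) (κ E L : ℝ) (x : ℝ → ℝ) (s₀ : ℝ) : Prop where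
  zero : x s₀ = 0
  singular : ¬W.Reg 0
  cont : ContinuousAt x s₀
  exists_nhds : ∃ ε > 0, (∀ s ∈ Ioo (s₀ - ε) (s₀ + ε), s ≠ s₀ → W.RadialAt κ E L x s) ∧
    (StrictMonoOn x (Ioo (s₀ - ε) (s₀ + ε)) ∨ StrictAntiOn x (Ioo (s₀ - ε) (s₀ + ε)))

/-- At the parameter `s` the curve `x` satisfies the radial equation or crosses a singular throat. -/
def MotionAt (W : Geon) (κ E L : ℝ) (x : ℝ → ℝ) (s : ℝ) : Prop :=
  W.RadialAt κ E L x s ∨ W.ThroatAt κ E L x s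

variable {W : Geon} {κ E L : ℝ}

lemma MotionAt.continuousAt {x : ℝ → ℝ} {s : ℝ} (h : W.MotionAt κ E L x s) : ContinuousAt x s :=
  h.elim (fun h => h.diff.continuousAt) (fun h => h.cont)

lemma MotionAt.radialAt {x : ℝ → ℝ} {s : ℝ} (h : W.MotionAt κ E L x s) (hr : W.Reg (x s)) :
    W.RadialAt κ E L x s :=
  h.resolve_right fun h' => h'.singular (h'.zero ▸ hr)

lemma MotionAt.throatAt {x : ℝ → ℝ} {s : ℝ} (h : W.MotionAt κ E L x s) (hr : ¬W.Reg (x s)) :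
    W.ThroatAt κ E L x s :=
  h.resolve_left fun h' => hr h'.reg

lemma ThroatAt.congr {x x₁ : ℝ → ℝ} {s : ℝ} (h : W.ThroatAt κ E L x s) (hx : x₁ =ᶠ[𝓝 s] x) :
    W.ThroatAt κ E L x₁ s := by
  obtain ⟨ε, hε, h1, h2⟩ := h.exists_nhds
  obtain ⟨ε', hε', h3⟩ := Metric.eventually_nhds_iff_ball.1 hx.eventuallyEq_nhds
  simp only [Real.ball_eq_Ioo] at h3
  have hs1 : Ioo (s - min ε ε') (s + min ε ε') ⊆ Ioo (s - ε) (s + ε) :=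
    Ioo_subset_Ioo (by linarith [min_le_left ε ε']) (by linarith [min_le_left ε ε'])
  have hs2 : Ioo (s - min ε ε') (s + min ε ε') ⊆ Ioo (s - ε') (s + ε') :=
    Ioo_subset_Ioo (by linarith [min_le_right ε ε']) (by linarith [min_le_right ε ε'])
  have heq : EqOn x x₁ (Ioo (s - min ε ε') (s + min ε ε')) :=
    fun u hu => (h3 u (hs2 hu)).eq_of_nhds.symm
  exact ⟨hx.eq_of_nhds.trans h.zero, h.singular, h.cont.congr hx.symm, min ε ε', lt_min hε hε',
    fun u hu hne => (h1 u (hs1 hu) hne).congr (h3 u (hs2 hu)),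
    h2.imp (fun h => (h.mono hs1).congr heq) (fun h => (h.mono hs1).congr heq)⟩

lemma MotionAt.congr {x x₁ : ℝ → ℝ} {s : ℝ} (h : W.MotionAt κ E L x s) (hx : x₁ =ᶠ[𝓝 s] x) :
    W.MotionAt κ E L x₁ s :=
  h.imp (fun h => h.congr hx) (fun h => h.congr hx)

lemma MotionAt.comp_neg {x : ℝ → ℝ} {s : ℝ} (h : W.MotionAt κ E L x (-s)) :
    W.MotionAt κ E L (fun u => x (-u)) s := by
  refine h.imp (fun h => h.comp_neg) fun h => ?_
  obtain ⟨ε, hε, h1, h2⟩ := h.exists_nhds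
  have hmaps : ∀ u ∈ Ioo (s - ε) (s + ε), -u ∈ Ioo (-s - ε) (-s + ε) :=
    fun u hu => ⟨by linarith [hu.2], by linarith [hu.1]⟩
  refine ⟨h.zero, h.singular, h.cont.comp (f := fun u => -u) continuous_neg.continuousAt, ε, hε,
    fun u hu hne => (h1 _ (hmaps u hu) (by simpa using hne)).comp_neg, ?_⟩
  refine h2.symm.imp (fun h => ?_) (fun h => ?_)
  · exact fun u hu v hv huv => h (hmaps v hv) (hmaps u hu) (neg_lt_neg huv)
  · exact fun u hu v hv huv => h (hmaps v hv) (hmaps u hu) (neg_lt_neg huv)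

/-! ### Uniqueness of the motion -/

lemma RadialAt.eventuallyEq_of_mem {J : Set ℝ} (hJ : IsOpen J) (hJc : IsPreconnected J)
    {x₁ x₂ : ℝ → ℝ} (h₁ : ∀ s ∈ J, W.RadialAt κ E L x₁ s) (h₂ : ∀ s ∈ J, W.RadialAt κ E L x₂ s)
    {s₀ : ℝ} (hs₀ : s₀ ∈ J) (hx : x₁ s₀ = x₂ s₀) (hd : deriv x₁ s₀ = deriv x₂ s₀) :
    ∀ s ∈ J, x₁ =ᶠ[𝓝 s] x₂ := by
  have ev₁ : ∀ s ∈ J, ∀ᶠ u in 𝓝 s, W.RadialAt κ E L x₁ u := fun s hs => by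
    filter_upwards [hJ.mem_nhds hs] with u hu using h₁ u hu
  have ev₂ : ∀ s ∈ J, ∀ᶠ u in 𝓝 s, W.RadialAt κ E L x₂ u := fun s hs => by
    filter_upwards [hJ.mem_nhds hs] with u hu using h₂ u hu
  refine eqOn_of_eventuallyEq_of_frequently hJc hs₀
    (RadialAt.eventuallyEq (ev₁ s₀ hs₀) (ev₂ s₀ hs₀) hx hd) fun s hs hfr => ?_
  have h := (h₁ s hs).hasDerivAt.continuousAt.eq_of_frequently_eq
    (h₂ s hs).hasDerivAt.continuousAt (hfr.mono fun u hu => by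
      simp only [hu.eq_of_nhds, hu.deriv_eq])
  simp only [Prod.mk.injEq] at h
  refine RadialAt.eventuallyEq (ev₁ s hs) (ev₂ s hs) h.1 ?_
  have h2 := h.2
  rw [h.1] at h2
  exact (div_left_inj' (W.sigmaP_pos _).ne').1 h2

lemma deriv_nonneg_of_strictMonoOn {x : ℝ → ℝ} {J : Set ℝ} {s : ℝ} (h : StrictMonoOn x J)
    (hs : J ∈ 𝓝 s) : 0 ≤ deriv x s := by
  rw [← derivWithin_of_mem_nhds hs]
  exact h.monotoneOn.derivWithin_nonneg

/-- A motion that leaves the throat to the side `x > 0` is unique: two such motions agree up to a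
translation of the parameter, by uniqueness where they reach the same value of `x`, and the translation
vanishes since both are at the throat at `s₀`. -/
lemma eqOn_of_strictMonoOn_right {s₀ ε : ℝ} (hε : 0 < ε) {x₁ x₂ : ℝ → ℝ}
    (h₁ : ∀ s ∈ Ioo s₀ (s₀ + ε), W.RadialAt κ E L x₁ s)
    (h₂ : ∀ s ∈ Ioo s₀ (s₀ + ε), W.RadialAt κ E L x₂ s)
    (m₁ : StrictMonoOn x₁ (Ico s₀ (s₀ + ε))) (m₂ : StrictMonoOn x₂ (Ico s₀ (s₀ + ε)))
    (z₁ : x₁ s₀ = 0) (z₂ : x₂ s₀ = 0) (c₁ : ContinuousAt x₁ s₀) (c₂ : ContinuousAt x₂ s₀) :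
    EqOn x₁ x₂ (Ioo s₀ (s₀ + ε)) := by
  have cont : ∀ x : ℝ → ℝ, (∀ s ∈ Ioo s₀ (s₀ + ε), W.RadialAt κ E L x s) → ContinuousAt x s₀ →
      ∀ s ∈ Ico s₀ (s₀ + ε), ContinuousAt x s := by
    intro x h c s hs
    rcases hs.1.eq_or_lt with rfl | h'
    · exact c
    · exact (h s ⟨h', hs.2⟩).diff.continuousAt
  have hm : s₀ + ε / 2 ∈ Ico s₀ (s₀ + ε) := ⟨by linarith, by linarith⟩
  have h0 : s₀ ∈ Ico s₀ (s₀ + ε) := ⟨le_rfl, by linarith⟩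
  have hsub : Icc s₀ (s₀ + ε / 2) ⊆ Ico s₀ (s₀ + ε) := fun s hs => ⟨hs.1, by linarith [hs.2]⟩
  -- both curves take the value `v`, at parameters `a` and `b`, by the intermediate value theorem
  set v := min (x₁ (s₀ + ε / 2)) (x₂ (s₀ + ε / 2)) with hv
  have hv0 : 0 < v := lt_min (z₁ ▸ m₁ h0 hm (by linarith)) (z₂ ▸ m₂ h0 hm (by linarith))
  have ivt : ∀ x : ℝ → ℝ, (∀ s ∈ Ico s₀ (s₀ + ε), ContinuousAt x s) → x s₀ = 0 →
      v ≤ x (s₀ + ε / 2) → ∃ s ∈ Ioo s₀ (s₀ + ε), x s = v := by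
    intro x hc hz hvx
    obtain ⟨s, hs, hxs⟩ := intermediate_value_Icc (by linarith : s₀ ≤ s₀ + ε / 2)
      (fun s hs => (hc s (hsub hs)).continuousWithinAt) ⟨hz.trans_le hv0.le, hvx⟩
    refine ⟨s, ⟨lt_of_le_of_ne hs.1 ?_, (hsub hs).2⟩, hxs⟩
    rintro rfl
    exact hv0.ne' (hxs.symm.trans hz)
  obtain ⟨a, ha, hxa⟩ := ivt x₁ (cont x₁ h₁ c₁) z₁ (min_le_left _ _)
  obtain ⟨b, hb, hxb⟩ := ivt x₂ (cont x₂ h₂ c₂) z₂ (min_le_right _ _)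
  clear_value v
  clear hv
  wlog hab : a ≤ b generalizing x₁ x₂ a b
  · exact (this h₂ h₁ m₂ m₁ z₂ z₁ c₂ c₁ b hb hxb a ha hxa (le_of_not_ge hab)).symm
  have d₁ := deriv_nonneg_of_strictMonoOn m₁ (mem_of_superset (isOpen_Ioo.mem_nhds ha) Ioo_subset_Ico_self)
  have d₂ := deriv_nonneg_of_strictMonoOn m₂ (mem_of_superset (isOpen_Ioo.mem_nhds hb) Ioo_subset_Ico_self)
  -- equal values of `x` give equal squares of the velocities, and these are non-negative
  have hd : deriv x₁ a = deriv x₂ b := by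
    have e₁ := (h₁ a ha).energy
    have e₂ := (h₂ b hb).energy
    rw [hxa] at e₁
    rw [hxb, ← e₁] at e₂
    have hσ := W.sigmaP_pos v
    rw [sq_eq_sq₀ (by positivity) (by positivity)] at e₂
    exact ((div_left_inj' hσ.ne').1 e₂).symm
  have key : ∀ s ∈ Ioo s₀ (s₀ + ε - (b - a)), x₁ s = x₂ (s + (b - a)) := by
    have hJ : ∀ s ∈ Ioo s₀ (s₀ + ε - (b - a)), x₁ =ᶠ[𝓝 s] fun s => x₂ (s + (b - a)) := by
      refine RadialAt.eventuallyEq_of_mem isOpen_Ioo isPreconnected_Ioo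
        (fun s hs => h₁ s ⟨hs.1, by linarith [hs.2]⟩)
        (fun s hs => (h₂ _ ⟨by linarith [hs.1], by linarith [hs.2]⟩).comp_add_const)
        (s₀ := a) ⟨ha.1, by linarith [hb.2]⟩ ?_ ?_
      · rw [hxa, add_sub_cancel, hxb]
      · rw [deriv_comp_add_const, add_sub_cancel, hd]
    exact fun s hs => (hJ s hs).eq_of_nhds
  have hb0 : s₀ + (b - a) ∈ Ico s₀ (s₀ + ε) := ⟨by linarith, by linarith [hb.2, ha.1]⟩
  -- in the limit at `s₀`, the curve `x₂` vanishes at `s₀ + (b - a)`, so that `b = a`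
  have hlim : x₁ s₀ = x₂ (s₀ + (b - a)) := by
    refine c₁.eq_of_frequently_eq (g := fun s => x₂ (s + (b - a)))
      (ContinuousAt.comp (f := fun s => s + (b - a)) (cont x₂ h₂ c₂ _ hb0)
        (continuous_id.add continuous_const).continuousAt) ?_
    have hfr : ∃ᶠ s in 𝓝[>] s₀, x₁ s = x₂ (s + (b - a)) := by
      refine Eventually.frequently ?_
      filter_upwards [Ioo_mem_nhdsGT (by linarith [hb.2, ha.1] : s₀ < s₀ + ε - (b - a))] with s hs
        using key s hs
    exact hfr.filter_mono nhdsWithin_le_nhds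
  rw [z₁, ← z₂] at hlim
  have h3 := m₂.injOn h0 hb0 hlim
  have h4 : b - a = 0 := by linarith
  rw [h4, sub_zero] at key
  intro s hs
  simpa using key s hs

/-- Crossings of a singular throat in the direction of increasing `x`, at the same parameter and with the same
constants of the motion, coincide. -/
lemma eqOn_of_strictMonoOn {s₀ ε : ℝ} (hε : 0 < ε) {x₁ x₂ : ℝ → ℝ}
    (h₁ : ∀ s ∈ Ioo (s₀ - ε) (s₀ + ε), s ≠ s₀ → W.RadialAt κ E L x₁ s)
    (h₂ : ∀ s ∈ Ioo (s₀ - ε) (s₀ + ε), s ≠ s₀ → W.RadialAt κ E L x₂ s)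
    (m₁ : StrictMonoOn x₁ (Ioo (s₀ - ε) (s₀ + ε))) (m₂ : StrictMonoOn x₂ (Ioo (s₀ - ε) (s₀ + ε)))
    (z₁ : x₁ s₀ = 0) (z₂ : x₂ s₀ = 0) (c₁ : ContinuousAt x₁ s₀) (c₂ : ContinuousAt x₂ s₀) :
    EqOn x₁ x₂ (Ioo (s₀ - ε) (s₀ + ε)) := by
  have hR : EqOn x₁ x₂ (Ioo s₀ (s₀ + ε)) := by
    have hs : Ioo s₀ (s₀ + ε) ⊆ Ioo (s₀ - ε) (s₀ + ε) := Ioo_subset_Ioo_left (by linarith)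
    have hs' : Ico s₀ (s₀ + ε) ⊆ Ioo (s₀ - ε) (s₀ + ε) := fun s hs => ⟨by linarith [hs.1], hs.2⟩
    exact eqOn_of_strictMonoOn_right hε (fun s h => h₁ s (hs h) h.1.ne')
      (fun s h => h₂ s (hs h) h.1.ne') (m₁.mono hs') (m₂.mono hs') z₁ z₂ c₁ c₂
  -- the left half is carried to the right half by the point reflection
  have hL : EqOn (fun s => -x₁ (-s)) (fun s => -x₂ (-s)) (Ioo (-s₀) (-s₀ + ε)) := by
    have hs : ∀ s ∈ Ico (-s₀) (-s₀ + ε), -s ∈ Ioo (s₀ - ε) (s₀ + ε) :=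
      fun s hs => ⟨by linarith [hs.2], by linarith [hs.1]⟩
    have hneg : ∀ x : ℝ → ℝ, ContinuousAt x s₀ → ContinuousAt (fun s => -x (-s)) (-s₀) := by
      intro x hx
      refine (ContinuousAt.comp (f := fun s : ℝ => -s) ?_ continuous_neg.continuousAt).neg
      rwa [neg_neg]
    refine eqOn_of_strictMonoOn_right hε
      (fun s h => (h₁ (-s) (hs s ⟨h.1.le, h.2⟩) (by linarith [h.1])).comp_neg.neg)
      (fun s h => (h₂ (-s) (hs s ⟨h.1.le, h.2⟩) (by linarith [h.1])).comp_neg.neg)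
      (fun u hu v hv huv => neg_lt_neg (m₁ (hs v hv) (hs u hu) (neg_lt_neg huv)))
      (fun u hu v hv huv => neg_lt_neg (m₂ (hs v hv) (hs u hu) (neg_lt_neg huv)))
      (by simp [z₁]) (by simp [z₂]) (hneg x₁ c₁) (hneg x₂ c₂)
  intro s hs
  rcases lt_trichotomy s s₀ with h | rfl | h
  · have := hL (x := -s) ⟨by linarith, by linarith [hs.1]⟩
    simpa using this
  · rw [z₁, z₂]
  · exact hR ⟨h, hs.2⟩

lemma eqOn_of_strictAntiOn {s₀ ε : ℝ} (hε : 0 < ε) {x₁ x₂ : ℝ → ℝ}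
    (h₁ : ∀ s ∈ Ioo (s₀ - ε) (s₀ + ε), s ≠ s₀ → W.RadialAt κ E L x₁ s)
    (h₂ : ∀ s ∈ Ioo (s₀ - ε) (s₀ + ε), s ≠ s₀ → W.RadialAt κ E L x₂ s)
    (m₁ : StrictAntiOn x₁ (Ioo (s₀ - ε) (s₀ + ε))) (m₂ : StrictAntiOn x₂ (Ioo (s₀ - ε) (s₀ + ε)))
    (z₁ : x₁ s₀ = 0) (z₂ : x₂ s₀ = 0) (c₁ : ContinuousAt x₁ s₀) (c₂ : ContinuousAt x₂ s₀) :
    EqOn x₁ x₂ (Ioo (s₀ - ε) (s₀ + ε)) := by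
  have h := eqOn_of_strictMonoOn hε (fun s hs hne => (h₁ s hs hne).neg)
    (fun s hs hne => (h₂ s hs hne).neg) m₁.neg m₂.neg (by simp [z₁]) (by simp [z₂]) c₁.neg c₂.neg
  exact fun s hs => neg_injective (h hs)

lemma ThroatAt.eventuallyEq {x₁ x₂ : ℝ → ℝ} {s : ℝ} (h₁ : W.ThroatAt κ E L x₁ s)
    (h₂ : W.ThroatAt κ E L x₂ s) (hfr : ∃ᶠ u in 𝓝 s, x₁ =ᶠ[𝓝 u] x₂) : x₁ =ᶠ[𝓝 s] x₂ := by
  obtain ⟨ε₁, hε₁, r₁, m₁⟩ := h₁.exists_nhds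
  obtain ⟨ε₂, hε₂, r₂, m₂⟩ := h₂.exists_nhds
  set ε := min ε₁ ε₂
  have hε : 0 < ε := lt_min hε₁ hε₂
  have hs1 : Ioo (s - ε) (s + ε) ⊆ Ioo (s - ε₁) (s + ε₁) :=
    Ioo_subset_Ioo (by linarith [min_le_left ε₁ ε₂]) (by linarith [min_le_left ε₁ ε₂])
  have hs2 : Ioo (s - ε) (s + ε) ⊆ Ioo (s - ε₂) (s + ε₂) :=
    Ioo_subset_Ioo (by linarith [min_le_right ε₁ ε₂]) (by linarith [min_le_right ε₁ ε₂])
  have hmem : Ioo (s - ε) (s + ε) ∈ 𝓝 s := Ioo_mem_nhds (by linarith) (by linarith)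
  -- the curves agree near some `u`, hence cross in the same direction
  obtain ⟨u, hu, huI⟩ := (hfr.and_eventually hmem).exists
  obtain ⟨v, ⟨hv1, hv2⟩, hvu⟩ : ∃ v, (x₁ v = x₂ v ∧ v ∈ Ioo (s - ε) (s + ε)) ∧ u < v :=
    (((hu.and (isOpen_Ioo.mem_nhds huI)).filter_mono
      (nhdsWithin_le_nhds (s := Ioi u))).and self_mem_nhdsWithin).exists
  have hu1 := hu.eq_of_nhds
  refine mem_of_superset hmem ?_
  rcases m₁ with m₁ | m₁ <;> rcases m₂ with m₂ | m₂
  · exact eqOn_of_strictMonoOn hε (fun s h => r₁ s (hs1 h)) (fun s h => r₂ s (hs2 h)) (m₁.mono hs1)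
      (m₂.mono hs2) h₁.zero h₂.zero h₁.cont h₂.cont
  · have e1 := m₁ (hs1 huI) (hs1 hv2) hvu
    have e2 := m₂ (hs2 huI) (hs2 hv2) hvu
    linarith
  · have e1 := m₁ (hs1 huI) (hs1 hv2) hvu
    have e2 := m₂ (hs2 huI) (hs2 hv2) hvu
    linarith
  · exact eqOn_of_strictAntiOn hε (fun s h => r₁ s (hs1 h)) (fun s h => r₂ s (hs2 h)) (m₁.mono hs1)
      (m₂.mono hs2) h₁.zero h₂.zero h₁.cont h₂.cont

/-- Motions with the same constants that agree near one parameter agree everywhere. -/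
lemma MotionAt.eventuallyEq_of_mem {J : Set ℝ} (hJ : IsOpen J) (hJc : IsPreconnected J)
    {x₁ x₂ : ℝ → ℝ} (h₁ : ∀ s ∈ J, W.MotionAt κ E L x₁ s) (h₂ : ∀ s ∈ J, W.MotionAt κ E L x₂ s)
    {s₀ : ℝ} (hs₀ : s₀ ∈ J) (h₀ : x₁ =ᶠ[𝓝 s₀] x₂) : ∀ s ∈ J, x₁ =ᶠ[𝓝 s] x₂ := by
  refine eqOn_of_eventuallyEq_of_frequently hJc hs₀ h₀ fun s hs hfr => ?_
  have hx : x₁ s = x₂ s := (h₁ s hs).continuousAt.eq_of_frequently_eq (h₂ s hs).continuousAt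
    (hfr.mono fun u hu => hu.eq_of_nhds)
  by_cases hr : W.Reg (x₁ s)
  · have hr₂ : W.Reg (x₂ s) := hx ▸ hr
    have ev : ∀ x : ℝ → ℝ, (∀ s ∈ J, W.MotionAt κ E L x s) → W.Reg (x s) →
        ∀ᶠ u in 𝓝 s, W.RadialAt κ E L x u := by
      intro x h hr
      filter_upwards [hJ.mem_nhds hs,
        (h s hs).continuousAt.preimage_mem_nhds (W.isOpen_setOf_reg.mem_nhds hr)] with u hu hur
        using (h u hu).radialAt hur
    refine RadialAt.eventuallyEq (ev x₁ h₁ hr) (ev x₂ h₂ hr₂) hx ?_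
    have h := ((h₁ s hs).radialAt hr).hasDerivAt.continuousAt.eq_of_frequently_eq
      ((h₂ s hs).radialAt hr₂).hasDerivAt.continuousAt (hfr.mono fun u hu => by
        simp only [hu.eq_of_nhds, hu.deriv_eq])
    simp only [Prod.mk.injEq] at h
    have h2 := h.2
    rw [hx] at h2
    exact (div_left_inj' (W.sigmaP_pos _).ne').1 h2
  · exact ((h₁ s hs).throatAt hr).eventuallyEq ((h₂ s hs).throatAt (hx ▸ hr)) hfr

/-! ### Extension of the motion to all parameters -/

lemma MotionAt.neg {x : ℝ → ℝ} {s : ℝ} (h : W.MotionAt κ E L x s) :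
    W.MotionAt κ E L (fun u => -x u) s := by
  refine h.imp (fun h => h.neg) fun h => ?_
  obtain ⟨ε, hε, h1, h2⟩ := h.exists_nhds
  exact ⟨by simp [h.zero], h.singular, h.cont.neg, ε, hε, fun u hu hne => (h1 u hu hne).neg,
    h2.symm.imp (fun h => h.neg) (fun h => h.neg)⟩

lemma ThroatAt.not_isLocalExtr {x : ℝ → ℝ} {s : ℝ} (h : W.ThroatAt κ E L x s) :
    ¬IsLocalExtr x s := by
  obtain ⟨ε, hε, -, h2⟩ := h.exists_nhds
  have hmem : Ioo (s - ε) (s + ε) ∈ 𝓝 s := Ioo_mem_nhds (by linarith) (by linarith)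
  have hs : s ∈ Ioo (s - ε) (s + ε) := mem_of_mem_nhds hmem
  have hR : ∀ p : ℝ → Prop, (∀ᶠ u in 𝓝 s, p u) → ∃ u, (p u ∧ u ∈ Ioo (s - ε) (s + ε)) ∧ s < u :=
    fun p hp => (((hp.and hmem).filter_mono (nhdsWithin_le_nhds (s := Ioi s))).and
      self_mem_nhdsWithin).exists
  have hL : ∀ p : ℝ → Prop, (∀ᶠ u in 𝓝 s, p u) → ∃ u, (p u ∧ u ∈ Ioo (s - ε) (s + ε)) ∧ u < s :=
    fun p hp => (((hp.and hmem).filter_mono (nhdsWithin_le_nhds (s := Iio s))).and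
      self_mem_nhdsWithin).exists
  rintro (h | h)
  · rcases h2 with m | m
    · obtain ⟨u, ⟨h1, h2⟩, h3⟩ := hL _ h
      exact absurd (m h2 hs h3) (not_lt.2 h1)
    · obtain ⟨u, ⟨h1, h2⟩, h3⟩ := hR _ h
      exact absurd (m hs h2 h3) (not_lt.2 h1)
  · rcases h2 with m | m
    · obtain ⟨u, ⟨h1, h2⟩, h3⟩ := hR _ h
      exact absurd (m hs h2 h3) (not_lt.2 h1)
    · obtain ⟨u, ⟨h1, h2⟩, h3⟩ := hL _ h
      exact absurd (m h2 hs h3) (not_lt.2 h1)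

/-- A motion without turning points is strictly monotone. -/
lemma MotionAt.strictMonoOn_or_strictAntiOn {x : ℝ → ℝ} {a b : ℝ} (hab : a < b)
    (h : ∀ s ∈ Ioo a b, W.MotionAt κ E L x s)
    (hd : ∀ s ∈ Ioo a b, W.Reg (x s) → deriv x s ≠ 0) :
    StrictMonoOn x (Ioo a b) ∨ StrictAntiOn x (Ioo a b) := by
  have hc : ContinuousOn x (Ioo a b) := fun s hs => (h s hs).continuousAt.continuousWithinAt
  -- an injective continuous function is monotone; equal values would produce a local extremum in between
  refine hc.strictMonoOn_of_injOn_Ioo hab ?_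
  have key : ∀ u ∈ Ioo a b, ∀ v ∈ Ioo a b, u < v → x u ≠ x v := by
    intro u hu v hv huv heq
    have hsub : Icc u v ⊆ Ioo a b := ordConnected_Ioo.out hu hv
    obtain ⟨c, hcm, hce⟩ := exists_isLocalExtr_Ioo huv (hc.mono hsub) heq
    have hcI := hsub (Ioo_subset_Icc_self hcm)
    by_cases hr : W.Reg (x c)
    · exact hd c hcI hr hce.deriv_eq_zero
    · exact ((h c hcI).throatAt hr).not_isLocalExtr hce
  intro u hu v hv heq
  rcases lt_trichotomy u v with h | h | h
  · exact absurd heq (key u hu v hv h)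
  · exact h
  · exact absurd heq.symm (key v hv u hu h)

/-- A motion that reaches a singular throat monotonically continues by the point reflection at the
throat, a symmetry of the radial equation. -/
lemma exists_reflection {x : ℝ → ℝ} {T ε : ℝ} (hε : 0 < ε)
    (h : ∀ s ∈ Ioo (T - ε) T, W.RadialAt κ E L x s)
    (m : StrictMonoOn x (Ioo (T - ε) T)) (lim : Tendsto x (𝓝[<] T) (𝓝 0)) :
    ∃ x₁ : ℝ → ℝ, EqOn x₁ x (Iio T) ∧ x₁ T = 0 ∧ ContinuousAt x₁ T ∧
      (∀ s, T < s → x₁ s = -x (2 * T - s)) ∧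
      (∀ s ∈ Ioo (T - ε) (T + ε), s ≠ T → W.RadialAt κ E L x₁ s) ∧
      StrictMonoOn x₁ (Ioo (T - ε) (T + ε)) := by
  set x₁ : ℝ → ℝ := fun s => if s < T then x s else if s = T then 0 else -x (2 * T - s) with hx₁
  have eL : ∀ s, s < T → x₁ s = x s := fun s hs => by simp [hx₁, hs]
  have eT : x₁ T = 0 := by simp [hx₁]
  have eR : ∀ s, T < s → x₁ s = -x (2 * T - s) := fun s hs => by
    simp [hx₁, hs.not_gt, hs.ne']
  have hneg : ∀ s ∈ Ioo (T - ε) T, x s < 0 := by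
    intro s hs
    have hu : (s + T) / 2 ∈ Ioo (T - ε) T := ⟨by linarith [hs.1, hs.2], by linarith [hs.2]⟩
    refine (m hs hu (by linarith [hs.2])).trans_le (ge_of_tendsto lim ?_)
    filter_upwards [Ioo_mem_nhdsLT hu.2] with v hv
    exact (m hu ⟨hu.1.trans hv.1, hv.2⟩ hv.1).le
  have mL : StrictMonoOn x₁ (Ioc (T - ε) T) := by
    intro u hu v hv huv
    rw [eL u (huv.trans_le hv.2)]
    rcases hv.2.eq_or_lt with rfl | hvT
    · rw [eT]
      exact hneg u ⟨hu.1, huv⟩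
    · rw [eL v hvT]
      exact m ⟨hu.1, huv.trans hvT⟩ ⟨hv.1, hvT⟩ huv
  have mR : StrictMonoOn x₁ (Ico T (T + ε)) := by
    intro u hu v hv huv
    rw [eR v (hu.1.trans_lt huv)]
    have hv' : 2 * T - v ∈ Ioo (T - ε) T := ⟨by linarith [hv.2], by linarith [hu.1]⟩
    rcases hu.1.eq_or_lt with rfl | hTu
    · rw [eT]
      exact neg_pos.2 (hneg _ hv')
    · rw [eR u hTu]
      exact neg_lt_neg (m hv' ⟨by linarith [hu.2], by linarith⟩ (by linarith))
  refine ⟨x₁, fun s hs => eL s hs, eT, ?_, eR, ?_, ?_⟩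
  · rw [continuousAt_iff_continuous_left'_right', ContinuousWithinAt, ContinuousWithinAt, eT]
    have hr : Tendsto (fun s => 2 * T - s) (𝓝[>] T) (𝓝[<] T) := by
      refine tendsto_nhdsWithin_iff.2 ⟨?_, ?_⟩
      · have : Tendsto (fun s : ℝ => 2 * T - s) (𝓝 T) (𝓝 (2 * T - T)) :=
          (continuous_const.sub continuous_id).tendsto T
        rw [show 2 * T - T = T by ring] at this
        exact this.mono_left nhdsWithin_le_nhds
      · filter_upwards [self_mem_nhdsWithin] with s hs
        have : T < s := hs
        exact show 2 * T - s < T by linarith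
    constructor
    · refine lim.congr' ?_
      filter_upwards [self_mem_nhdsWithin] with s hs using (eL s hs).symm
    · have := (lim.comp hr).neg
      rw [neg_zero] at this
      refine this.congr' ?_
      filter_upwards [self_mem_nhdsWithin] with s hs using (eR s hs).symm
  · intro s hs hne
    rcases hne.lt_or_gt with hsT | hsT
    · refine (h s ⟨hs.1, hsT⟩).congr ?_
      filter_upwards [isOpen_Iio.mem_nhds hsT] with u hu using eL u hu
    · have h1 : W.RadialAt κ E L (fun s => -x (-(s + -(2 * T)))) s := by
        refine (RadialAt.comp_add_const (x := fun s => x (-s)) ?_).neg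
        refine RadialAt.comp_neg (h _ ⟨by linarith [hs.2], by linarith⟩)
      refine h1.congr ?_
      filter_upwards [isOpen_Ioi.mem_nhds hsT] with u hu
      rw [eR u hu]
      congr 2
      ring
  · have hT1 : IsGreatest (Ioc (T - ε) T) T := ⟨⟨by linarith, le_rfl⟩, fun s hs => hs.2⟩
    have hT2 : IsLeast (Ico T (T + ε)) T := ⟨⟨le_rfl, by linarith⟩, fun s hs => hs.1⟩
    refine (mL.union mR hT1 hT2).mono fun s hs => ?_
    rcases le_total s T with h | h
    · exact Or.inl ⟨hs.1, h⟩
    · exact Or.inr ⟨h, hs.2⟩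

/-- A motion can be continued whenever its state has a regular limit point. -/
lemma exists_extension_of_mapClusterPt {x : ℝ → ℝ} {a T : ℝ} (haT : a < T)
    (h : ∀ s ∈ Ioo a T, W.MotionAt κ E L x s) {p : ℝ × ℝ} (hp : W.Reg p.1)
    (hcl : MapClusterPt p (𝓝[<] T) fun s => (x s, deriv x s / W.sigmaP (x s))) :
    ∃ b > T, ∃ x₁ : ℝ → ℝ, (∀ s ∈ Ioo a b, W.MotionAt κ E L x₁ s) ∧ EqOn x₁ x (Ioo a T) := by
  obtain ⟨δ, hδ, U, hU, hsol⟩ := W.exists_radialAt_of_mem_nhds κ L p.2 hp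
  have hUR : U ∩ {q | W.Reg q.1} ∈ 𝓝 p :=
    inter_mem hU (continuousAt_fst.preimage_mem_nhds (W.isOpen_setOf_reg.mem_nhds hp))
  -- start from a state close to the limit point, at a parameter closer to `T` than the common life time `δ`
  obtain ⟨s₁, ⟨hs₁U, hs₁R⟩, hs₁⟩ := ((hcl.frequently hUR).and_eventually
    (Ioo_mem_nhdsLT (max_lt haT (by linarith : T - δ < T)))).exists
  have hs₁a : a < s₁ := (le_max_left _ _).trans_lt hs₁.1
  have hs₁δ : T - δ < s₁ := (le_max_right _ _).trans_lt hs₁.1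
  have hI : s₁ ∈ Ioo a T := ⟨hs₁a, hs₁.2⟩
  have hrad : W.RadialAt κ E L x s₁ := (h s₁ hI).radialAt hs₁R
  obtain ⟨z, hz, hzd, hzR⟩ := hsol _ hs₁U E hrad.energy s₁
  have hJ₁ : max a (s₁ - δ) < s₁ := max_lt hs₁a (by linarith)
  have hJsub : ∀ s ∈ Ioo (max a (s₁ - δ)) T, s ∈ Ioo a T ∧ s ∈ Ioo (s₁ - δ) (s₁ + δ) :=
    fun s hs => ⟨⟨(le_max_left _ _).trans_lt hs.1, hs.2⟩, (le_max_right _ _).trans_lt hs.1,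
      by linarith [hs.2]⟩
  have heq : ∀ s ∈ Ioo (max a (s₁ - δ)) T, x =ᶠ[𝓝 s] z := by
    refine MotionAt.eventuallyEq_of_mem isOpen_Ioo isPreconnected_Ioo (fun s hs => h s (hJsub s hs).1)
      (fun s hs => Or.inl (hzR s (hJsub s hs).2)) (s₀ := s₁) ⟨hJ₁, hs₁.2⟩ ?_
    refine RadialAt.eventuallyEq (W := W) (κ := κ) (L := L) (E₁ := E) (E₂ := E) ?_ ?_ hz.symm ?_
    · filter_upwards [isOpen_Ioo.mem_nhds hI,
        (h s₁ hI).continuousAt.preimage_mem_nhds (W.isOpen_setOf_reg.mem_nhds hs₁R)] with u hu hur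
        using (h u hu).radialAt hur
    · filter_upwards [Ioo_mem_nhds (by linarith : s₁ - δ < s₁) (by linarith : s₁ < s₁ + δ)] with u hu
        using hzR u hu
    · rw [hzd]
      have := W.sigmaP_pos (x s₁)
      field_simp
  refine ⟨s₁ + δ, by linarith, fun s => if s < T then x s else z s, fun s hs => ?_,
    fun s hs => by simp [hs.2]⟩
  rcases lt_or_ge s T with hsT | hsT
  · refine (h s ⟨hs.1, hsT⟩).congr ?_
    filter_upwards [isOpen_Iio.mem_nhds hsT] with u hu
    simp [show u < T from hu]
  · refine Or.inl ((hzR s ⟨by linarith [hs₁.2], hs.2⟩).congr ?_)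
    filter_upwards [isOpen_Ioi.mem_nhds (hs₁.2.trans_le hsT)] with u hu
    by_cases huT : u < T
    · simp only [huT, if_true]
      exact (heq u ⟨hJ₁.trans hu, huT⟩).eq_of_nhds
    · simp [huT]

lemma RadialAt.abs_le {x : ℝ → ℝ} {s C : ℝ} (h : W.RadialAt κ E L x s) (hC : 0 ≤ C)
    (hV : |W.V κ L (x s)| ≤ C) : |deriv x s / W.sigmaP (x s)| ≤ E ^ 2 + C + 1 := by
  have h1 := h.energy
  have h2 := neg_le_of_abs_le hV
  have h3 := sq_nonneg E
  refine abs_le_of_sq_le_sq ?_ (by linarith)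
  nlinarith

/-- A bounded potential bounds the speed, so that `x` stays bounded in finite time. -/
lemma exists_abs_le_of_radialAt {x : ℝ → ℝ} {a T : ℝ} (haT : a < T)
    (h : ∀ s ∈ Ioo a T, W.RadialAt κ E L x s)
    (hx : ∀ s ∈ Ioo a T, 1 ≤ |x s| ∨ W.throatMass = 0) : ∃ R, ∀ s ∈ Ioo a T, |x s| ≤ R := by
  obtain ⟨C, hC, hV⟩ := W.exists_abs_V_le κ L one_pos
  have hb : ∀ s ∈ Ioo a T, ‖deriv x s‖ ≤ 2 * (E ^ 2 + C + 1) := by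
    intro s hs
    have h1 := (h s hs).abs_le hC (hV _ (hx s hs))
    have h2 := W.sigmaP_pos (x s)
    rw [abs_div, abs_of_pos h2, div_le_iff₀ h2] at h1
    have h3 := W.sigmaP_le_two (x s)
    have h4 := sq_nonneg E
    rw [Real.norm_eq_abs]
    nlinarith
  have hm : (a + T) / 2 ∈ Ioo a T := ⟨by linarith, by linarith⟩
  refine ⟨|x ((a + T) / 2)| + 2 * (E ^ 2 + C + 1) * (T - a), fun s hs => ?_⟩
  have h1 := (convex_Ioo a T).norm_image_sub_le_of_norm_deriv_le (fun u hu => (h u hu).diff) hb hm hs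
  rw [Real.norm_eq_abs, Real.norm_eq_abs] at h1
  have h2 : |s - (a + T) / 2| ≤ T - a := abs_le.2 ⟨by linarith [hs.1], by linarith [hs.2]⟩
  have h3 := abs_sub_abs_le_abs_sub (x s) (x ((a + T) / 2))
  have h4 : 2 * (E ^ 2 + C + 1) * |s - (a + T) / 2| ≤ 2 * (E ^ 2 + C + 1) * (T - a) := by
    gcongr
  linarith

/-- Either a motion tends to a singular throat at a finite parameter, or it returns infinitely often to a
bounded set of regular values of `x`. -/
lemma exists_frequently_abs_le {x : ℝ → ℝ} {a T : ℝ} (haT : a < T)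
    (h : ∀ s ∈ Ioo a T, W.MotionAt κ E L x s)
    (hlim : ¬(Tendsto x (𝓝[<] T) (𝓝 0) ∧ W.throatMass ≠ 0)) :
    ∃ ρ > 0, ∃ R, ∃ᶠ s in 𝓝[<] T, (ρ ≤ |x s| ∨ W.throatMass = 0) ∧ |x s| ≤ R := by
  have hreg : ∀ s ∈ Ioo a T, 1 ≤ |x s| ∨ W.throatMass = 0 → W.RadialAt κ E L x s := by
    intro s hs hx
    refine (h s hs).radialAt ((W.reg_iff _).2 (hx.imp_left fun hx h0 => ?_))
    rw [h0, abs_zero] at hx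
    linarith
  by_cases hm : W.throatMass = 0
  · obtain ⟨R, hR⟩ := exists_abs_le_of_radialAt haT (fun s hs => hreg s hs (Or.inr hm))
      (fun s _ => Or.inr hm)
    refine ⟨1, one_pos, R, Eventually.frequently ?_⟩
    filter_upwards [Ioo_mem_nhdsLT haT] with s hs using ⟨Or.inr hm, hR s hs⟩
  · have hlim' : ¬Tendsto x (𝓝[<] T) (𝓝 0) := fun h => hlim ⟨h, hm⟩
    obtain ⟨ρ, hρ, hρ1, hfr⟩ : ∃ ρ > 0, ρ < 1 ∧ ∃ᶠ s in 𝓝[<] T, ρ ≤ |x s| := by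
      simp only [Metric.tendsto_nhds, Real.dist_0_eq_abs, not_forall] at hlim'
      obtain ⟨ρ, hρ, hfr⟩ := hlim'
      refine ⟨min ρ (1 / 2), by positivity, (min_le_right _ _).trans_lt (by norm_num), ?_⟩
      exact (not_eventually.1 hfr).mono fun s hs => (min_le_left _ _).trans (not_lt.1 hs)
    -- either `|x| ≥ 1` near `T`, and the speed is bounded, or the values oscillate and take the value `1` in between
    by_cases hone : ∀ᶠ s in 𝓝[<] T, 1 ≤ |x s|
    · obtain ⟨l, hl, hsub⟩ := mem_nhdsLT_iff_exists_Ioo_subset.1 (inter_mem hone (Ioo_mem_nhdsLT haT))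
      obtain ⟨R, hR⟩ := exists_abs_le_of_radialAt (mem_Iio.1 hl)
        (fun s hs => hreg s (hsub hs).2 (Or.inl (hsub hs).1)) (fun s hs => Or.inl (hsub hs).1)
      refine ⟨ρ, hρ, R, (hfr.and_eventually (Ioo_mem_nhdsLT (mem_Iio.1 hl))).mono fun s hs =>
        ⟨Or.inl hs.1, hR s hs.2⟩⟩
    · refine ⟨ρ, hρ, 1, fun hev => ?_⟩
      obtain ⟨l, hl, hsub⟩ := mem_nhdsLT_iff_exists_Ioo_subset.1 (inter_mem hev (Ioo_mem_nhdsLT haT))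
      obtain ⟨u, hu, huI⟩ := (hfr.and_eventually (Ioo_mem_nhdsLT (mem_Iio.1 hl))).exists
      obtain ⟨v, hv, hvI⟩ := ((not_eventually.1 hone).and_eventually
        (Ioo_mem_nhdsLT (mem_Iio.1 hl))).exists
      have hu1 : 1 < |x u| := not_le.1 fun h1 => (hsub huI).1 ⟨Or.inl hu, h1⟩
      have huv : uIcc u v ⊆ Ioo l T := ordConnected_Ioo.uIcc_subset huI hvI
      obtain ⟨w, hw, hxw⟩ := intermediate_value_uIcc (f := fun s => |x s|) (a := u) (b := v)
        (fun s hs => (h s (hsub (huv hs)).2).continuousAt.abs.continuousWithinAt)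
        (mem_uIcc.2 (Or.inr ⟨(not_le.1 hv).le, hu1.le⟩))
      simp only at hxw
      exact (hsub (huv hw)).1 ⟨Or.inl (by rw [hxw]; exact hρ1.le), hxw.le⟩

lemma reg_zero_iff (W : Geon) : W.Reg 0 ↔ W.throatMass = 0 := by simp [reg_iff]

/-- A motion continues beyond a finite parameter `T`: by reflection if it tends to a singular throat, where it
has no turning points, and otherwise from a limit point of its states, which exists by compactness. -/
lemma exists_extension_right (hκ : κ = 0 ∨ κ = 1) (hne : κ = 1 ∨ L ≠ 0 ∨ E ≠ 0) {x : ℝ → ℝ}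
    {a T : ℝ} (haT : a < T) (h : ∀ s ∈ Ioo a T, W.MotionAt κ E L x s) :
    ∃ b > T, ∃ x₁ : ℝ → ℝ, (∀ s ∈ Ioo a b, W.MotionAt κ E L x₁ s) ∧ EqOn x₁ x (Ioo a T) := by
  by_cases hlim : Tendsto x (𝓝[<] T) (𝓝 0) ∧ W.throatMass ≠ 0
  · obtain ⟨hlim, hm⟩ := hlim
    have hsing : ¬W.Reg 0 := by rwa [reg_zero_iff]
    obtain ⟨δ, hδ, c, hc, hsp⟩ := exists_speed_bound hm (E := E) hκ hne
    have hev : ∀ᶠ s in 𝓝[<] T, |x s| < δ := by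
      simpa [Real.dist_0_eq_abs] using (Metric.tendsto_nhds.1 hlim) δ hδ
    obtain ⟨l, hl, hsub⟩ := mem_nhdsLT_iff_exists_Ioo_subset.1 (inter_mem hev (Ioo_mem_nhdsLT haT))
    have hlT : l < T := hl
    have hd : ∀ s ∈ Ioo l T, W.Reg (x s) → deriv x s ≠ 0 := by
      intro s hs hr hd0
      have h1 := ((h s (hsub hs).2).radialAt hr).energy
      have h2 := hsp (x s) (fun h0 => hsing (h0 ▸ hr)) (hsub hs).1 (by rw [← h1]; positivity)
      rw [← h1, hd0] at h2
      norm_num at h2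
      linarith
    have hε : 0 < T - l := by linarith
    have hTl : T - (T - l) = l := by ring
    -- the reflection, for increasing curves; decreasing curves are turned over first
    have main : ∀ x : ℝ → ℝ, (∀ s ∈ Ioo a T, W.MotionAt κ E L x s) → Tendsto x (𝓝[<] T) (𝓝 0) →
        StrictMonoOn x (Ioo l T) → ∃ b > T, ∃ x₁ : ℝ → ℝ,
          (∀ s ∈ Ioo a b, W.MotionAt κ E L x₁ s) ∧ EqOn x₁ x (Ioo a T) := by
      intro x h hlim m
      have hneg : ∀ s ∈ Ioo l T, x s ≠ 0 := by
        intro s hs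
        have hu : (s + T) / 2 ∈ Ioo l T := ⟨by linarith [hs.1, hs.2], by linarith [hs.2]⟩
        refine ((m hs hu (by linarith [hs.2])).trans_le (ge_of_tendsto hlim ?_)).ne
        filter_upwards [Ioo_mem_nhdsLT hu.2] with v hv
        exact (m hu ⟨hu.1.trans hv.1, hv.2⟩ hv.1).le
      have hrad : ∀ s ∈ Ioo l T, W.RadialAt κ E L x s := fun s hs =>
        (h s (hsub hs).2).radialAt (Or.inl (hneg s hs))
      obtain ⟨x₁, h1, h2, h3, -, h4, h5⟩ := exists_reflection hε (by rwa [hTl]) (by rwa [hTl]) hlim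
      rw [hTl] at h4 h5
      refine ⟨T + (T - l), by linarith, x₁, fun s hs => ?_, fun s hs => h1 hs.2⟩
      rcases lt_trichotomy s T with hsT | rfl | hsT
      · refine (h s ⟨hs.1, hsT⟩).congr ?_
        filter_upwards [isOpen_Iio.mem_nhds hsT] with u hu using h1 hu
      · exact Or.inr ⟨h2, hsing, h3, s - l, hε, by rwa [hTl], Or.inl (by rwa [hTl])⟩
      · exact Or.inl (h4 s ⟨hlT.trans hsT, hs.2⟩ hsT.ne')
    rcases MotionAt.strictMonoOn_or_strictAntiOn hlT (fun s hs => h s (hsub hs).2) hd with m | m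
    · exact main x h hlim m
    · obtain ⟨b, hb, x₁, h1, h2⟩ := main (fun s => -x s) (fun s hs => (h s hs).neg)
        (by simpa using hlim.neg) m.neg
      exact ⟨b, hb, fun s => -x₁ s, fun s hs => (h1 s hs).neg, fun s hs => by simp [h2 hs]⟩
  · obtain ⟨ρ, hρ, R, hfr⟩ := exists_frequently_abs_le haT h hlim
    obtain ⟨C, hC, hV⟩ := W.exists_abs_V_le κ L hρ
    set B := E ^ 2 + C + 1
    have hreg : ∀ u, ρ ≤ |u| ∨ W.throatMass = 0 → W.Reg u := fun u hu =>
      (W.reg_iff u).2 (hu.imp_left fun h0 => abs_pos.1 (hρ.trans_le h0))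
    have hK : IsCompact ((Icc (-R) R ∩ {u | ρ ≤ |u| ∨ W.throatMass = 0}) ×ˢ Icc (-B) B) := by
      refine (isCompact_Icc.inter_right ?_).prod isCompact_Icc
      by_cases hm : W.throatMass = 0
      · simp [hm]
      · simp only [hm, or_false]
        exact isClosed_le continuous_const continuous_abs
    -- the states of the motion return infinitely often to a compact set of regular states
    obtain ⟨p, hpK, hp⟩ := hK.exists_mapClusterPt_of_frequently
      (l := 𝓝[<] T) (f := fun s => (x s, deriv x s / W.sigmaP (x s)))
      ((hfr.and_eventually (Ioo_mem_nhdsLT haT)).mono fun s ⟨⟨h1, h2⟩, hs⟩ => by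
        have h3 := ((h s hs).radialAt (hreg _ h1)).abs_le hC (hV _ h1)
        exact ⟨⟨abs_le.1 h2, h1⟩, abs_le.1 h3⟩)
    exact exists_extension_of_mapClusterPt haT h (hreg _ hpK.1.2) hp

lemma exists_extension_left (hκ : κ = 0 ∨ κ = 1) (hne : κ = 1 ∨ L ≠ 0 ∨ E ≠ 0) {x : ℝ → ℝ}
    {a b : ℝ} (hab : a < b) (h : ∀ s ∈ Ioo a b, W.MotionAt κ E L x s) :
    ∃ a' < a, ∃ x₁ : ℝ → ℝ, (∀ s ∈ Ioo a' b, W.MotionAt κ E L x₁ s) ∧ EqOn x₁ x (Ioo a b) := by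
  obtain ⟨c, hc, x₁, h1, h2⟩ := exists_extension_right (a := -b) (T := -a) (x := fun s => x (-s)) hκ hne
    (by linarith) (fun s hs => (h (-s) ⟨by linarith [hs.2], by linarith [hs.1]⟩).comp_neg)
  refine ⟨-c, by linarith, fun s => x₁ (-s), fun s hs =>
    (h1 (-s) ⟨by linarith [hs.2], by linarith [hs.1]⟩).comp_neg, fun s hs => ?_⟩
  simpa using h2 (x := -s) ⟨by linarith [hs.2], by linarith [hs.1]⟩

/-- Motions on nested intervals around `s₁` with the same germ at `s₁` fit together. -/
lemma exists_motion_iUnion {x : ℝ → ℝ} {s₁ : ℝ} {I : Set ℝ} (hI : ∀ T ∈ I, 0 < T)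
    (h : ∀ T ∈ I, ∃ z : ℝ → ℝ, (∀ s ∈ Ioo (s₁ - T) (s₁ + T), W.MotionAt κ E L z s) ∧
      z =ᶠ[𝓝 s₁] x) :
    ∃ z : ℝ → ℝ, ∀ T ∈ I, (∀ s ∈ Ioo (s₁ - T) (s₁ + T), W.MotionAt κ E L z s) ∧
      z =ᶠ[𝓝 s₁] x := by
  classical
  choose! X hX hX0 using h
  set z : ℝ → ℝ := fun s =>
    if h : ∃ T, T ∈ I ∧ s ∈ Ioo (s₁ - T) (s₁ + T) then X h.choose s else 0 with hz
  have hzX : ∀ T ∈ I, ∀ s ∈ Ioo (s₁ - T) (s₁ + T), z s = X T s := by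
    intro T hT s hs
    have hex : ∃ T, T ∈ I ∧ s ∈ Ioo (s₁ - T) (s₁ + T) := ⟨T, hT, hs⟩
    have hz1 : z s = X hex.choose s := by simp only [hz, dif_pos hex]
    obtain ⟨hT', hs'⟩ := hex.choose_spec
    rw [hz1]
    generalize hex.choose = T' at hT' hs'
    have h1 : 0 < min T T' := lt_min (hI T hT) (hI T' hT')
    have e1 := min_le_left T T'
    have e2 := min_le_right T T'
    have hmin : s ∈ Ioo (s₁ - min T T') (s₁ + min T T') := by
      rcases min_choice T T' with h | h <;> rw [h] <;> assumption
    exact (MotionAt.eventuallyEq_of_mem isOpen_Ioo isPreconnected_Ioo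
      (fun u hu => hX T' hT' u ⟨by linarith [hu.1], by linarith [hu.2]⟩)
      (fun u hu => hX T hT u ⟨by linarith [hu.1], by linarith [hu.2]⟩)
      (s₀ := s₁) ⟨by linarith, by linarith⟩ ((hX0 T' hT').trans (hX0 T hT).symm) s hmin).eq_of_nhds
  have hzX' : ∀ T ∈ I, ∀ s ∈ Ioo (s₁ - T) (s₁ + T), z =ᶠ[𝓝 s] X T := fun T hT s hs => by
    filter_upwards [isOpen_Ioo.mem_nhds hs] with u hu using hzX T hT u hu
  exact ⟨z, fun T hT => ⟨fun s hs => (hX T hT s hs).congr (hzX' T hT s hs),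
    (hzX' T hT s₁ ⟨by linarith [hI T hT], by linarith [hI T hT]⟩).trans (hX0 T hT)⟩⟩

/-- Every motion extends to all values of the affine parameter. -/
theorem exists_motion_univ (hκ : κ = 0 ∨ κ = 1) (hne : κ = 1 ∨ L ≠ 0 ∨ E ≠ 0) {x : ℝ → ℝ}
    {s₁ ε : ℝ} (hε : 0 < ε) (h : ∀ s ∈ Ioo (s₁ - ε) (s₁ + ε), W.MotionAt κ E L x s) :
    ∃ z : ℝ → ℝ, (∀ s, W.MotionAt κ E L z s) ∧ z =ᶠ[𝓝 s₁] x := by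
  set I : Set ℝ := {T | 0 < T ∧ ∃ z : ℝ → ℝ,
    (∀ s ∈ Ioo (s₁ - T) (s₁ + T), W.MotionAt κ E L z s) ∧ z =ᶠ[𝓝 s₁] x} with hI
  have hεI : ε ∈ I := ⟨hε, x, h, EventuallyEq.rfl⟩
  obtain ⟨z, hz⟩ := exists_motion_iUnion (I := I) (fun T hT => hT.1) (fun T hT => hT.2)
  -- a motion on a maximal symmetric interval could be extended on both sides
  have hunb : ¬BddAbove I := by
    intro hb
    set S := sSup I
    have hεS : ε ≤ S := le_csSup hb hεI
    have hzS : ∀ s ∈ Ioo (s₁ - S) (s₁ + S), W.MotionAt κ E L z s := by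
      intro s hs
      have hlt : |s - s₁| < S := abs_lt.2 ⟨by linarith [hs.1], by linarith [hs.2]⟩
      obtain ⟨T, hT, hsT⟩ := exists_lt_of_lt_csSup ⟨ε, hεI⟩ hlt
      have := abs_lt.1 hsT
      exact (hz T hT).1 s ⟨by linarith [this.1], by linarith [this.2]⟩
    obtain ⟨b, hb1, x₁, h1, h2⟩ := exists_extension_right hκ hne (by linarith) hzS
    obtain ⟨a, ha1, x₂, h3, h4⟩ := exists_extension_left hκ hne (by linarith) h1
    have hmem : min (b - s₁) (s₁ - a) ∈ I := by
      refine ⟨lt_min (by linarith) (by linarith), x₂, fun s hs => h3 s ?_, ?_⟩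
      · exact ⟨by linarith [hs.1, min_le_right (b - s₁) (s₁ - a)],
          by linarith [hs.2, min_le_left (b - s₁) (s₁ - a)]⟩
      · refine EventuallyEq.trans ?_ (hz ε hεI).2
        filter_upwards [Ioo_mem_nhds (by linarith : s₁ - S < s₁) (by linarith : s₁ < s₁ + S)] with u hu
        rw [h4 ⟨hu.1, hu.2.trans hb1⟩, h2 hu]
    have := le_csSup hb hmem
    rcases min_choice (b - s₁) (s₁ - a) with h | h <;> rw [h] at this <;> linarith
  refine ⟨z, fun s => ?_, (hz ε hεI).2⟩
  obtain ⟨T, hT, hsT⟩ := not_bddAbove_iff.1 hunb |s - s₁|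
  have := abs_lt.1 hsT
  exact (hz T hT).1 s ⟨by linarith [this.1], by linarith [this.2]⟩

end Geon

/-- A continuous function whose derivative has a limit at a point is differentiable there. -/
lemma hasDerivAt_of_tendsto_nhdsNE {E : Type*} [NormedAddCommGroup E] [NormedSpace ℝ E] {f g : ℝ → E}
    {x : ℝ} {e : E} (hd : ∀ᶠ y in 𝓝[≠] x, HasDerivAt f (g y) y) (hc : ContinuousAt f x)
    (hg : Tendsto g (𝓝[≠] x) (𝓝 e)) : HasDerivAt f e x := by
  have hlim : Tendsto (fun y => deriv f y) (𝓝[≠] x) (𝓝 e) :=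
    hg.congr' (hd.mono fun y hy => hy.deriv.symm)
  have hdiff : DifferentiableOn ℝ f {y | HasDerivAt f (g y) y} :=
    fun y hy => (HasDerivAt.differentiableAt hy).differentiableWithinAt
  have h1 := hasDerivWithinAt_Ici_of_tendsto_deriv hdiff hc.continuousWithinAt
    (hd.filter_mono (nhdsWithin_mono x fun y hy => ne_of_gt hy))
    (hlim.mono_left (nhdsWithin_mono x fun y hy => ne_of_gt hy))
  have h2 := hasDerivWithinAt_Iic_of_tendsto_deriv hdiff hc.continuousWithinAt
    (hd.filter_mono (nhdsWithin_mono x fun y hy => ne_of_lt hy))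
    (hlim.mono_left (nhdsWithin_mono x fun y hy => ne_of_lt hy))
  have h3 := h2.union h1
  rwa [Iic_union_Ici, hasDerivWithinAt_univ] at h3

/-- If the momentum `ρ n'` of a curve of unit vectors `n` changes along `n`, its norm is constant. -/
lemma norm_smul_deriv_eq {ρ c : ℝ → ℝ} {n : ℝ → Vec3} {J : Set ℝ} (hJ : IsOpen J)
    (hJc : IsPreconnected J) (hu : ∀ s ∈ J, ‖n s‖ = 1) (hd : ∀ s ∈ J, DifferentiableAt ℝ n s)
    (he : ∀ s ∈ J, HasDerivAt (fun s => ρ s • deriv n s) (c s • n s) s) {s u : ℝ} (hs : s ∈ J)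
    (hu' : u ∈ J) : ‖ρ s • deriv n s‖ = ‖ρ u • deriv n u‖ := by
  have horth : ∀ s ∈ J, inner ℝ (deriv n s) (n s) = 0 := by
    intro s hs
    have h1 := (hd s hs).hasDerivAt.norm_sq
    have h2 : (fun s => ‖n s‖ ^ 2) =ᶠ[𝓝 s] fun _ => 1 := by
      filter_upwards [hJ.mem_nhds hs] with v hv
      rw [hu v hv, one_pow]
    have h3 := h1.unique ((hasDerivAt_const s (1 : ℝ)).congr_of_eventuallyEq h2)
    rw [real_inner_comm]
    linarith
  have hder : ∀ s ∈ J, HasDerivAt (fun s => ‖ρ s • deriv n s‖ ^ 2) 0 s := by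
    intro s hs
    refine (he s hs).norm_sq.congr_deriv ?_
    rw [inner_smul_left, inner_smul_right, horth s hs]
    simp
  have h := hJ.is_const_of_deriv_eq_zero hJc
    (fun s hs => (hder s hs).differentiableAt.differentiableWithinAt)
    (fun s hs => (hder s hs).deriv) hs hu'
  exact (sq_eq_sq₀ (norm_nonneg _) (norm_nonneg _)).1 h

namespace Geon

variable {W : Geon} {κ E L : ℝ}

/-! ### The direction along a geodesic -/

lemma AngularAt.norm_smul {x : ℝ → ℝ} {n : ℝ → Vec3} {s : ℝ} (h : W.AngularAt L x n s) :
    ‖W.radius (x s) ^ 2 • deriv n s‖ = L := by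
  rw [_root_.norm_smul, norm_pow, Real.norm_of_nonneg (W.radius_pos _).le, h.momentum]

lemma AngularAt.nonneg {x : ℝ → ℝ} {n : ℝ → Vec3} {s : ℝ} (h : W.AngularAt L x n s) : 0 ≤ L :=
  h.norm_smul ▸ norm_nonneg _

/-- The difference of two solutions with the same radial coordinate solves a linear system which conserves
`L² |δn|² + |δm|²`, where `m = r² n'`. -/
lemma AngularAt.eqOn {x : ℝ → ℝ} {n₁ n₂ : ℝ → Vec3} {J : Set ℝ} (hJ : IsOpen J)
    (hJc : IsPreconnected J) (h₁ : ∀ s ∈ J, W.AngularAt L x n₁ s)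
    (h₂ : ∀ s ∈ J, W.AngularAt L x n₂ s) {s₀ : ℝ} (hs₀ : s₀ ∈ J) (hn : n₁ s₀ = n₂ s₀)
    (hd : deriv n₁ s₀ = deriv n₂ s₀) : EqOn n₁ n₂ J := by
  have hr : ∀ s, W.radius (x s) ^ 2 ≠ 0 := fun s => (pow_pos (W.radius_pos _) 2).ne'
  set m : (ℝ → Vec3) → ℝ → Vec3 := fun n s => W.radius (x s) ^ 2 • deriv n s with hm
  have hmd : ∀ n : ℝ → Vec3, ∀ s, W.AngularAt L x n s →
      HasDerivAt (m n) (-(L ^ 2 / W.radius (x s) ^ 2) • n s) s := by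
    intro n s h
    refine h.eqn.congr_deriv ?_
    rw [AngularAt.norm_deriv_sq h.momentum]
    congr 2
    have := W.radius_pos (x s)
    field_simp
  have hnd : ∀ n : ℝ → Vec3, ∀ s, W.AngularAt L x n s →
      HasDerivAt n ((W.radius (x s) ^ 2)⁻¹ • m n s) s := by
    intro n s h
    refine h.diff.hasDerivAt.congr_deriv ?_
    simp only [hm]
    rw [inv_smul_smul₀ (hr s)]
  have hcons : ∀ s ∈ J, HasDerivAt
      (fun s => L ^ 2 * ‖n₁ s - n₂ s‖ ^ 2 + ‖m n₁ s - m n₂ s‖ ^ 2) 0 s := by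
    intro s hs
    have e1 := (((hnd n₁ s (h₁ s hs)).fun_sub (hnd n₂ s (h₂ s hs))).norm_sq).const_mul (L ^ 2)
    have e2 := ((hmd n₁ s (h₁ s hs)).fun_sub (hmd n₂ s (h₂ s hs))).norm_sq
    refine (e1.fun_add e2).congr_deriv ?_
    generalize m n₁ s = m₁
    generalize m n₂ s = m₂
    rw [← smul_sub, ← smul_sub, inner_smul_right, inner_smul_right,
      real_inner_comm (n₁ s - n₂ s) (m₁ - m₂)]
    ring
  -- the conserved quantity vanishes at `s₀`; it controls `δm` even if `L = 0`
  have hm0 : ∀ s ∈ J, m n₁ s = m n₂ s := by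
    intro s hs
    have h := hJ.is_const_of_deriv_eq_zero hJc
      (fun s hs => (hcons s hs).differentiableAt.differentiableWithinAt)
      (fun s hs => (hcons s hs).deriv) hs hs₀
    have h0 : m n₁ s₀ = m n₂ s₀ := by simp only [hm, hd]
    rw [hn, h0] at h
    simp only [sub_self, norm_zero] at h
    have h1 : 0 ≤ L ^ 2 * ‖n₁ s - n₂ s‖ ^ 2 := by positivity
    have h2 : ‖m n₁ s - m n₂ s‖ ^ 2 = 0 := le_antisymm (by nlinarith) (by positivity)
    exact sub_eq_zero.1 (norm_eq_zero.1 (pow_eq_zero_iff two_ne_zero |>.1 h2))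
  refine hJ.eqOn_of_deriv_eq hJc (fun s hs => (h₁ s hs).diff.differentiableWithinAt)
    (fun s hs => (h₂ s hs).diff.differentiableWithinAt) (fun s hs => ?_) hs₀ hn
  exact smul_right_injective _ (hr s) (hm0 s hs)

lemma AngularAt.eqOn_of_eventuallyEq {x : ℝ → ℝ} {n₁ n₂ : ℝ → Vec3} {J : Set ℝ} (hJ : IsOpen J)
    (hJc : IsPreconnected J) (h₁ : ∀ s ∈ J, W.AngularAt L x n₁ s)
    (h₂ : ∀ s ∈ J, W.AngularAt L x n₂ s) {s₀ : ℝ} (hs₀ : s₀ ∈ J) (hn : n₁ =ᶠ[𝓝 s₀] n₂) :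
    EqOn n₁ n₂ J :=
  AngularAt.eqOn hJ hJc h₁ h₂ hs₀ hn.eq_of_nhds hn.deriv_eq

lemma norm_cos_smul_add_sin_smul {p u : Vec3} (hp : ‖p‖ = 1) (hu : ‖u‖ = 1)
    (hpu : inner ℝ p u = 0) (θ : ℝ) : ‖Real.cos θ • p + Real.sin θ • u‖ = 1 := by
  have h : ‖Real.cos θ • p + Real.sin θ • u‖ ^ 2 = 1 := by
    rw [norm_add_sq_real, _root_.norm_smul, _root_.norm_smul, inner_smul_left, inner_smul_right, hpu, hp,
      hu, Real.norm_eq_abs, Real.norm_eq_abs, mul_one, mul_one, sq_abs, sq_abs]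
    have := Real.cos_sq_add_sin_sq θ
    simp only [mul_zero]
    linarith
  nlinarith [norm_nonneg (Real.cos θ • p + Real.sin θ • u)]

/-- The direction moves along a great circle, by the angle `∫ L / r²`. -/
lemma exists_angularAt {x : ℝ → ℝ} {J : Set ℝ} (hJ : IsOpen J) (hJc : J.OrdConnected)
    (hx : ContinuousOn x J) {s₀ : ℝ} (hs₀ : s₀ ∈ J) {p v : Vec3} (hp : ‖p‖ = 1)
    (hpv : inner ℝ p v = 0) (hL : W.radius (x s₀) ^ 2 * ‖v‖ = L) :
    ∃ n : ℝ → Vec3, n s₀ = p ∧ deriv n s₀ = v ∧ ∀ s ∈ J, W.AngularAt L x n s := by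
  have hr : ∀ s, 0 < W.radius (x s) := fun s => W.radius_pos _
  rcases eq_or_ne v 0 with rfl | hv
  · rw [norm_zero, mul_zero] at hL
    subst hL
    refine ⟨fun _ => p, rfl, by simp, fun s _ => ⟨hp, differentiableAt_const _, ?_, by simp⟩⟩
    simp only [deriv_const', smul_zero, norm_zero]
    simpa using hasDerivAt_const s (0 : Vec3)
  · have hv0 : 0 < ‖v‖ := norm_pos_iff.2 hv
    have hL0 : 0 < L := hL ▸ mul_pos (pow_pos (hr s₀) 2) hv0
    set u : Vec3 := ‖v‖⁻¹ • v with hu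
    have hu1 : ‖u‖ = 1 := by rw [hu, _root_.norm_smul, norm_inv, norm_norm, inv_mul_cancel₀ hv0.ne']
    have hpu : inner ℝ p u = 0 := by rw [hu, inner_smul_right, hpv, mul_zero]
    have hgc : ContinuousOn (fun s => L / W.radius (x s) ^ 2) J :=
      continuousOn_const.div ((W.continuous_radius.comp_continuousOn hx).pow 2)
        fun s _ => (pow_pos (hr s) 2).ne'
    obtain ⟨φ, hφ0, hφ⟩ := exists_primitive_of_continuousOn hJ hJc hgc hs₀
    -- rotate `p` towards the direction `u` of `v` by the angle `φ`, with `φ' = L / r²`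
    set n : ℝ → Vec3 := fun s => Real.cos (φ s) • p + Real.sin (φ s) • u with hn
    set w : ℝ → Vec3 := fun s => Real.cos (φ s) • u + Real.sin (φ s) • (-p) with hw
    have hw1 : ∀ s, ‖w s‖ = 1 := fun s => norm_cos_smul_add_sin_smul hu1 (by rwa [norm_neg])
      (by rw [inner_neg_right, real_inner_comm, hpu, neg_zero]) _
    have hnd : ∀ s ∈ J, HasDerivAt n ((L / W.radius (x s) ^ 2) • w s) s := by
      intro s hs
      have h1 := ((hφ s hs).cos.smul_const p).fun_add ((hφ s hs).sin.smul_const u)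
      refine h1.congr_deriv ?_
      simp only [hw]
      module
    have hwd : ∀ s ∈ J, HasDerivAt w (-(L / W.radius (x s) ^ 2) • n s) s := by
      intro s hs
      have h1 := ((hφ s hs).cos.smul_const u).fun_add ((hφ s hs).sin.smul_const (-p))
      refine h1.congr_deriv ?_
      simp only [hn]
      module
    have hm : ∀ s ∈ J, W.radius (x s) ^ 2 • deriv n s = L • w s := by
      intro s hs
      rw [(hnd s hs).deriv, smul_smul, mul_div_cancel₀ _ (pow_pos (hr s) 2).ne']
    have hnorm : ∀ s ∈ J, W.radius (x s) ^ 2 * ‖deriv n s‖ = L := by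
      intro s hs
      have h1 := congrArg norm (hm s hs)
      rw [_root_.norm_smul, _root_.norm_smul, hw1, mul_one, Real.norm_of_nonneg hL0.le,
        Real.norm_of_nonneg (by positivity)] at h1
      exact h1
    refine ⟨n, by simp [hn, hφ0], ?_, fun s hs => ⟨norm_cos_smul_add_sin_smul hp hu1 hpu _,
      (hnd s hs).differentiableAt, ?_, hnorm s hs⟩⟩
    · rw [(hnd s₀ hs₀).deriv]
      simp only [hw, hφ0, Real.cos_zero, Real.sin_zero, zero_smul, add_zero, hu, smul_smul]
      rw [← hL, mul_div_cancel_left₀ _ (pow_pos (hr s₀) 2).ne', one_mul, mul_inv_cancel₀ hv0.ne', one_smul]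
    · refine (((hwd s hs).const_smul L).congr_of_eventuallyEq ?_).congr_deriv ?_
      · filter_upwards [hJ.mem_nhds hs] with t ht using hm t ht
      · rw [AngularAt.norm_deriv_sq (hnorm s hs), smul_smul]
        congr 1
        have := hr s
        field_simp

/-- The angular momentum is constant along a geodesic. -/
lemma IsGeodesicOn.momentum_eq {c : Chart} {a b : ℝ → ℝ} {n : ℝ → Vec3} {J : Set ℝ}
    (h : W.IsGeodesicOn c κ E a b n J) (hJ : IsOpen J) (hJc : IsPreconnected J) {s u : ℝ}
    (hs : s ∈ J) (hu : u ∈ J) : W.radius (c.X (a s, b s)) ^ 2 * ‖deriv n s‖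
      = W.radius (c.X (a u, b u)) ^ 2 * ‖deriv n u‖ := by
  have h1 := norm_smul_deriv_eq (ρ := fun s => W.radius (c.X (a s, b s)) ^ 2) hJ hJc h.unit h.diff_n
    h.eqn_n hs hu
  rwa [norm_smul, norm_smul, Real.norm_of_nonneg (by positivity),
    Real.norm_of_nonneg (by positivity)] at h1

lemma IsGeodesicOn.angularAt {c : Chart} {a b x : ℝ → ℝ} {n : ℝ → Vec3} {J : Set ℝ}
    (h : W.IsGeodesicOn c κ E a b n J) {s : ℝ} (hs : s ∈ J)
    (hx : x =ᶠ[𝓝 s] fun s => c.X (a s, b s))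
    (hL : W.radius (c.X (a s, b s)) ^ 2 * ‖deriv n s‖ = L) : W.AngularAt L x n s := by
  refine AngularAt.congr (x := fun s => c.X (a s, b s)) (n := n) ?_ hx EventuallyEq.rfl
  exact ⟨h.unit s hs, h.diff_n s hs, h.eqn_n s hs, hL⟩

lemma IsGeodesicOn.F_mul_deriv_t {t x : ℝ → ℝ} {n : ℝ → Vec3} {J : Set ℝ}
    (h : W.IsGeodesicOn W.static κ E t x n J) {s : ℝ} (hs : s ∈ J) :
    W.F (x s) * deriv t s = E := by
  have := h.energy s hs
  simp only [static] at this
  rw [F]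
  linarith

/-- A curve that crosses a singular throat in the sense of extremal length has the same energy and angular
momentum on both sides, and its direction satisfies the equation of a great circle at the throat
as well. -/
lemma IsThroatCrossing.exists_motion (hsing : ¬W.Reg 0) {t x : ℝ → ℝ} {n : ℝ → Vec3} {s₀ ε : ℝ}
    (h : W.IsThroatCrossing κ E t x n s₀ ε) :
    ∃ L, (∀ s ∈ Ioo (s₀ - ε) (s₀ + ε), s ≠ s₀ → W.RadialAt κ E L x s) ∧
      (∀ s ∈ Ioo (s₀ - ε) (s₀ + ε), W.AngularAt L x n s) ∧ W.ThroatAt κ E L x s₀ ∧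
      W.IsGeodesicOn W.static κ E t x n (Ioo (s₀ - ε) s₀) ∧
      W.IsGeodesicOn W.static κ E t x n (Ioo s₀ (s₀ + ε)) := by
  have hε := h.pos
  obtain ⟨m, hm⟩ := h.momentum_n
  -- on each side the energy and the angular momentum are determined by their limits at the throat
  have side : ∀ J : Set ℝ, IsOpen J → IsPreconnected J → J ⊆ {s₀}ᶜ → ∀ l : Filter ℝ, l.NeBot → J ∈ l →
      l ≤ 𝓝[≠] s₀ → (∃ E', W.IsGeodesicOn W.static κ E' t x n J) →
      W.IsGeodesicOn W.static κ E t x n J ∧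
        ∀ s ∈ J, W.radius (x s) ^ 2 * ‖deriv n s‖ = ‖m‖ := by
    intro J hJ hJc _ l hl hJl hle hg
    obtain ⟨E', hg⟩ := hg
    constructor
    · have h1 : E' = E := by
        refine tendsto_nhds_unique (tendsto_const_nhds.congr' ?_) (h.momentum_t.mono_left hle)
        filter_upwards [hJl] with s hs using (hg.F_mul_deriv_t hs).symm
      rwa [h1] at hg
    · intro s hs
      refine tendsto_nhds_unique (tendsto_const_nhds.congr' ?_) (hm.mono_left hle).norm
      filter_upwards [hJl] with u hu
      rw [_root_.norm_smul, Real.norm_of_nonneg (by positivity)]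
      exact hg.momentum_eq hJ hJc hs hu
  obtain ⟨gL, mL⟩ := side (Ioo (s₀ - ε) s₀) isOpen_Ioo isPreconnected_Ioo (fun s hs => hs.2.ne)
    (𝓝[<] s₀) inferInstance (Ioo_mem_nhdsLT (by linarith))
    (nhdsWithin_mono _ fun s hs => ne_of_lt hs) h.left
  obtain ⟨gR, mR⟩ := side (Ioo s₀ (s₀ + ε)) isOpen_Ioo isPreconnected_Ioo (fun s hs => hs.1.ne')
    (𝓝[>] s₀) inferInstance (Ioo_mem_nhdsGT (by linarith))
    (nhdsWithin_mono _ fun s hs => ne_of_gt hs) h.right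
  have hrad : ∀ s ∈ Ioo (s₀ - ε) (s₀ + ε), s ≠ s₀ → W.RadialAt κ E ‖m‖ x s := by
    intro s hs hne
    rcases hne.lt_or_gt with hlt | hlt
    · exact gL.radialAt_static isOpen_Ioo ⟨hs.1, hlt⟩ (mL s ⟨hs.1, hlt⟩)
    · exact gR.radialAt_static isOpen_Ioo ⟨hlt, hs.2⟩ (mR s ⟨hlt, hs.2⟩)
  have hang : ∀ s ∈ Ioo (s₀ - ε) (s₀ + ε), s ≠ s₀ → W.AngularAt ‖m‖ x n s := by
    intro s hs hne
    rcases hne.lt_or_gt with hlt | hlt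
    · exact gL.angularAt ⟨hs.1, hlt⟩ EventuallyEq.rfl (mL s ⟨hs.1, hlt⟩)
    · exact gR.angularAt ⟨hlt, hs.2⟩ EventuallyEq.rfl (mR s ⟨hlt, hs.2⟩)
  have hI : Ioo (s₀ - ε) (s₀ + ε) ∈ 𝓝 s₀ := Ioo_mem_nhds (by linarith) (by linarith)
  have hI' : ∀ᶠ s in 𝓝[≠] s₀, s ∈ Ioo (s₀ - ε) (s₀ + ε) ∧ s ≠ s₀ :=
    (show ∀ᶠ s in 𝓝[≠] s₀, s ∈ Ioo (s₀ - ε) (s₀ + ε) from mem_nhdsWithin_of_mem_nhds hI).and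
      self_mem_nhdsWithin
  have hr0 := W.radius_pos (x s₀)
  have hrc : ContinuousAt (fun s => W.radius (x s) ^ 2) s₀ :=
    (W.continuous_radius.continuousAt.comp h.cont_x).pow 2
  have hrt : Tendsto (fun s => W.radius (x s) ^ 2) (𝓝[≠] s₀) (𝓝 (W.radius (x s₀) ^ 2)) :=
    hrc.tendsto.mono_left nhdsWithin_le_nhds
  have hnt : Tendsto n (𝓝[≠] s₀) (𝓝 (n s₀)) := h.cont_n.tendsto.mono_left nhdsWithin_le_nhds
  -- the continuity of the momentum makes `n` differentiable at the throat
  have hnd : HasDerivAt n ((W.radius (x s₀) ^ 2)⁻¹ • m) s₀ := by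
    refine hasDerivAt_of_tendsto_nhdsNE
      (g := fun s => (W.radius (x s) ^ 2)⁻¹ • (W.radius (x s) ^ 2 • deriv n s)) ?_ h.cont_n
      ((hrt.inv₀ (pow_pos hr0 2).ne').smul hm)
    filter_upwards [hI'] with s hs
    rw [inv_smul_smul₀ (pow_pos (W.radius_pos _) 2).ne']
    exact (hang s hs.1 hs.2).diff.hasDerivAt
  have hm0 : W.radius (x s₀) ^ 2 • deriv n s₀ = m := by
    rw [hnd.deriv, smul_inv_smul₀ (pow_pos hr0 2).ne']
  have hmom : W.radius (x s₀) ^ 2 * ‖deriv n s₀‖ = ‖m‖ := by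
    rw [← hm0, _root_.norm_smul, Real.norm_of_nonneg (by positivity)]
  have hang0 : W.AngularAt ‖m‖ x n s₀ := by
    refine ⟨?_, hnd.differentiableAt, ?_, hmom⟩
    · refine tendsto_nhds_unique hnt.norm (tendsto_const_nhds.congr' ?_)
      filter_upwards [hI'] with s hs using (hang s hs.1 hs.2).unit.symm
    · refine hasDerivAt_of_tendsto_nhdsNE
        (g := fun s => -(‖m‖ ^ 2 / W.radius (x s) ^ 2) • n s) ?_ ?_ ?_
      · filter_upwards [hI'] with s hs
        refine (hang s hs.1 hs.2).eqn.congr_deriv ?_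
        rw [AngularAt.norm_deriv_sq (hang s hs.1 hs.2).momentum]
        have := W.radius_pos (x s)
        congr 2
        field_simp
      · rw [continuousAt_iff_punctured_nhds, hm0]
        exact hm
      · rw [AngularAt.norm_deriv_sq hmom,
          show W.radius (x s₀) ^ 2 * (‖m‖ ^ 2 / W.radius (x s₀) ^ 4)
            = ‖m‖ ^ 2 / W.radius (x s₀) ^ 2 by field_simp]
        exact (tendsto_const_nhds.div hrt (pow_pos hr0 2).ne').neg.smul hnt
  refine ⟨‖m‖, hrad, fun s hs => ?_, ⟨h.zero, hsing, h.cont_x, ε, hε, hrad, h.crosses⟩, gL, gR⟩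
  rcases eq_or_ne s s₀ with rfl | hne
  · exact hang0
  · exact hang s hs hne

/-! ### From geodesics to the reduced equations -/

lemma IsGeodesicOn.radialAt_of_mem_atlas {c : Chart} (hc : c ∈ W.atlas) {a b : ℝ → ℝ} {n : ℝ → Vec3}
    {J : Set ℝ} (h : W.IsGeodesicOn c κ E a b n J) (hJ : IsOpen J) {s : ℝ} (hs : s ∈ J)
    (hL : W.radius (c.X (a s, b s)) ^ 2 * ‖deriv n s‖ = L) :
    W.RadialAt κ E L (fun u => c.X (a u, b u)) s := by
  rcases hc with rfl | rfl | rfl | ⟨h₀, hh, h0, hk, rfl⟩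
  · exact h.radialAt_static hJ hs hL
  · exact h.radialAt_eddington (Or.inl rfl) hJ hs hL
  · exact h.radialAt_eddington (Or.inr rfl) hJ hs hL
  · exact IsGeodesicOn.radialAt_bifurcate hh h0 hk h hJ hs hL

/-- A geodesic with `κ = L = E = 0` would be at rest off the horizons, against the requirement that the
tangent does not vanish. -/
lemma IsGeodesicOn.nontrivial {c : Chart} (hc : c ∈ W.atlas) {a b : ℝ → ℝ} {n : ℝ → Vec3}
    {J : Set ℝ} (h : W.IsGeodesicOn c κ E a b n J) (hJ : IsOpen J) {s : ℝ} (hs : s ∈ J)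
    (hL : W.radius (c.X (a s, b s)) ^ 2 * ‖deriv n s‖ = L) (hA : W.A (c.X (a s, b s)) ≠ 0)
    (hκ : κ = 0 ∨ κ = 1) : κ = 1 ∨ L ≠ 0 ∨ E ≠ 0 := by
  by_contra hcon
  push Not at hcon
  obtain ⟨hκ1, rfl, rfl⟩ := hcon
  obtain rfl : κ = 0 := hκ.resolve_right hκ1
  have hR := h.radialAt_of_mem_atlas hc hJ hs hL
  have hn : deriv n s = 0 := by
    have := W.radius_pos (c.X (a s, b s))
    rcases mul_eq_zero.1 hL with h0 | h0
    · exact absurd h0 (pow_pos this 2).ne'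
    · exact norm_eq_zero.1 h0
  have hx : deriv (fun u => c.X (a u, b u)) s = 0 := by
    have h1 := hR.energy
    have h2 := W.sigmaP_pos (c.X (a s, b s))
    rw [V_zero_zero] at h1
    have h3 := pow_eq_zero_iff two_ne_zero |>.1 (h1.trans (by norm_num))
    exact (div_eq_zero_iff.1 h3).resolve_right h2.ne'
  have ht := h.tangent_ne_zero s hs
  have hen := h.energy s hs
  rcases hc with rfl | rfl | rfl | ⟨h₀, hh, h0, hk, rfl⟩
  · have hF := h.F_mul_deriv_t hs
    have hF0 : W.F (b s) ≠ 0 := div_ne_zero hA (W.sigmaP_pos _).ne'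
    exact ht ⟨(mul_eq_zero.1 hF).resolve_left hF0, hx, hn⟩
  · change deriv b s = 0 at hx
    simp only [eddington, hx] at hen
    have hF0 : W.A (b s) / W.sigmaP (b s) ≠ 0 := div_ne_zero hA (W.sigmaP_pos _).ne'
    have h1 : W.A (b s) / W.sigmaP (b s) * deriv a s = 0 := by linarith
    exact ht ⟨(mul_eq_zero.1 h1).resolve_left hF0, hx, hn⟩
  · change deriv b s = 0 at hx
    simp only [eddington, hx] at hen
    have hF0 : W.A (b s) / W.sigmaP (b s) ≠ 0 := div_ne_zero hA (W.sigmaP_pos _).ne'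
    have h1 : W.A (b s) / W.sigmaP (b s) * deriv a s = 0 := by linarith
    exact ht ⟨(mul_eq_zero.1 h1).resolve_left hF0, hx, hn⟩
  · change W.A (h₀ + a s * b s) ≠ 0 at hA
    have hX : deriv a s * b s + a s * deriv b s = 0 := by
      have h1 := ((h.diff_a s hs).hasDerivAt.fun_mul (h.diff_b s hs).hasDerivAt).const_add h₀
      rw [← h1.deriv]
      exact hx
    rw [bifurcate_qaa] at hen
    simp only [bifurcate] at hen
    have hS := W.slopeA_eq h₀ (h₀ + a s * b s)
    have hAS := W.A_eq_mul_slopeA h0 (h₀ + a s * b s)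
    rw [add_sub_cancel_left] at hS hAS
    have hσ := W.sigmaP_pos (h₀ + a s * b s)
    generalize W.slopeA₂ h₀ (h₀ + a s * b s) = D at hen hS
    generalize W.slopeA h₀ (h₀ + a s * b s) = B at hS hAS
    generalize W.sigmaP (h₀ + a s * b s) = σ at hen hσ
    rw [hAS] at hA
    have hB : B ≠ 0 := right_ne_zero_of_mul hA
    have ha : a s ≠ 0 := left_ne_zero_of_mul (left_ne_zero_of_mul hA)
    have hb : b s ≠ 0 := right_ne_zero_of_mul (left_ne_zero_of_mul hA)
    generalize deriv W.A h₀ = k at hen hS hk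
    -- with `x' = 0` the energy is a non-zero multiple of `U'`, for `U V ≠ 0`
    have ha' : deriv a s = 0 := by
      have h1 : deriv a s * (b s * B) = 0 := by
        field_simp at hen
        rw [hS]
        have h2 : a s * deriv b s = -(deriv a s * b s) := by linarith
        rw [h2] at hen
        linear_combination hen / 4
      exact (mul_eq_zero.1 h1).resolve_right (mul_ne_zero hb hB)
    rw [ha', zero_mul, zero_add] at hX
    exact ht ⟨ha', (mul_eq_zero.1 hX).resolve_left ha, hn⟩

/-- Along a causal geodesic the angular momentum is constant, and the reduced equations hold. -/
lemma IsCausalGeodesic.exists_motion {I : Set ℝ} {x : ℝ → ℝ} {n : ℝ → Vec3}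
    (h : W.IsCausalGeodesic κ E I x n) : ∃ L, (κ = 1 ∨ L ≠ 0 ∨ E ≠ 0) ∧
      (∀ s ∈ I, W.MotionAt κ E L x s) ∧ ∀ s ∈ I, W.AngularAt L x n s := by
  -- each chart has its own value of `L`; where the charts overlap these values agree
  have hloc : ∀ s₀ ∈ I, ∃ L, (∀ᶠ u in 𝓝 s₀, W.MotionAt κ E L x u ∧ W.AngularAt L x n u) ∧
      (W.Reg (x s₀) → W.A (x s₀) ≠ 0 → κ = 1 ∨ L ≠ 0 ∨ E ≠ 0) := by
    intro s₀ hs₀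
    by_cases hr : W.Reg (x s₀)
    · obtain ⟨c, hc, ε, hε, a, b, -, hg, hx⟩ := h.regular s₀ hs₀ hr
      have hs : s₀ ∈ Ioo (s₀ - ε) (s₀ + ε) := ⟨by linarith, by linarith⟩
      refine ⟨_, ?_, fun _ hA => hg.nontrivial hc isOpen_Ioo hs rfl (by rwa [← hx s₀ hs]) h.causal⟩
      filter_upwards [isOpen_Ioo.mem_nhds hs] with u hu
      have hm := hg.momentum_eq isOpen_Ioo isPreconnected_Ioo hu hs
      have hxe : x =ᶠ[𝓝 u] fun s => c.X (a s, b s) := by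
        filter_upwards [isOpen_Ioo.mem_nhds hu] with v hv using hx v hv
      exact ⟨Or.inl ((hg.radialAt_of_mem_atlas hc isOpen_Ioo hu hm).congr hxe),
        hg.angularAt hu hxe hm⟩
    · obtain ⟨ε, hε, t, -, ht⟩ := h.throat s₀ hs₀ hr
      obtain ⟨L, h1, h2, h3, -, -⟩ := ht.exists_motion (by rwa [ht.zero] at hr)
      refine ⟨L, ?_, fun h' => absurd h' hr⟩
      filter_upwards [Ioo_mem_nhds (by linarith : s₀ - ε < s₀) (by linarith : s₀ < s₀ + ε)] with u hu
      refine ⟨?_, h2 u hu⟩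
      rcases eq_or_ne u s₀ with rfl | hne
      · exact Or.inr h3
      · exact Or.inl (h1 u hu hne)
  obtain ⟨s₁, hs₁, hr₁, hA₁⟩ := h.meets
  -- the angular momentum is locally constant on the interval `I`
  set ℓ : ℝ → ℝ := fun s => W.radius (x s) ^ 2 * ‖deriv n s‖
  have hℓ : ∀ s₀ ∈ I, ∃ L, (∀ᶠ u in 𝓝 s₀, ℓ u = L) := fun s₀ hs₀ => by
    obtain ⟨L, h1, -⟩ := hloc s₀ hs₀
    exact ⟨L, h1.mono fun u hu => hu.2.momentum⟩
  have hconst : ∀ s ∈ I, ℓ =ᶠ[𝓝 s] fun _ => ℓ s₁ := by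
    refine eqOn_of_eventuallyEq_of_frequently h.ordConnected.isPreconnected hs₁ ?_ fun s hs hfr => ?_
    · obtain ⟨L, hL⟩ := hℓ s₁ hs₁
      filter_upwards [hL] with u hu
      rw [hu, hL.self_of_nhds]
    · obtain ⟨L, hL⟩ := hℓ s hs
      obtain ⟨u, hu1, hu2⟩ := (hfr.and_eventually hL).exists
      filter_upwards [hL] with v hv
      rw [hv, ← hu2]
      exact hu1.eq_of_nhds
  have hall : ∀ s ∈ I, W.MotionAt κ E (ℓ s₁) x s ∧ W.AngularAt (ℓ s₁) x n s := by
    intro s hs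
    obtain ⟨L, h1, -⟩ := hloc s hs
    have h2 : L = ℓ s₁ := by
      rw [← (hconst s hs).eq_of_nhds]
      exact h1.self_of_nhds.2.momentum.symm
    rw [← h2]
    exact h1.self_of_nhds
  refine ⟨ℓ s₁, ?_, fun s hs => (hall s hs).1, fun s hs => (hall s hs).2⟩
  obtain ⟨L, h1, h2⟩ := hloc s₁ hs₁
  have h3 : L = ℓ s₁ := h1.self_of_nhds.2.momentum.symm
  exact h3 ▸ h2 hr₁ hA₁

/-! ### From the reduced equations to geodesics -/

lemma ne_zero_of_nontrivial (hne : κ = 1 ∨ L ≠ 0 ∨ E ≠ 0) : κ ≠ 0 ∨ L ≠ 0 ∨ E ≠ 0 :=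
  hne.imp_left fun h => by simp [h]

lemma exists_Ioo_subset_of_eventually {s₀ : ℝ} {p : ℝ → Prop} (h : ∀ᶠ s in 𝓝 s₀, p s) :
    ∃ ε > 0, ∀ s ∈ Ioo (s₀ - ε) (s₀ + ε), p s := by
  obtain ⟨ε, hε, h⟩ := Metric.eventually_nhds_iff_ball.1 h
  exact ⟨ε, hε, fun s hs => h s (by rwa [Real.ball_eq_Ioo])⟩

/-- Where `A ≠ 0` the coordinate `t` is a primitive of `E σ₊ / A`. -/
lemma exists_static_lift (hne : κ = 1 ∨ L ≠ 0 ∨ E ≠ 0) {J : Set ℝ} (hJ : IsOpen J)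
    {x : ℝ → ℝ} {n : ℝ → Vec3} (hR : ∀ s ∈ J, W.RadialAt κ E L x s)
    (hN : ∀ s ∈ J, W.AngularAt L x n s) {s₀ : ℝ} (hs₀ : s₀ ∈ J) (hA : W.A (x s₀) ≠ 0) :
    ∃ ε > 0, ∃ t : ℝ → ℝ, Ioo (s₀ - ε) (s₀ + ε) ⊆ J ∧
      W.IsGeodesicOn W.static κ E t x n (Ioo (s₀ - ε) (s₀ + ε)) := by
  have hAc : ∀ s ∈ J, ContinuousAt (fun s => W.A (x s)) s := fun s hs =>
    ContinuousAt.comp (f := x) (W.analyticAt_A (hR s hs).reg).continuousAt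
      (hR s hs).diff.continuousAt
  obtain ⟨ε, hε, hsub⟩ := exists_Ioo_subset_of_eventually
    ((show ∀ᶠ s in 𝓝 s₀, s ∈ J from hJ.mem_nhds hs₀).and ((hAc s₀ hs₀).eventually_ne hA))
  obtain ⟨t, -, ht⟩ := exists_primitive_of_continuousOn (J := Ioo (s₀ - ε) (s₀ + ε))
    (g := fun s => E * W.sigmaP (x s) / W.A (x s)) isOpen_Ioo ordConnected_Ioo
    (fun s hs => ((continuousAt_const.mul (W.continuous_sigmaP.continuousAt.comp
      (hR s (hsub s hs).1).diff.continuousAt)).div (hAc s (hsub s hs).1)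
      (hsub s hs).2).continuousWithinAt) (c := s₀) ⟨by linarith, by linarith⟩
  exact ⟨ε, hε, t, fun s hs => (hsub s hs).1, IsGeodesicOn.static_of_radialAt isOpen_Ioo
    (ne_zero_of_nontrivial hne) (fun s hs => (hsub s hs).2) (fun s hs => hR s (hsub s hs).1)
    (fun s hs => hN s (hsub s hs).1) ht⟩

/-- Where `E ≠ e x' / σ₊` the coordinate `w` is a primitive of `(κ + L² / r²) / (E - e x' / σ₊)`, which is
regular across the horizons. -/
lemma exists_eddington_lift {e : ℝ} (he : e = 1 ∨ e = -1) {J : Set ℝ} (hJ : IsOpen J)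
    {x : ℝ → ℝ} {n : ℝ → Vec3} (hR : ∀ s ∈ J, W.RadialAt κ E L x s)
    (hN : ∀ s ∈ J, W.AngularAt L x n s) {s₀ : ℝ} (hs₀ : s₀ ∈ J)
    (h0 : E - e * (deriv x s₀ / W.sigmaP (x s₀)) ≠ 0) :
    ∃ ε > 0, ∃ w : ℝ → ℝ, Ioo (s₀ - ε) (s₀ + ε) ⊆ J ∧
      W.IsGeodesicOn (W.eddington e) κ E w x n (Ioo (s₀ - ε) (s₀ + ε)) := by
  have hc : ∀ s ∈ J, ContinuousAt (fun s => E - e * (deriv x s / W.sigmaP (x s))) s := fun s hs =>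
    continuousAt_const.sub (continuousAt_const.mul (hR s hs).accel.continuousAt)
  obtain ⟨ε, hε, hsub⟩ := exists_Ioo_subset_of_eventually
    ((show ∀ᶠ s in 𝓝 s₀, s ∈ J from hJ.mem_nhds hs₀).and ((hc s₀ hs₀).eventually_ne h0))
  obtain ⟨w, -, hw⟩ := exists_primitive_of_continuousOn (J := Ioo (s₀ - ε) (s₀ + ε))
    (g := fun s => W.massTerm κ L (x s) / (E - e * (deriv x s / W.sigmaP (x s)))) isOpen_Ioo
    ordConnected_Ioo
    (fun s hs => ((ContinuousAt.comp (f := x) (W.analyticAt_massTerm κ L _).continuousAt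
      (hR s (hsub s hs).1).diff.continuousAt).div (hc s (hsub s hs).1)
      (hsub s hs).2).continuousWithinAt) (c := s₀) ⟨by linarith, by linarith⟩
  exact ⟨ε, hε, w, fun s hs => (hsub s hs).1, IsGeodesicOn.eddington_of_radialAt he isOpen_Ioo
    (fun s hs => (hsub s hs).2) (fun s hs => hR s (hsub s hs).1)
    (fun s hs => hN s (hsub s hs).1) hw⟩

lemma V_eq_zero_of_A_eq_zero {x : ℝ} (h : W.A x = 0) : W.V κ L x = 0 := by
  simp [V, F, h]

/-- At a degenerate horizon the constant curve solves the radial equation with `E = 0`. By uniqueness no other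
motion with `E = 0` reaches such a horizon. -/
lemma radialAt_const {h : ℝ} (hh : W.Reg h) (h0 : W.A h = 0) (hk : deriv W.A h = 0) (s : ℝ) :
    W.RadialAt κ 0 L (fun _ => h) s := by
  refine ⟨hh, differentiableAt_const _, ?_, ?_⟩
  · simp only [deriv_const', zero_div, W.deriv_V κ L hh, h0, hk]
    refine (hasDerivAt_const s (0 : ℝ)).congr_deriv (by ring)
  · simp [V_eq_zero_of_A_eq_zero h0]

lemma abs_mul_A_eq (W : Geon) {x : ℝ} (hx : x ≠ 0) :
    |x| * W.A x = |x| * W.regA x - W.throatMass := by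
  have := abs_ne_zero.2 hx
  rw [A_eq]
  field_simp

/-- Off the throat `t' = E σ₊ / A`; in the form `E σ₊ |x| / (|x| A)` the right-hand side is continuous
through a singular throat. -/
lemma isThroatCrossing_of_motion (hne : κ = 1 ∨ L ≠ 0 ∨ E ≠ 0)
    {t x : ℝ → ℝ} {n : ℝ → Vec3} {s₀ ε : ℝ} (hε : 0 < ε)
    (hrad : ∀ s ∈ Ioo (s₀ - ε) (s₀ + ε), s ≠ s₀ → W.RadialAt κ E L x s)
    (hang : ∀ s ∈ Ioo (s₀ - ε) (s₀ + ε), W.AngularAt L x n s) (hz : x s₀ = 0)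
    (hc : ContinuousAt x s₀)
    (hcross : StrictMonoOn x (Ioo (s₀ - ε) (s₀ + ε)) ∨ StrictAntiOn x (Ioo (s₀ - ε) (s₀ + ε)))
    (hA : ∀ s ∈ Ioo (s₀ - ε) (s₀ + ε), |x s| * W.regA (x s) - W.throatMass ≠ 0)
    (ht : ∀ s ∈ Ioo (s₀ - ε) (s₀ + ε), HasDerivAt t
      (E * W.sigmaP (x s) * |x s| / (|x s| * W.regA (x s) - W.throatMass)) s) :
    W.IsThroatCrossing κ E t x n s₀ ε := by
  have hs₀ : s₀ ∈ Ioo (s₀ - ε) (s₀ + ε) := ⟨by linarith, by linarith⟩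
  have hx0 : ∀ s ∈ Ioo (s₀ - ε) (s₀ + ε), s ≠ s₀ → x s ≠ 0 := by
    intro s hs hne h0
    have hinj : InjOn x (Ioo (s₀ - ε) (s₀ + ε)) := hcross.elim (fun h => h.injOn) (fun h => h.injOn)
    exact hne (hinj hs hs₀ (h0.trans hz.symm))
  have hA0 : ∀ s ∈ Ioo (s₀ - ε) (s₀ + ε), s ≠ s₀ → W.A (x s) ≠ 0 := by
    intro s hs hne
    have h1 := hA s hs
    rw [← W.abs_mul_A_eq (hx0 s hs hne)] at h1
    exact right_ne_zero_of_mul h1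
  have ht' : ∀ s ∈ Ioo (s₀ - ε) (s₀ + ε), s ≠ s₀ →
      HasDerivAt t (E * W.sigmaP (x s) / W.A (x s)) s := by
    intro s hs hne
    refine (ht s hs).congr_deriv ?_
    rw [← W.abs_mul_A_eq (hx0 s hs hne)]
    have h1 := abs_ne_zero.2 (hx0 s hs hne)
    have h2 := hA0 s hs hne
    field_simp
  have hL : ∀ s ∈ Ioo (s₀ - ε) s₀, s ∈ Ioo (s₀ - ε) (s₀ + ε) ∧ s ≠ s₀ :=
    fun s hs => ⟨⟨hs.1, by linarith [hs.2]⟩, hs.2.ne⟩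
  have hR : ∀ s ∈ Ioo s₀ (s₀ + ε), s ∈ Ioo (s₀ - ε) (s₀ + ε) ∧ s ≠ s₀ :=
    fun s hs => ⟨⟨by linarith [hs.1], hs.2⟩, hs.1.ne'⟩
  have hgeo : ∀ J : Set ℝ, IsOpen J → (∀ s ∈ J, s ∈ Ioo (s₀ - ε) (s₀ + ε) ∧ s ≠ s₀) →
      W.IsGeodesicOn W.static κ E t x n J := fun J hJ hsub =>
    IsGeodesicOn.static_of_radialAt hJ (ne_zero_of_nontrivial hne)
      (fun s hs => hA0 s (hsub s hs).1 (hsub s hs).2)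
      (fun s hs => hrad s (hsub s hs).1 (hsub s hs).2) (fun s hs => hang s (hsub s hs).1)
      (fun s hs => ht' s (hsub s hs).1 (hsub s hs).2)
  refine ⟨hε, ⟨E, hgeo _ isOpen_Ioo hL⟩, ⟨E, hgeo _ isOpen_Ioo hR⟩, hz,
    (ht s₀ hs₀).continuousAt, hc, (hang s₀ hs₀).diff.continuousAt, ?_,
    ⟨_, (hang s₀ hs₀).eqn.continuousAt.tendsto.mono_left nhdsWithin_le_nhds⟩, hcross⟩
  refine tendsto_const_nhds.congr' ?_
  filter_upwards [mem_nhdsWithin_of_mem_nhds (isOpen_Ioo.mem_nhds hs₀), self_mem_nhdsWithin] with s hs hs'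
  rcases lt_or_gt_of_ne hs' with h | h
  · exact ((hgeo _ isOpen_Ioo hL).F_mul_deriv_t ⟨hs.1, h⟩).symm
  · exact ((hgeo _ isOpen_Ioo hR).F_mul_deriv_t ⟨h, hs.2⟩).symm

/-- Time as a function of the parameter through a singular throat: the derivative `E σ₊ / A` of `t` is continuous
there, with the value `0`. -/
lemma exists_throat_time {J : Set ℝ} (hJ : IsOpen J) (hJc : J.OrdConnected) {x : ℝ → ℝ}
    (hx : ContinuousOn x J) (hA : ∀ s ∈ J, |x s| * W.regA (x s) - W.throatMass ≠ 0) {c : ℝ}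
    (hc : c ∈ J) (E : ℝ) : ∃ t : ℝ → ℝ, t c = 0 ∧ ∀ s ∈ J, HasDerivAt t
      (E * W.sigmaP (x s) * |x s| / (|x s| * W.regA (x s) - W.throatMass)) s := by
  refine exists_primitive_of_continuousOn hJ hJc ?_ hc
  have h1 : Continuous W.regA := continuous_iff_continuousAt.2 fun u =>
    (W.analyticAt_regA u).continuousAt
  exact ((continuousOn_const.mul (W.continuous_sigmaP.comp_continuousOn hx)).mul hx.abs).div
    ((hx.abs.mul (h1.comp_continuousOn hx)).sub continuousOn_const) hA

/-- A solution of the reduced equations that does not stay in a horizon is a causal geodesic. Where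
`A ≠ 0` the coordinate `t` is an integral; at a horizon reached with `E ≠ 0` the Eddington-Finkelstein
coordinate in which the curve is regular is an integral; with `E = 0` the curve passes through the bifurcation
sphere of a non-degenerate horizon. -/
lemma isCausalGeodesic_of_motion (hκ : κ = 0 ∨ κ = 1) (hne : κ = 1 ∨ L ≠ 0 ∨ E ≠ 0) {I : Set ℝ}
    (hI : IsOpen I) (hIc : I.OrdConnected) {x : ℝ → ℝ} {n : ℝ → Vec3}
    (hmeets : ∃ s ∈ I, W.Reg (x s) ∧ W.A (x s) ≠ 0) (hM : ∀ s ∈ I, W.MotionAt κ E L x s)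
    (hN : ∀ s ∈ I, W.AngularAt L x n s) : W.IsCausalGeodesic κ E I x n := by
  refine ⟨hκ, hI, hIc, hmeets, fun s₀ hs₀ hr => ?_, fun s₀ hs₀ hr => ?_⟩
  · obtain ⟨ε₀, hε₀, hsub⟩ := exists_Ioo_subset_of_eventually
      ((show ∀ᶠ s in 𝓝 s₀, s ∈ I from hI.mem_nhds hs₀).and
        ((hM s₀ hs₀).continuousAt.preimage_mem_nhds (W.isOpen_setOf_reg.mem_nhds hr)))
    set J := Ioo (s₀ - ε₀) (s₀ + ε₀) with hJ
    have hJs : s₀ ∈ J := ⟨by linarith, by linarith⟩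
    have hR : ∀ s ∈ J, W.RadialAt κ E L x s := fun s hs => (hM s (hsub s hs).1).radialAt (hsub s hs).2
    have hN' : ∀ s ∈ J, W.AngularAt L x n s := fun s hs => hN s (hsub s hs).1
    have hJI : J ⊆ I := fun s hs => (hsub s hs).1
    by_cases hA : W.A (x s₀) = 0
    · by_cases hE : E = 0
      · subst hE
        have hne' : κ = 1 ∨ L ≠ 0 := by simpa using hne
        -- a motion with `E = 0` does not reach a degenerate horizon
        have hk : deriv W.A (x s₀) ≠ 0 := by
          intro hk
          obtain ⟨s₁, hs₁, -, hA₁⟩ := hmeets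
          have hd : deriv x s₀ = deriv (fun _ => x s₀) s₀ := by
            have h1 := (hR s₀ hJs).energy
            rw [V_eq_zero_of_A_eq_zero hA] at h1
            have h2 := pow_eq_zero_iff two_ne_zero |>.1 (h1.trans (by norm_num))
            rw [deriv_const]
            exact (div_eq_zero_iff.1 h2).resolve_right (W.sigmaP_pos _).ne'
          have hev : x =ᶠ[𝓝 s₀] fun _ => x s₀ := by
            refine RadialAt.eventuallyEq (W := W) (κ := κ) (L := L) (E₁ := 0) (E₂ := 0) ?_
              (Eventually.of_forall (radialAt_const hr hA hk)) rfl hd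
            filter_upwards [isOpen_Ioo.mem_nhds hJs] with u hu using hR u hu
          have := MotionAt.eventuallyEq_of_mem hI hIc.isPreconnected hM
            (fun s _ => Or.inl (radialAt_const hr hA hk s)) hs₀ hev s₁ hs₁
          rw [this.eq_of_nhds] at hA₁
          exact hA₁ hA
        obtain ⟨ε, hε, a, b, h1, h2, h3⟩ := exists_bifurcate_lift hκ hne' hr hA hk isOpen_Ioo hJs hR
          hN' rfl
        exact ⟨W.bifurcate (x s₀), Or.inr (Or.inr (Or.inr ⟨_, hr, hA, hk, rfl⟩)), ε, hε, a, b,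
          h1.trans hJI, h2, h3⟩
      -- on the horizon `x' / σ₊ = ± E`; one of the two signs of `e` is admissible
      · obtain ⟨e, he, hee⟩ : ∃ e : ℝ, (e = 1 ∨ e = -1) ∧
            E - e * (deriv x s₀ / W.sigmaP (x s₀)) ≠ 0 := by
          have h1 := (hR s₀ hJs).energy
          rw [V_eq_zero_of_A_eq_zero hA, sub_zero, sq_eq_sq_iff_eq_or_eq_neg] at h1
          rcases h1 with h1 | h1 <;> rw [h1]
          · exact ⟨-1, Or.inr rfl, fun h => hE (by linarith)⟩
          · exact ⟨1, Or.inl rfl, fun h => hE (by linarith)⟩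
        obtain ⟨ε, hε, w, h1, h2⟩ := exists_eddington_lift he isOpen_Ioo hR hN' hJs hee
        refine ⟨W.eddington e, ?_, ε, hε, w, x, h1.trans hJI, h2, fun _ _ => rfl⟩
        rcases he with rfl | rfl
        · exact Or.inr (Or.inl rfl)
        · exact Or.inr (Or.inr (Or.inl rfl))
    · obtain ⟨ε, hε, t, h1, h2⟩ := exists_static_lift hne isOpen_Ioo hR hN' hJs hA
      exact ⟨W.static, Or.inl rfl, ε, hε, t, x, h1.trans hJI, h2, fun _ _ => rfl⟩
  · have hT := (hM s₀ hs₀).throatAt hr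
    have hm : W.throatMass ≠ 0 := fun h => hT.singular (W.reg_zero_iff.2 h)
    obtain ⟨ε₁, hε₁, h1, h2⟩ := hT.exists_nhds
    -- the denominator is `|x| A`, which tends to `-m₀ ≠ 0` at the throat
    have hev : ∀ᶠ s in 𝓝 s₀, |x s| * W.regA (x s) - W.throatMass ≠ 0 := by
      refine ContinuousAt.eventually_ne ((hT.cont.abs.mul (ContinuousAt.comp (f := x)
        (W.analyticAt_regA _).continuousAt hT.cont)).sub continuousAt_const) ?_
      rw [hT.zero]
      simpa using hm
    obtain ⟨ε, hε, hsub⟩ := exists_Ioo_subset_of_eventually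
      (((show ∀ᶠ s in 𝓝 s₀, s ∈ I from hI.mem_nhds hs₀).and
        (Ioo_mem_nhds (by linarith : s₀ - ε₁ < s₀) (by linarith : s₀ < s₀ + ε₁))).and hev)
    have hs : s₀ ∈ Ioo (s₀ - ε) (s₀ + ε) := ⟨by linarith, by linarith⟩
    have hsub₁ : Ioo (s₀ - ε) (s₀ + ε) ⊆ Ioo (s₀ - ε₁) (s₀ + ε₁) := fun s hs => (hsub s hs).1.2
    obtain ⟨t, -, ht⟩ := exists_throat_time isOpen_Ioo ordConnected_Ioo
      (fun s hs => (hM s (hsub s hs).1.1).continuousAt.continuousWithinAt)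
      (fun s hs => (hsub s hs).2) hs E
    exact ⟨ε, hε, t, fun s hs => (hsub s hs).1.1, isThroatCrossing_of_motion hne hε
      (fun s hs hne => h1 s (hsub₁ hs) hne) (fun s hs => hN s (hsub s hs).1.1) hT.zero hT.cont
      (h2.imp (fun h => h.mono hsub₁) (fun h => h.mono hsub₁)) (fun s hs => (hsub s hs).2) ht⟩

/-! ### Completeness and uniqueness of causal geodesics -/

lemma AngularAt.inner_deriv_eq_zero {x : ℝ → ℝ} {n : ℝ → Vec3} {s : ℝ}
    (h : ∀ᶠ u in 𝓝 s, W.AngularAt L x n u) : inner ℝ (n s) (deriv n s) = 0 := by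
  have h1 := h.self_of_nhds.diff.hasDerivAt.norm_sq
  have h2 : (fun s => ‖n s‖ ^ 2) =ᶠ[𝓝 s] fun _ => 1 := h.mono fun u hu => by
    simp only [hu.unit, one_pow]
  have h3 := h1.unique ((hasDerivAt_const s (1 : ℝ)).congr_of_eventuallyEq h2)
  linarith

lemma eqOn_of_motion {J : Set ℝ} (hJ : IsOpen J) (hJc : IsPreconnected J) {x₁ x₂ : ℝ → ℝ}
    {n₁ n₂ : ℝ → Vec3} (hM₁ : ∀ s ∈ J, W.MotionAt κ E L x₁ s) (hN₁ : ∀ s ∈ J, W.AngularAt L x₁ n₁ s)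
    (hM₂ : ∀ s ∈ J, W.MotionAt κ E L x₂ s) (hN₂ : ∀ s ∈ J, W.AngularAt L x₂ n₂ s) {s₀ : ℝ}
    (hs₀ : s₀ ∈ J) (hx : x₁ =ᶠ[𝓝 s₀] x₂) (hn : n₁ s₀ = n₂ s₀) (hd : deriv n₁ s₀ = deriv n₂ s₀) :
    EqOn x₁ x₂ J ∧ EqOn n₁ n₂ J := by
  have h := MotionAt.eventuallyEq_of_mem hJ hJc hM₁ hM₂ hs₀ hx
  exact ⟨fun s hs => (h s hs).eq_of_nhds, AngularAt.eqOn hJ hJc hN₁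
    (fun s hs => (hN₂ s hs).congr (h s hs) EventuallyEq.rfl) hs₀ hn hd⟩

/-- A local radial motion and initial data for the direction give rise to a complete causal geodesic. -/
lemma exists_isCausalGeodesic_univ (hκ : κ = 0 ∨ κ = 1) (hne : κ = 1 ∨ L ≠ 0 ∨ E ≠ 0) {x : ℝ → ℝ}
    {s₁ ε : ℝ} (hε : 0 < ε) (h : ∀ s ∈ Ioo (s₁ - ε) (s₁ + ε), W.MotionAt κ E L x s)
    {s₂ : ℝ} (hs₂ : s₂ ∈ Ioo (s₁ - ε) (s₁ + ε)) (hr : W.Reg (x s₂)) (hA : W.A (x s₂) ≠ 0)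
    {p v : Vec3} (hp : ‖p‖ = 1)
    (hpv : inner ℝ p v = 0) (hL : W.radius (x s₁) ^ 2 * ‖v‖ = L) :
    ∃ (z : ℝ → ℝ) (n : ℝ → Vec3), W.IsCausalGeodesic κ E univ z n ∧
      (∀ s, W.MotionAt κ E L z s) ∧ (∀ s, W.AngularAt L z n s) ∧
      z =ᶠ[𝓝 s₁] x ∧ n s₁ = p ∧ deriv n s₁ = v := by
  obtain ⟨z, hz, hzx⟩ := exists_motion_univ hκ hne hε h
  have hzc : ContinuousOn z univ := fun s _ => (hz s).continuousAt.continuousWithinAt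
  have hz₂ : z s₂ = x s₂ := (MotionAt.eventuallyEq_of_mem isOpen_Ioo isPreconnected_Ioo
    (fun s _ => hz s) h (s₀ := s₁) ⟨by linarith, by linarith⟩ hzx s₂ hs₂).eq_of_nhds
  obtain ⟨n, h1, h2, h3⟩ := exists_angularAt (W := W) (L := L) isOpen_univ ordConnected_univ hzc
    (mem_univ s₁) hp hpv (by rw [hzx.eq_of_nhds]; exact hL)
  exact ⟨z, n, isCausalGeodesic_of_motion hκ hne isOpen_univ ordConnected_univ
    ⟨s₂, mem_univ _, by rwa [hz₂], by rwa [hz₂]⟩ (fun s _ => hz s) h3, hz,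
    fun s => h3 s (mem_univ _), hzx, h1, h2⟩

theorem exists_complete_geodesic {x₀ t' x' : ℝ} {n₀ n' : Vec3} (hκ : κ = 0 ∨ κ = 1)
    (hr : W.Reg x₀) (hA : W.A x₀ ≠ 0) (hn₀ : ‖n₀‖ = 1) (hnn : inner ℝ n₀ n' = 0)
    (hne : ¬(t' = 0 ∧ x' = 0 ∧ n' = 0))
    (hnorm : -(W.A x₀ / W.sigmaP x₀) * t' ^ 2 + 1 / (W.A x₀ * W.sigmaP x₀) * x' ^ 2
      + W.radius x₀ ^ 2 * ‖n'‖ ^ 2 = -κ) :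
    ∃ (x : ℝ → ℝ) (n : ℝ → Vec3), W.IsCausalGeodesic κ (W.F x₀ * t') univ x n ∧
      x 0 = x₀ ∧ deriv x 0 = x' ∧ n 0 = n₀ ∧ deriv n 0 = n' := by
  have hσ := W.sigmaP_pos x₀
  have hr0 := W.radius_pos x₀
  set L := W.radius x₀ ^ 2 * ‖n'‖ with hL
  -- the norm of the initial velocity is the radial equation
  have hen : (x' / W.sigmaP x₀) ^ 2 = (W.F x₀ * t') ^ 2 - W.V κ L x₀ := by
    have h1 : L ^ 2 / W.radius x₀ ^ 2 = W.radius x₀ ^ 2 * ‖n'‖ ^ 2 := by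
      rw [hL]
      field_simp
    rw [V, F, h1]
    linear_combination (norm := (field_simp; ring)) W.A x₀ / W.sigmaP x₀ * hnorm
  have hF : W.F x₀ ≠ 0 := div_ne_zero hA hσ.ne'
  have hnt : κ = 1 ∨ L ≠ 0 ∨ W.F x₀ * t' ≠ 0 := by
    by_contra hcon
    push Not at hcon
    obtain ⟨h1, h2, h3⟩ := hcon
    obtain rfl : κ = 0 := hκ.resolve_right h1
    rw [h2, h3, V_zero_zero] at hen
    have h4 := pow_eq_zero_iff two_ne_zero |>.1 (hen.trans (by norm_num))
    exact hne ⟨(mul_eq_zero.1 h3).resolve_left hF, (div_eq_zero_iff.1 h4).resolve_right hσ.ne',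
      norm_eq_zero.1 ((mul_eq_zero.1 (hL.symm.trans h2)).resolve_left (pow_pos hr0 2).ne')⟩
  obtain ⟨δ, hδ, U, hU, hsol⟩ := W.exists_radialAt_of_mem_nhds κ L (x' / W.sigmaP x₀) hr
  obtain ⟨z, hz0, hzd, hz⟩ := hsol _ (mem_of_mem_nhds hU) _ hen 0
  simp only at hz0 hzd
  obtain ⟨x, n, h1, -, -, h2, h3, h4⟩ := exists_isCausalGeodesic_univ hκ hnt hδ
    (fun s hs => Or.inl (hz s hs)) (s₂ := 0) ⟨by linarith, by linarith⟩ (by rwa [hz0]) (by rwa [hz0])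
    hn₀ hnn (by rw [hz0])
  refine ⟨x, n, h1, by rw [h2.eq_of_nhds, hz0], ?_, h3, h4⟩
  rw [h2.deriv_eq, hzd]
  field_simp

theorem IsCausalGeodesic.existsUnique_extension {I : Set ℝ} {x : ℝ → ℝ} {n : ℝ → Vec3}
    (h : W.IsCausalGeodesic κ E I x n) : ∃! p : (ℝ → ℝ) × (ℝ → Vec3),
      W.IsCausalGeodesic κ E univ p.1 p.2 ∧ EqOn p.1 x I ∧ EqOn p.2 n I := by
  obtain ⟨L, hne, hM, hN⟩ := h.exists_motion
  obtain ⟨s₁, hs₁, hr₁, hA₁⟩ := h.meets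
  have hI := h.isOpen.mem_nhds hs₁
  obtain ⟨ε, hε, hsub⟩ := exists_Ioo_subset_of_eventually (show ∀ᶠ s in 𝓝 s₁, s ∈ I from hI)
  refine existsUnique_of_exists_of_unique ?_ ?_
  · obtain ⟨z, m, h1, h2, h3, h4, h5, h6⟩ := exists_isCausalGeodesic_univ h.causal hne hε
      (fun s hs => hM s (hsub s hs)) (s₂ := s₁) ⟨by linarith, by linarith⟩ hr₁ hA₁ (hN s₁ hs₁).unit
      (AngularAt.inner_deriv_eq_zero (L := L) (x := x)
        (by filter_upwards [hI] with s hs using hN s hs)) (hN s₁ hs₁).momentum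
    exact ⟨(z, m), h1, eqOn_of_motion h.isOpen h.ordConnected.isPreconnected (fun s _ => h2 s)
      (fun s _ => h3 s) hM hN hs₁ h4 h5 h6⟩
  · rintro ⟨x₁, n₁⟩ ⟨x₂, n₂⟩ ⟨g₁, ex₁, en₁⟩ ⟨g₂, ex₂, en₂⟩
    simp only at ex₁ en₁ ex₂ en₂ g₁ g₂
    have ev : ∀ {β : Type} {f g : ℝ → β}, EqOn f g I → f =ᶠ[𝓝 s₁] g := fun hfg => by
      filter_upwards [hI] with u hu using hfg hu
    -- every extension has the same angular momentum, read off where the curves agree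
    have hL : ∀ (x' : ℝ → ℝ) (n' : ℝ → Vec3), EqOn x' x I → EqOn n' n I →
        W.IsCausalGeodesic κ E univ x' n' →
        (∀ s ∈ univ, W.MotionAt κ E L x' s) ∧ ∀ s ∈ univ, W.AngularAt L x' n' s := by
      intro x' n' hx' hn' hg
      obtain ⟨L', -, hM', hN'⟩ := hg.exists_motion
      have : L' = L := by
        rw [← (hN' s₁ (mem_univ _)).momentum, hx' hs₁, (ev hn').deriv_eq, (hN s₁ hs₁).momentum]
      rw [← this]
      exact ⟨hM', hN'⟩
    obtain ⟨hM₁, hN₁⟩ := hL x₁ n₁ ex₁ en₁ g₁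
    obtain ⟨hM₂, hN₂⟩ := hL x₂ n₂ ex₂ en₂ g₂
    have hn₁₂ := (ev en₁).trans (ev en₂).symm
    obtain ⟨e1, e2⟩ := eqOn_of_motion isOpen_univ isPreconnected_univ hM₁ hN₁ hM₂ hN₂ (mem_univ s₁)
      ((ev ex₁).trans (ev ex₂).symm) hn₁₂.eq_of_nhds hn₁₂.deriv_eq
    exact Prod.ext (funext fun s => e1 (mem_univ s)) (funext fun s => e2 (mem_univ s))

/-! ### Geodesics in a horizon -/

lemma deriv_eq_zero_of_mul_norm_eq_zero {n : ℝ → Vec3} {s x : ℝ}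
    (h : W.radius x ^ 2 * ‖deriv n s‖ = 0) : deriv n s = 0 :=
  norm_eq_zero.1 ((mul_eq_zero.1 h).resolve_left (pow_pos (W.radius_pos x) 2).ne')

lemma eqOn_affine_of_hasDerivAt {E' : Type*} [NormedAddCommGroup E'] [NormedSpace ℝ E'] {f : ℝ → E'}
    {c : E'} {I : Set ℝ} (hI : IsOpen I) (hIc : IsPreconnected I)
    (hf : ∀ s ∈ I, HasDerivAt f c s) {s₁ : ℝ} (hs₁ : s₁ ∈ I) :
    EqOn (fun s => f s₁ + (s - s₁) • c) f I := by
  have hd : ∀ s : ℝ, HasDerivAt (fun s => f s₁ + (s - s₁) • c) c s := fun s => by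
    simpa using (((hasDerivAt_id s).sub_const s₁).smul_const c).const_add (f s₁)
  exact hI.eqOn_of_deriv_eq hIc (fun s _ => (hd s).differentiableAt.differentiableWithinAt)
    (fun s hs => (hf s hs).differentiableAt.differentiableWithinAt)
    (fun s hs => (hd s).deriv.trans (hf s hs).deriv.symm) hs₁ (by simp)

/-- The generators of a non-degenerate horizon: one of the two Kruskal-type coordinates vanishes and the
other one is an affine function of the parameter. -/
lemma isGeodesicOn_bifurcate_generator {h α β : ℝ} (hh : W.Reg h) (hk : deriv W.A h ≠ 0)
    {a b : ℝ → ℝ} {p : Vec3} (hp : ‖p‖ = 1) (ha : ∀ s, HasDerivAt a α s)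
    (hb : ∀ s, HasDerivAt b β s) (hab : ∀ s, a s * b s = 0) (hbα : ∀ s, b s * α = 0)
    (haβ : ∀ s, a s * β = 0) (hαβ : α * β = 0) (h0 : α ≠ 0 ∨ β ≠ 0) :
    W.IsGeodesicOn (W.bifurcate h) 0 0 a b (fun _ => p) univ := by
  have hX : ∀ s, h + a s * b s = h := fun s => by rw [hab, add_zero]
  have hda : ∀ s, deriv a s = α := fun s => (ha s).deriv
  have hdb : ∀ s, deriv b s = β := fun s => (hb s).deriv
  -- the coefficient `qaa` has a factor `V²`
  have hqα : ∀ s, (W.bifurcate h).qaa (a s, b s) * α = 0 := fun s => by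
    rw [bifurcate_qaa]
    simp only
    linear_combination -(b s * (W.slopeA₂ h (h + a s * b s)
      / ((deriv W.A h / 2) ^ 2 * W.sigmaP (h + a s * b s)))) * hbα s
  have hqab : ∀ s, (W.bifurcate h).qab (a s, b s) = 1 / (deriv W.A h / 2 * W.sigmaP h) := fun s => by
    simp only [bifurcate, hX]
  have hqbb : ∀ s, (W.bifurcate h).qbb (a s, b s) = 0 := fun _ => rfl
  refine ⟨fun s _ => ?_, fun _ _ => hp, fun s _ => (ha s).differentiableAt,
    fun s _ => (hb s).differentiableAt, fun _ _ => differentiableAt_const _, fun s _ => ?_,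
    fun s _ => ?_, fun s _ => ?_, fun s _ => ?_, fun s _ => ?_, fun s _ => ?_⟩
  · change W.Reg (h + a s * b s)
    rwa [hX]
  · simp only [hda, hdb, hqα, hqab, deriv_const]
    refine (hasDerivAt_const s _).congr_deriv ?_
    rw [W.pdA_bifurcate_qaa hh hk (by rwa [hX]), pdA_bifurcate_qbb, hαβ, hX, norm_zero]
    linear_combination (b s ^ 2 * α / 2 * ((deriv (W.slopeA₂ h) h * W.sigmaP h
      - W.slopeA₂ h h * deriv W.sigmaP h) / ((deriv W.A h / 2) ^ 2 * W.sigmaP h ^ 2))) * hbα s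
  · simp only [hda, hdb, hqbb, hqab, deriv_const]
    refine (hasDerivAt_const s _).congr_deriv ?_
    rw [W.pdB_bifurcate_qaa hh hk (by rwa [hX]), pdB_bifurcate_qbb, hαβ, hX, norm_zero]
    linear_combination (α * (W.slopeA₂ h h / ((deriv W.A h / 2) ^ 2 * W.sigmaP h))
      + b s * α * a s / 2 * ((deriv (W.slopeA₂ h) h * W.sigmaP h
      - W.slopeA₂ h h * deriv W.sigmaP h) / ((deriv W.A h / 2) ^ 2 * W.sigmaP h ^ 2))) * hbα s
  · simp only [deriv_const, smul_zero, norm_zero]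
    exact (hasDerivAt_const s _).congr_deriv (by simp)
  · rintro ⟨h1, h2, -⟩
    rw [hda] at h1
    rw [hdb] at h2
    exact h0.elim (fun h => h h1) (fun h => h h2)
  · rw [hda, hdb, hqbb, deriv_const, norm_zero]
    linear_combination α * hqα s + 2 * (W.bifurcate h).qab (a s, b s) * hαβ
  · rw [hda, hdb, hqbb]
    simp only [show (W.bifurcate h).Ka (a s, b s) = deriv W.A h / 2 * a s from rfl,
      show (W.bifurcate h).Kb (a s, b s) = -(deriv W.A h / 2 * b s) from rfl]
    linear_combination -(deriv W.A h / 2 * a s) * hqα s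
      - (W.bifurcate h).qab (a s, b s) * (deriv W.A h / 2) * haβ s
      + (W.bifurcate h).qab (a s, b s) * (deriv W.A h / 2) * hbα s

/-- A geodesic in a non-degenerate horizon is a null generator: the radial equation for the constant curve forces
`E = κ = L = 0`, and then `U` and `V` are affine functions of the parameter. -/
lemma IsGeodesicOn.extend_bifurcate_horizon {h : ℝ} (hκ : κ = 0 ∨ κ = 1) (hh : W.Reg h)
    (h0 : W.A h = 0) (hk : deriv W.A h ≠ 0) {I : Set ℝ} (hI : IsOpen I) (hIc : I.OrdConnected)
    (hIn : I.Nonempty) {a b : ℝ → ℝ} {n : ℝ → Vec3}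
    (hg : W.IsGeodesicOn (W.bifurcate h) κ E a b n I) (hX : ∀ s ∈ I, h + a s * b s = h) :
    ∃ (a₁ b₁ : ℝ → ℝ) (n₁ : ℝ → Vec3), W.IsGeodesicOn (W.bifurcate h) κ E a₁ b₁ n₁ univ ∧
      (∀ s, (W.bifurcate h).X (a₁ s, b₁ s) = h) ∧ EqOn a₁ a I ∧ EqOn b₁ b I ∧ EqOn n₁ n I := by
  have hσ := W.sigmaP_pos h
  have hab : ∀ s ∈ I, a s * b s = 0 := fun s hs => by linarith [hX s hs]
  -- the constants of the motion vanish
  have hconst : ∀ s ∈ I, E = 0 ∧ κ = 0 ∧ deriv n s = 0 := by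
    intro s hs
    have hR := (IsGeodesicOn.radialAt_bifurcate hh h0 hk hg hI hs rfl).congr (x₁ := fun _ => h)
      (by filter_upwards [hI.mem_nhds hs] with u hu using (hX u hu).symm)
    generalize hL : W.radius (h + a s * b s) ^ 2 * ‖deriv n s‖ = L at hR
    have h1 := hR.energy
    rw [V_eq_zero_of_A_eq_zero h0, deriv_const, zero_div] at h1
    have h2 := hR.accel
    simp only [deriv_const', zero_div] at h2
    have h3 := h2.unique (hasDerivAt_const s (0 : ℝ))
    rw [W.deriv_V κ L hh, h0] at h3
    -- the vanishing acceleration is a non-zero multiple of `A'(h) (κ + L² / r²)`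
    have h4 : W.massTerm κ L h = 0 := by
      have : W.massTerm κ L h * deriv W.A h = 0 := by
        linear_combination (norm := (field_simp; ring)) -2 * h3
      exact (mul_eq_zero.1 this).resolve_right hk
    have h5 : ¬(κ = 1 ∨ L ≠ 0) := fun h' => (W.massTerm_pos hκ h' h).ne' h4
    push Not at h5
    refine ⟨pow_eq_zero_iff two_ne_zero |>.1 (by linarith), hκ.resolve_right h5.1,
      deriv_eq_zero_of_mul_norm_eq_zero (hL.trans h5.2)⟩
  obtain ⟨s₁, hs₁⟩ := hIn
  obtain ⟨rfl, rfl, -⟩ := hconst s₁ hs₁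
  have hn' : ∀ s ∈ I, deriv n s = 0 := fun s hs => (hconst s hs).2.2
  -- differentiate `U V = 0`; where `V ≠ 0` the function `U` vanishes nearby
  have hba' : ∀ s ∈ I, b s * deriv a s = 0 := by
    intro s hs
    by_cases hb : b s = 0
    · rw [hb, zero_mul]
    · have : a =ᶠ[𝓝 s] fun _ => 0 := by
        filter_upwards [hI.mem_nhds hs, (hg.diff_b s hs).continuousAt.eventually_ne hb] with u hu hbu
        exact (mul_eq_zero.1 (hab u hu)).resolve_right hbu
      rw [this.deriv_eq, deriv_const, mul_zero]
  have hab' : ∀ s ∈ I, a s * deriv b s = 0 := by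
    intro s hs
    have h1 := (hg.diff_a s hs).hasDerivAt.fun_mul (hg.diff_b s hs).hasDerivAt
    have h2 := h1.unique ((hasDerivAt_const s (0 : ℝ)).congr_of_eventuallyEq
      (by filter_upwards [hI.mem_nhds hs] with u hu using hab u hu))
    linarith [hba' s hs]
  have hqa : ∀ s ∈ I, (W.bifurcate h).qaa (a s, b s) * deriv a s = 0 := fun s hs => by
    rw [bifurcate_qaa]
    simp only
    linear_combination -(b s * (W.slopeA₂ h (h + a s * b s)
      / ((deriv W.A h / 2) ^ 2 * W.sigmaP (h + a s * b s)))) * hba' s hs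
  set c := 1 / (deriv W.A h / 2 * W.sigmaP h) with hc
  have hc0 : c ≠ 0 := one_div_ne_zero (mul_ne_zero (div_ne_zero hk two_ne_zero) hσ.ne')
  have hqab : ∀ s ∈ I, (W.bifurcate h).qab (a s, b s) = c := fun s hs => by
    simp only [bifurcate, hX s hs, hc]
  have hqbb : ∀ s, (W.bifurcate h).qbb (a s, b s) = 0 := fun _ => rfl
  have ha'b' : ∀ s ∈ I, deriv a s * deriv b s = 0 := by
    intro s hs
    have h1 := hg.norm_tangent s hs
    rw [hqab s hs, hqbb, hn' s hs, norm_zero] at h1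
    have h2 : c * (deriv a s * deriv b s) = 0 := by
      linear_combination h1 / 2 - deriv a s / 2 * hqa s hs
    exact (mul_eq_zero.1 h2).resolve_left hc0
  -- on the horizon the geodesic equation reduces to `U'' = V'' = 0`
  have hda : ∀ s ∈ I, deriv a s = deriv a s₁ := by
    have hd : ∀ s ∈ I, HasDerivAt (fun s => c * deriv a s) 0 s := by
      intro s hs
      refine ((hg.eqn_b s hs).congr_of_eventuallyEq ?_).congr_deriv ?_
      · filter_upwards [hI.mem_nhds hs] with u hu
        rw [hqab u hu, hqbb, zero_mul, add_zero]
      · rw [W.pdB_bifurcate_qaa hh hk (by rwa [hX s hs]), pdB_bifurcate_qbb, ha'b' s hs, hX s hs,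
          hn' s hs, norm_zero]
        linear_combination -(deriv a s * (W.slopeA₂ h h / ((deriv W.A h / 2) ^ 2 * W.sigmaP h))
          + b s * deriv a s * a s / 2 * ((deriv (W.slopeA₂ h) h * W.sigmaP h
          - W.slopeA₂ h h * deriv W.sigmaP h) / ((deriv W.A h / 2) ^ 2 * W.sigmaP h ^ 2)))
          * hba' s hs
    intro s hs
    exact mul_left_cancel₀ hc0 (hI.is_const_of_deriv_eq_zero hIc.isPreconnected
      (fun s hs => (hd s hs).differentiableAt.differentiableWithinAt)
      (fun s hs => (hd s hs).deriv) hs hs₁)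
  have hdb : ∀ s ∈ I, deriv b s = deriv b s₁ := by
    have hd : ∀ s ∈ I, HasDerivAt (fun s => c * deriv b s) 0 s := by
      intro s hs
      refine ((hg.eqn_a s hs).congr_of_eventuallyEq ?_).congr_deriv ?_
      · filter_upwards [hI.mem_nhds hs] with u hu
        rw [hqab u hu, hqa u hu, zero_add]
      · rw [W.pdA_bifurcate_qaa hh hk (by rwa [hX s hs]), pdA_bifurcate_qbb, ha'b' s hs, hX s hs,
          hn' s hs, norm_zero]
        linear_combination -(b s ^ 2 * deriv a s / 2 * ((deriv (W.slopeA₂ h) h * W.sigmaP h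
          - W.slopeA₂ h h * deriv W.sigmaP h) / ((deriv W.A h / 2) ^ 2 * W.sigmaP h ^ 2)))
          * hba' s hs
    intro s hs
    exact mul_left_cancel₀ hc0 (hI.is_const_of_deriv_eq_zero hIc.isPreconnected
      (fun s hs => (hd s hs).differentiableAt.differentiableWithinAt)
      (fun s hs => (hd s hs).deriv) hs hs₁)
  set α := deriv a s₁
  set β := deriv b s₁
  have hαβ : α * β = 0 := ha'b' s₁ hs₁
  have hnz : α ≠ 0 ∨ β ≠ 0 := by
    by_contra hcon
    push Not at hcon
    exact hg.tangent_ne_zero s₁ hs₁ ⟨hcon.1, hcon.2, hn' s₁ hs₁⟩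
  have hd : ∀ (u γ : ℝ) (s : ℝ), HasDerivAt (fun s => u + (s - s₁) • γ) γ s := fun u γ s => by
    simpa using (((hasDerivAt_id s).sub_const s₁).smul_const γ).const_add u
  have hprod : ∀ s : ℝ, (a s₁ + (s - s₁) • α) * (b s₁ + (s - s₁) • β) = 0 ∧
      (b s₁ + (s - s₁) • β) * α = 0 ∧ (a s₁ + (s - s₁) • α) * β = 0 := by
    intro s
    have e1 := hba' s₁ hs₁
    have e2 := hab' s₁ hs₁
    rcases mul_eq_zero.1 hαβ with h1 | h1
    · have h2 : a s₁ = 0 := (mul_eq_zero.1 e2).resolve_right (hnz.resolve_left fun h => h h1)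
      simp [h1, h2]
    · have h2 : b s₁ = 0 := (mul_eq_zero.1 e1).resolve_right (hnz.resolve_right fun h => h h1)
      simp [h1, h2]
  refine ⟨fun s => a s₁ + (s - s₁) • α, fun s => b s₁ + (s - s₁) • β, fun _ => n s₁,
    isGeodesicOn_bifurcate_generator hh hk (hg.unit s₁ hs₁) (hd _ _) (hd _ _)
      (fun s => (hprod s).1) (fun s => (hprod s).2.1) (fun s => (hprod s).2.2) hαβ hnz, fun s => ?_,
    ?_, ?_, ?_⟩
  · simp only [bifurcate, (hprod s).1, add_zero]
  · exact eqOn_affine_of_hasDerivAt hI hIc.isPreconnected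
      (fun s hs => hda s hs ▸ (hg.diff_a s hs).hasDerivAt) hs₁
  · exact eqOn_affine_of_hasDerivAt hI hIc.isPreconnected
      (fun s hs => hdb s hs ▸ (hg.diff_b s hs).hasDerivAt) hs₁
  · have := eqOn_affine_of_hasDerivAt hI hIc.isPreconnected
      (fun s hs => hn' s hs ▸ (hg.diff_n s hs).hasDerivAt) hs₁
    simpa using this

/-- The generators of a degenerate horizon: the Eddington-Finkelstein coordinate `w` is an affine function
of the parameter. -/
lemma IsGeodesicOn.extend_eddington_horizon {h e : ℝ} (he : e = 1 ∨ e = -1) (hκ : κ = 0 ∨ κ = 1)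
    (hh : W.Reg h) (h0 : W.A h = 0) (hk : deriv W.A h = 0) {I : Set ℝ} (hI : IsOpen I)
    (hIc : I.OrdConnected) (hIn : I.Nonempty) {w x : ℝ → ℝ} {n : ℝ → Vec3}
    (hg : W.IsGeodesicOn (W.eddington e) κ E w x n I) (hX : ∀ s ∈ I, x s = h) :
    ∃ (w₁ x₁ : ℝ → ℝ) (n₁ : ℝ → Vec3), W.IsGeodesicOn (W.eddington e) κ E w₁ x₁ n₁ univ ∧
      (∀ s, (W.eddington e).X (w₁ s, x₁ s) = h) ∧ EqOn w₁ w I ∧ EqOn x₁ x I ∧ EqOn n₁ n I := by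
  have hσ := W.sigmaP_pos h
  have he0 : e ≠ 0 := by rcases he with rfl | rfl <;> norm_num
  have hx' : ∀ s ∈ I, deriv x s = 0 := by
    intro s hs
    have : x =ᶠ[𝓝 s] fun _ => h := by
      filter_upwards [hI.mem_nhds hs] with u hu using hX u hu
    rw [this.deriv_eq, deriv_const]
  -- the constants of the motion vanish
  have hconst : ∀ s ∈ I, E = 0 ∧ κ = 0 ∧ deriv n s = 0 := by
    intro s hs
    have h1 := hg.norm_tangent s hs
    have h2 := hg.energy s hs
    simp only [eddington, hX s hs, hx' s hs, h0] at h1 h2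
    have h3 : W.radius h ^ 2 * ‖deriv n s‖ ^ 2 = -κ := by linear_combination h1
    have h4 : 0 ≤ W.radius h ^ 2 * ‖deriv n s‖ ^ 2 := by positivity
    have h5 : κ = 0 := hκ.resolve_right fun h => by linarith
    refine ⟨by linear_combination -h2, h5, ?_⟩
    rw [h5, neg_zero, mul_eq_zero] at h3
    exact norm_eq_zero.1 (pow_eq_zero_iff two_ne_zero |>.1
      (h3.resolve_left (pow_pos (W.radius_pos h) 2).ne'))
  obtain ⟨s₁, hs₁⟩ := hIn
  obtain ⟨rfl, rfl, -⟩ := hconst s₁ hs₁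
  have hn' : ∀ s ∈ I, deriv n s = 0 := fun s hs => (hconst s hs).2.2
  have hqbb : ∀ p, (W.eddington e).qbb p = 0 := fun _ => rfl
  have hF0 : (deriv W.A h * W.sigmaP h - W.A h * deriv W.sigmaP h) / W.sigmaP h ^ 2 = 0 := by
    rw [h0, hk]
    simp
  -- since `A` has a double zero, the geodesic equation reduces to `w'' = 0`
  have hdw : ∀ s ∈ I, deriv w s = deriv w s₁ := by
    have hd : ∀ s ∈ I, HasDerivAt (fun s => e / W.sigmaP h * deriv w s) 0 s := by
      intro s hs
      refine ((hg.eqn_b s hs).congr_of_eventuallyEq ?_).congr_deriv ?_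
      · filter_upwards [hI.mem_nhds hs] with u hu
        rw [hqbb, zero_mul, add_zero, ← hX u hu]
        rfl
      · rw [W.pdB_eddington_qaa e _ (by rwa [hX s hs]), pdB_eddington_qbb, hX s hs, hF0, hx' s hs,
          hn' s hs, norm_zero]
        ring
    intro s hs
    exact mul_left_cancel₀ (div_ne_zero he0 hσ.ne') (hI.is_const_of_deriv_eq_zero hIc.isPreconnected
      (fun s hs => (hd s hs).differentiableAt.differentiableWithinAt)
      (fun s hs => (hd s hs).deriv) hs hs₁)
  set α := deriv w s₁
  have hα : α ≠ 0 := fun h => hg.tangent_ne_zero s₁ hs₁ ⟨h, hx' s₁ hs₁, hn' s₁ hs₁⟩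
  have hd : ∀ (s : ℝ), HasDerivAt (fun s => w s₁ + (s - s₁) • α) α s := fun s => by
    simpa using (((hasDerivAt_id s).sub_const s₁).smul_const α).const_add (w s₁)
  refine ⟨fun s => w s₁ + (s - s₁) • α, fun _ => h, fun _ => n s₁, ?_, fun _ => rfl, ?_,
    fun s hs => (hX s hs).symm, ?_⟩
  · have hqaa : ∀ u : ℝ, (W.eddington e).qaa (u, h) = 0 := fun u => by simp [eddington, h0]
    refine ⟨fun s _ => hh, fun _ _ => hg.unit s₁ hs₁, fun s _ => (hd s).differentiableAt,
      fun _ _ => differentiableAt_const (c := h), fun _ _ => differentiableAt_const (c := n s₁), fun s _ => ?_,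
      fun s _ => ?_, fun s _ => ?_, fun s _ => ?_, fun s _ => ?_, fun s _ => ?_⟩
    · simp only [hqaa, deriv_const, zero_mul, mul_zero, add_zero]
      refine (hasDerivAt_const s _).congr_deriv ?_
      simp [pdA, eddington]
    · have hdd := fun u => (hd u).deriv
      simp only [hqbb, hdd, deriv_const, mul_zero, add_zero]
      refine (hasDerivAt_const s (e / W.sigmaP h * α)).congr_deriv ?_
      rw [W.pdB_eddington_qaa e _ hh, hF0]
      simp
    · simp only [deriv_const, smul_zero, norm_zero]
      exact (hasDerivAt_const s _).congr_deriv (by simp)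
    · rintro ⟨h1, -, -⟩
      rw [(hd s).deriv] at h1
      exact hα h1
    · simp [hqaa, hqbb]
    · rw [hqaa, hqbb, deriv_const]
      simp [eddington]
  · exact eqOn_affine_of_hasDerivAt hI hIc.isPreconnected
      (fun s hs => hdw s hs ▸ (hg.diff_a s hs).hasDerivAt) hs₁
  · have := eqOn_affine_of_hasDerivAt hI hIc.isPreconnected
      (fun s hs => hn' s hs ▸ (hg.diff_n s hs).hasDerivAt) hs₁
    simpa using this

theorem exists_extension_of_horizon {h : ℝ} {c : Chart} {I : Set ℝ} {a b : ℝ → ℝ} {n : ℝ → Vec3}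
    (hκ : κ = 0 ∨ κ = 1) (hc : W.IsHorizonChart h c) (hI : IsOpen I) (hIc : I.OrdConnected)
    (hIn : I.Nonempty) (hg : W.IsGeodesicOn c κ E a b n I) (hX : ∀ s ∈ I, c.X (a s, b s) = h) :
    ∃ (a₁ b₁ : ℝ → ℝ) (n₁ : ℝ → Vec3), W.IsGeodesicOn c κ E a₁ b₁ n₁ univ ∧
      (∀ s, c.X (a₁ s, b₁ s) = h) ∧ EqOn a₁ a I ∧ EqOn b₁ b I ∧ EqOn n₁ n I := by
  obtain ⟨hh, h0, ⟨hk, rfl⟩ | ⟨hk, rfl | rfl⟩⟩ := hc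
  · exact hg.extend_bifurcate_horizon hκ hh h0 hk hI hIc hIn hX
  · exact hg.extend_eddington_horizon (Or.inl rfl) hκ hh h0 hk hI hIc hIn hX
  · exact hg.extend_eddington_horizon (Or.inr rfl) hκ hh h0 hk hI hIc hIn hX

/-! ### Radial null geodesics -/

lemma rayBranch_eq (W : Geon) (x : ℝ) : W.rayBranch x =
    ordinaryHypergeometric (-1 / 4 : ℝ) (1 / 2) (-1 / 4 + 1) (W.rc ^ 4 / W.radius x ^ 4)
      * W.radius x := by
  rw [rayBranch]
  norm_num

lemma rayBranch_neg (W : Geon) (x : ℝ) : W.rayBranch (-x) = W.rayBranch x := by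
  rw [rayBranch, rayBranch, radius_neg]

lemma continuous_rayBranch (W : Geon) : Continuous W.rayBranch := by
  have hF := continuousOn_hypergeometric (a := -1 / 4) (by norm_num) (by norm_num)
  have hz : Continuous fun x => W.rc ^ 4 / W.radius x ^ 4 :=
    continuous_const.div (W.continuous_radius.pow 4) fun x => (pow_pos (W.radius_pos x) 4).ne'
  have hmem : ∀ x, W.rc ^ 4 / W.radius x ^ 4 ∈ Icc (0 : ℝ) 1 := fun x => by
    have h1 := W.radius_pos x
    have h2 := W.rc_pos
    refine ⟨by positivity, (div_le_one (by positivity)).2 ?_⟩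
    exact pow_le_pow_left₀ h2.le (W.rc_le_radius x) 4
  rw [show W.rayBranch = _ from funext W.rayBranch_eq]
  exact (hF.comp_continuous hz hmem).mul W.continuous_radius

/-- The differential equation of the hypergeometric function, `f + (z / a) f' = 1 / √(1 - z)`, amounts to
`d(r f) / dx = 1 / σ₊`. -/
lemma hasDerivAt_rayBranch (W : Geon) {x : ℝ} (hx : 0 < x) :
    HasDerivAt W.rayBranch (1 / W.sigmaP x) x := by
  have hr := W.radius_pos x
  have hc := W.rc_pos
  have hσ := W.sigmaP_pos x
  have hlt := W.rc_lt_radius hx.ne'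
  have hz1 : W.rc ^ 4 / W.radius x ^ 4 < 1 :=
    (div_lt_one (by positivity)).2 (pow_lt_pow_left₀ hlt hc.le four_ne_zero)
  have hz0 : 0 < W.rc ^ 4 / W.radius x ^ 4 := by positivity
  obtain ⟨d, hd, he⟩ := hasDerivAt_hypergeometric (a := -1 / 4) (by norm_num) (by norm_num)
    (z := W.rc ^ 4 / W.radius x ^ 4) (by rw [abs_of_pos hz0]; exact hz1)
  have h1 := W.hasDerivAt_radius x
  have h2 := (hasDerivAt_const x (W.rc ^ 4)).fun_div (h1.fun_pow 4) (pow_pos hr 4).ne'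
  have h3 := (HasDerivAt.comp x hd h2).fun_mul h1
  rw [show W.rayBranch = _ from funext W.rayBranch_eq]
  refine h3.congr_deriv ?_
  simp only [Function.comp_apply]
  have hx1 := W.eq_radius_mul_sqrt hx.le
  have hs : 0 < √(1 - W.rc ^ 4 / W.radius x ^ 4) := Real.sqrt_pos.2 (by linarith)
  generalize ordinaryHypergeometric (-1 / 4 : ℝ) (1 / 2) (-1 / 4 + 1)
    (W.rc ^ 4 / W.radius x ^ 4) = f at he ⊢
  generalize √(1 - W.rc ^ 4 / W.radius x ^ 4) = q at *
  have h5 : f = 1 / q + 4 * (W.rc ^ 4 / W.radius x ^ 4) * d := by linear_combination he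
  generalize W.radius x = r at *
  rw [h5, hx1]
  push_cast
  field_simp
  ring

lemma continuous_rayParam (W : Geon) : Continuous W.rayParam := by
  refine Continuous.if_le W.continuous_rayBranch (continuous_const.sub W.continuous_rayBranch)
    continuous_const continuous_id ?_
  rintro x rfl
  have h : W.rayBranch 0 = ordinaryHypergeometric (-1 / 4 : ℝ) (1 / 2) (3 / 4) (1 : ℝ) * W.rc := by
    rw [rayBranch, radius_zero, div_self (pow_pos W.rc_pos 4).ne']
  rw [h]
  ring

lemma hasDerivAt_rayParam (W : Geon) (x : ℝ) : HasDerivAt W.rayParam (1 / W.sigmaP x) x := by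
  have hne : ∀ x ≠ 0, HasDerivAt W.rayParam (1 / W.sigmaP x) x := by
    intro x hx
    rcases hx.lt_or_gt with h | h
    · have h1 := (W.hasDerivAt_rayBranch (neg_pos.2 h)).comp x (hasDerivAt_neg x)
      have h2 : HasDerivAt W.rayBranch (-(1 / W.sigmaP x)) x := by
        refine (h1.congr_of_eventuallyEq ?_).congr_deriv (by rw [sigmaP_neg]; ring)
        exact Eventually.of_forall fun u => (W.rayBranch_neg u).symm
      refine ((h2.const_sub (2 * (ordinaryHypergeometric (-1 / 4 : ℝ) (1 / 2) (3 / 4) (1 : ℝ)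
        * W.rc))).congr_of_eventuallyEq ?_).congr_deriv (neg_neg _)
      filter_upwards [isOpen_Iio.mem_nhds h] with u hu
      rw [rayParam, if_neg (not_le.2 hu)]
    · refine (W.hasDerivAt_rayBranch h).congr_of_eventuallyEq ?_
      filter_upwards [isOpen_Ioi.mem_nhds h] with u hu
      rw [rayParam, if_pos (le_of_lt hu)]
  rcases eq_or_ne x 0 with rfl | hx
  -- the formulas for the two sides join differentiably, since `1 / σ₊` is continuous at the throat
  · refine hasDerivAt_of_tendsto_nhdsNE (g := fun x => 1 / W.sigmaP x) ?_
      W.continuous_rayParam.continuousAt ?_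
    · filter_upwards [self_mem_nhdsWithin] with u hu using hne u hu
    · exact ((continuous_const.div W.continuous_sigmaP
        fun x => (W.sigmaP_pos x).ne').tendsto 0).mono_left nhdsWithin_le_nhds
  · exact hne x hx

lemma strictMono_rayParam (W : Geon) : StrictMono W.rayParam :=
  strictMono_of_deriv_pos fun x => by
    rw [(W.hasDerivAt_rayParam x).deriv]
    exact one_div_pos.2 (W.sigmaP_pos x)

lemma deriv_V_zero_zero (W : Geon) (x : ℝ) : deriv (W.V 0 0) x = 0 := by
  rw [show W.V 0 0 = fun _ => 0 from funext W.V_zero_zero, deriv_const]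

/-- For a radial null geodesic `x' / σ₊ = ± E` is constant, and `1 / σ₊` is the derivative of `rayParam`. -/
lemma RadialAt.exists_rayParam_eq {x : ℝ → ℝ} {a b : ℝ} (hab : a < b)
    (h : ∀ s ∈ Ioo a b, W.RadialAt 0 E 0 x s) : ∃ e c : ℝ, (e = 1 ∨ e = -1) ∧
      ∀ s ∈ Ioo a b, W.rayParam (x s) = e * E * s + c := by
  have hm : (a + b) / 2 ∈ Ioo a b := ⟨by linarith, by linarith⟩
  set y : ℝ → ℝ := fun s => deriv x s / W.sigmaP (x s) with hy
  have hyc : ∀ s ∈ Ioo a b, y s = y ((a + b) / 2) := fun s hs => by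
    have hd : ∀ s ∈ Ioo a b, HasDerivAt y 0 s := fun s hs =>
      (h s hs).accel.congr_deriv (by rw [deriv_V_zero_zero]; simp)
    exact isOpen_Ioo.is_const_of_deriv_eq_zero isPreconnected_Ioo
      (fun s hs => (hd s hs).differentiableAt.differentiableWithinAt)
      (fun s hs => (hd s hs).deriv) hs hm
  have hen := (h _ hm).energy
  rw [V_zero_zero, sub_zero, sq_eq_sq_iff_eq_or_eq_neg] at hen
  obtain ⟨e, he, hye⟩ : ∃ e : ℝ, (e = 1 ∨ e = -1) ∧ y ((a + b) / 2) = e * E := by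
    rcases hen with h | h
    · exact ⟨1, Or.inl rfl, by rw [one_mul]; exact h⟩
    · exact ⟨-1, Or.inr rfl, by rw [neg_one_mul]; exact h⟩
  have hd : ∀ s ∈ Ioo a b, HasDerivAt (fun s => W.rayParam (x s) - e * E * s) 0 s := by
    intro s hs
    have h1 := ((W.hasDerivAt_rayParam (x s)).comp s (h s hs).diff.hasDerivAt).fun_sub
      ((hasDerivAt_id s).const_mul (e * E))
    refine h1.congr_deriv ?_
    rw [← hye, ← hyc s hs]
    simp only [hy]
    ring
  obtain ⟨c, hc⟩ := isOpen_Ioo.exists_is_const_of_deriv_eq_zero isPreconnected_Ioo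
    (fun s hs => (hd s hs).differentiableAt.differentiableWithinAt) (fun s hs => (hd s hs).deriv)
  exact ⟨e, c, he, fun s hs => by linarith [hc s hs]⟩

/-- The formula for a radial null geodesic continues through a singular throat: `x` is continuous and monotone
there. -/
lemma MotionAt.eventually_rayParam_eq {x : ℝ → ℝ} {I : Set ℝ} (hI : IsOpen I)
    (h : ∀ s ∈ I, W.MotionAt 0 E 0 x s) {s₀ : ℝ} (hs₀ : s₀ ∈ I) : ∃ e c : ℝ, (e = 1 ∨ e = -1) ∧
      ∀ᶠ s in 𝓝 s₀, W.rayParam (x s) = e * E * s + c := by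
  by_cases hr : W.Reg (x s₀)
  · obtain ⟨ε, hε, hsub⟩ := exists_Ioo_subset_of_eventually
      ((show ∀ᶠ s in 𝓝 s₀, s ∈ I from hI.mem_nhds hs₀).and
        ((h s₀ hs₀).continuousAt.preimage_mem_nhds (W.isOpen_setOf_reg.mem_nhds hr)))
    obtain ⟨e, c, he, hc⟩ := RadialAt.exists_rayParam_eq (by linarith : s₀ - ε < s₀ + ε)
      (fun s hs => (h s (hsub s hs).1).radialAt (hsub s hs).2)
    refine ⟨e, c, he, ?_⟩
    filter_upwards [Ioo_mem_nhds (by linarith : s₀ - ε < s₀) (by linarith : s₀ < s₀ + ε)] with s hs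
      using hc s hs
  · have hT := (h s₀ hs₀).throatAt hr
    obtain ⟨ε, hε, h1, h2⟩ := hT.exists_nhds
    obtain ⟨e₁, c₁, he₁, hc₁⟩ := RadialAt.exists_rayParam_eq (by linarith : s₀ - ε < s₀)
      (fun s hs => h1 s ⟨hs.1, by linarith [hs.2]⟩ hs.2.ne)
    obtain ⟨e₂, c₂, he₂, hc₂⟩ := RadialAt.exists_rayParam_eq (by linarith : s₀ < s₀ + ε)
      (fun s hs => h1 s ⟨by linarith [hs.1], hs.2⟩ hs.1.ne')
    have hcont : ContinuousAt (fun s => W.rayParam (x s)) s₀ :=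
      W.continuous_rayParam.continuousAt.comp hT.cont
    have lin : ∀ e c : ℝ, ContinuousAt (fun s => e * E * s + c) s₀ := fun e c => by fun_prop
    have l₁ : W.rayParam (x s₀) = e₁ * E * s₀ + c₁ := by
      refine hcont.eq_of_frequently_eq (lin e₁ c₁)
        (Frequently.filter_mono (Eventually.frequently ?_) (nhdsWithin_le_nhds (s := Iio s₀)))
      filter_upwards [Ioo_mem_nhdsLT (by linarith : s₀ - ε < s₀)] with s hs using hc₁ s hs
    have l₂ : W.rayParam (x s₀) = e₂ * E * s₀ + c₂ := by
      refine hcont.eq_of_frequently_eq (lin e₂ c₂)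
        (Frequently.filter_mono (Eventually.frequently ?_) (nhdsWithin_le_nhds (s := Ioi s₀)))
      filter_upwards [Ioo_mem_nhdsGT (by linarith : s₀ < s₀ + ε)] with s hs using hc₂ s hs
    have hmL : s₀ - ε / 2 ∈ Ioo (s₀ - ε) s₀ := ⟨by linarith, by linarith⟩
    have hmR : s₀ + ε / 2 ∈ Ioo s₀ (s₀ + ε) := ⟨by linarith, by linarith⟩
    have hmL' : s₀ - ε / 2 ∈ Ioo (s₀ - ε) (s₀ + ε) := ⟨by linarith, by linarith⟩
    have hmR' : s₀ + ε / 2 ∈ Ioo (s₀ - ε) (s₀ + ε) := ⟨by linarith, by linarith⟩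
    have hm0 : s₀ ∈ Ioo (s₀ - ε) (s₀ + ε) := ⟨by linarith, by linarith⟩
    have d₁ := hc₁ _ hmL
    have d₂ := hc₂ _ hmR
    -- the signs agree since `x` is monotone
    have hsign : 0 < (e₁ * E) * (e₂ * E) := by
      rcases h2 with m | m
      · have a1 := W.strictMono_rayParam (m hmL' hm0 (by linarith))
        have a2 := W.strictMono_rayParam (m hm0 hmR' (by linarith))
        exact mul_pos (by nlinarith) (by nlinarith)
      · have a1 := W.strictMono_rayParam (m hmL' hm0 (by linarith))
        have a2 := W.strictMono_rayParam (m hm0 hmR' (by linarith))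
        exact mul_pos_of_neg_of_neg (by nlinarith) (by nlinarith)
    have hee : e₁ = e₂ := by
      rcases he₁ with rfl | rfl <;> rcases he₂ with rfl | rfl <;> first | rfl | (exfalso; nlinarith [sq_nonneg E])
    subst hee
    have hcc : c₁ = c₂ := by linarith
    subst hcc
    refine ⟨e₁, c₁, he₁, ?_⟩
    filter_upwards [Ioo_mem_nhds (by linarith : s₀ - ε < s₀) (by linarith : s₀ < s₀ + ε)] with s hs
    rcases lt_trichotomy s s₀ with hlt | rfl | hlt
    · exact hc₁ s ⟨hs.1, hlt⟩
    · exact l₁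
    · exact hc₂ s ⟨hlt, hs.2⟩

/-- A radial null geodesic in terms of hypergeometric functions. -/
theorem MotionAt.exists_rayParam_eq {x : ℝ → ℝ} {I : Set ℝ} (hI : IsOpen I) (hIc : IsPreconnected I)
    (hE : E ≠ 0) (h : ∀ s ∈ I, W.MotionAt 0 E 0 x s) {s₀ : ℝ} (hs₀ : s₀ ∈ I) :
    ∃ e s₁ : ℝ, (e = 1 ∨ e = -1) ∧ ∀ s ∈ I, e * E * (s - s₁) = W.rayParam (x s) := by
  obtain ⟨e, c, he, hc⟩ := MotionAt.eventually_rayParam_eq hI h hs₀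
  have key : ∀ s ∈ I, (fun s => W.rayParam (x s)) =ᶠ[𝓝 s] fun s => e * E * s + c := by
    refine eqOn_of_eventuallyEq_of_frequently hIc hs₀ hc fun s hs hfr => ?_
    obtain ⟨e', c', -, hc'⟩ := MotionAt.eventually_rayParam_eq hI h hs
    obtain ⟨u, hu1, hu2⟩ := (hfr.and_eventually hc'.eventually_nhds).exists
    have h1 : (fun s => e * E * s + c) =ᶠ[𝓝 u] fun s => e' * E * s + c' := hu1.symm.trans hu2
    have hd : ∀ m k : ℝ, deriv (fun s => m * s + k) u = m := fun m k => by simp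
    have h2 := h1.deriv_eq
    rw [hd, hd] at h2
    have h3 := h1.eq_of_nhds
    rw [h2] at h3
    have h4 : c = c' := by linarith
    rw [h2, h4]
    exact hc'
  have he0 : e ≠ 0 := by rcases he with rfl | rfl <;> norm_num
  refine ⟨e, -c / (e * E), he, fun s hs => ?_⟩
  rw [(key s hs).eq_of_nhds]
  field_simp
  ring

theorem strictMono_or_strictAnti_of_rayParam {x : ℝ → ℝ} {e s₁ : ℝ} (he : e = 1 ∨ e = -1) (hE : E ≠ 0)
    (h : ∀ s, e * E * (s - s₁) = W.rayParam (x s)) :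
    (StrictMono x ∨ StrictAnti x) ∧ Function.Surjective x := by
  have he0 : e * E ≠ 0 := mul_ne_zero (by rcases he with rfl | rfl <;> norm_num) hE
  -- `rayParam` is injective, so that `x` takes the value `ξ` at the parameter where the left side is `rayParam ξ`
  refine ⟨?_, fun ξ => ⟨s₁ + W.rayParam ξ / (e * E), W.strictMono_rayParam.injective ?_⟩⟩
  · rcases he0.lt_or_gt with h0 | h0
    · refine Or.inr fun u v huv => W.strictMono_rayParam.lt_iff_lt.1 ?_
      rw [← h, ← h]
      exact mul_lt_mul_of_neg_left (by linarith) h0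
    · refine Or.inl fun u v huv => W.strictMono_rayParam.lt_iff_lt.1 ?_
      rw [← h, ← h]
      exact mul_lt_mul_of_pos_left (by linarith) h0
  · rw [← h, add_sub_cancel_left, mul_div_cancel₀ _ he0]

/-! ### Repulsion from the throat in the Reissner-Nordström-like case -/

/-- Since `V` tends to `+∞` at the throat, `E² - V ≥ 0` keeps a motion away from it. -/
theorem exists_le_abs_of_motion (hm : W.throatMass < 0) (hκ : κ = 0 ∨ κ = 1) (hne : κ = 1 ∨ L ≠ 0)
    {x : ℝ → ℝ} {I : Set ℝ} (h : ∀ s ∈ I, W.MotionAt κ E L x s) :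
    ∃ ε > 0, (∀ ξ, 0 < |ξ| → |ξ| < ε → E ^ 2 < W.V κ L ξ) ∧ ∀ s ∈ I, ε ≤ |x s| := by
  obtain ⟨ε, hε, hb⟩ := Metric.eventually_nhds_iff_ball.1 (eventually_nhdsWithin_iff.1
    ((tendsto_V_atTop hm hκ hne).eventually_gt_atTop (E ^ 2)))
  have hV : ∀ ξ, 0 < |ξ| → |ξ| < ε → E ^ 2 < W.V κ L ξ := fun ξ h1 h2 =>
    hb ξ (by simpa using h2) (abs_pos.1 h1)
  have hsing : ¬W.Reg 0 := by
    rw [reg_zero_iff]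
    exact hm.ne
  have hrad : ∀ s, W.RadialAt κ E L x s → ε ≤ |x s| := by
    intro s hs
    by_contra hlt
    have h1 : x s ≠ 0 := fun h0 => hsing (h0 ▸ hs.reg)
    have h2 := hV _ (abs_pos.2 h1) (not_le.1 hlt)
    have h3 := hs.energy
    have h4 := sq_nonneg (deriv x s / W.sigmaP (x s))
    linarith
  refine ⟨ε, hε, hV, fun s hs => ?_⟩
  rcases h s hs with hR | hT
  · exact hrad s hR
  · exfalso
    -- a crossing of the throat would violate the bound at neighbouring parameters
    obtain ⟨δ, hδ, h1, -⟩ := hT.exists_nhds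
    have h2 : ∀ᶠ u in 𝓝 s, |x u| < ε := by
      have := hT.cont.abs.tendsto
      simp only [hT.zero, abs_zero] at this
      exact this.eventually (gt_mem_nhds hε)
    obtain ⟨u, ⟨hu1, hu2⟩, hu3⟩ := ((((h2.and (Ioo_mem_nhds (by linarith : s - δ < s)
      (by linarith : s < s + δ)))).filter_mono (nhdsWithin_le_nhds (s := Ioi s))).and
      self_mem_nhdsWithin).exists
    exact absurd (hrad u (h1 u hu2 (ne_of_gt hu3))) (not_le.2 hu1)

/-! ### Crossing of the throat in the Schwarzschild-like and smooth cases -/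

/-- `A = 1 - 2 M / x`, with the mass function increasing and concave, and non-negative at the throat. -/
lemma A_le_A (hm : 0 ≤ W.throatMass) {x y : ℝ} (hx : 0 < x) (hxy : x ≤ y) : W.A x ≤ W.A y := by
  rcases hxy.eq_or_lt with rfl | hlt
  · exact le_rfl
  have hy : 0 < y := hx.trans hlt
  have hA : ∀ u, 0 < u → W.A u = 1 - (W.chargeMass u + W.throatMass) / u := by
    intro u hu
    rw [A_eq, regA, dslope_of_ne _ hu.ne', slope_def_field, chargeMass_zero, abs_of_pos hu]
    ring
  have hc := W.rq_pos
  have hN : Continuous W.chargeMass := continuous_iff_continuousAt.2 fun u =>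
    (W.hasDerivAt_chargeMass u).continuousAt
  have hq : ∀ u v, 0 ≤ u → u ≤ v → W.rq ^ 2 / W.radius v ^ 2 ≤ W.rq ^ 2 / W.radius u ^ 2 := by
    intro u v hu huv
    have h1 := W.radius_pos u
    have h2 := W.radius_le_of_abs_le (x := u) (y := v)
      (by rw [abs_of_nonneg hu, abs_of_nonneg (hu.trans huv)]; exact huv)
    gcongr
  -- concavity of `chargeMass`, by the mean value theorem on `[0, x]` and on `[x, y]`
  obtain ⟨c₁, hc₁, e₁⟩ := exists_hasDerivAt_eq_slope W.chargeMass _ hx hN.continuousOn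
    (fun u _ => W.hasDerivAt_chargeMass u)
  obtain ⟨c₂, hc₂, e₂⟩ := exists_hasDerivAt_eq_slope W.chargeMass _ hlt hN.continuousOn
    (fun u _ => W.hasDerivAt_chargeMass u)
  have q₁ := hq c₁ x hc₁.1.le hc₁.2.le
  have q₂ := hq x c₂ hx.le hc₂.1.le
  rw [chargeMass_zero, sub_zero, sub_zero] at e₁
  have b₁ : W.rq ^ 2 / W.radius x ^ 2 * x ≤ W.chargeMass x := by
    rw [e₁, le_div_iff₀ hx] at q₁
    exact q₁
  have b₂ : W.chargeMass y - W.chargeMass x ≤ W.rq ^ 2 / W.radius x ^ 2 * (y - x) := by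
    rw [e₂, div_le_iff₀ (by linarith)] at q₂
    exact q₂
  rw [hA x hx, hA y hy]
  have : (W.chargeMass y + W.throatMass) / y ≤ (W.chargeMass x + W.throatMass) / x := by
    rw [div_le_div_iff₀ hy hx]
    nlinarith [mul_le_mul_of_nonneg_left b₂ hx.le,
      mul_le_mul_of_nonneg_left b₁ (by linarith : (0 : ℝ) ≤ y - x)]
  linarith

lemma massTerm_le_massTerm (κ L : ℝ) {x y : ℝ} (hx : 0 ≤ x) (hxy : x ≤ y) :
    W.massTerm κ L y ≤ W.massTerm κ L x := by
  have h1 := W.radius_pos x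
  have h2 := W.radius_le_of_abs_le (x := x) (y := y)
    (by rw [abs_of_nonneg hx, abs_of_nonneg (hx.trans hxy)]; exact hxy)
  simp only [massTerm]
  gcongr

/-- A geodesic moving towards the throat that is radial, or not outside of the horizon, has no potential
barrier ahead. -/
lemma exists_barrier_lt (hm : 0 ≤ W.throatMass) (hκ : κ = 0 ∨ κ = 1)
    (hne : κ = 1 ∨ L ≠ 0 ∨ E ≠ 0) {x : ℝ → ℝ} {s : ℝ} (h : W.RadialAt κ E L x s) (hx : 0 < x s)
    (hd : deriv x s < 0) (hc : L = 0 ∨ W.A (x s) ≤ 0) :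
    ∃ η < E ^ 2, ∀ ξ ∈ Ioc 0 (x s), W.V κ L ξ ≤ η := by
  have hσ := W.sigmaP_pos (x s)
  have hy : 0 < (deriv x s / W.sigmaP (x s)) ^ 2 :=
    sq_pos_of_ne_zero (div_ne_zero hd.ne hσ.ne')
  have hlt : W.V κ L (x s) < E ^ 2 := by linarith [h.energy]
  by_cases hA : W.A (x s) ≤ 0
  -- inside the horizon `A` decreases and the mass term increases towards the throat, and `1 / σ₊ ≥ 1 / 2`
  · have hV0 : ∀ ξ ∈ Ioc 0 (x s), W.V κ L ξ ≤ W.A (x s) * W.massTerm κ L (x s) / 2 := by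
      intro ξ hξ
      have h1 := A_le_A hm hξ.1 hξ.2
      have h2 := massTerm_le_massTerm (W := W) κ L hξ.1.le hξ.2
      have h3 : 0 ≤ W.massTerm κ L (x s) :=
        W.massTerm_nonneg (by rcases hκ with rfl | rfl <;> norm_num) L _
      have h4 : W.A ξ * W.massTerm κ L ξ ≤ W.A (x s) * W.massTerm κ L (x s) := by nlinarith
      have h5 := W.sigmaP_pos ξ
      have h6 := W.sigmaP_le_two ξ
      have h7 : W.A (x s) * W.massTerm κ L (x s) ≤ 0 := mul_nonpos_of_nonpos_of_nonneg hA h3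
      have h8 : W.V κ L ξ = W.A ξ * W.massTerm κ L ξ / W.sigmaP ξ := by
        rw [V_eq, F]
        ring
      rw [h8, div_le_div_iff₀ h5 two_pos]
      nlinarith
    refine ⟨_, ?_, hV0⟩
    have h3 : 0 ≤ W.massTerm κ L (x s) :=
      W.massTerm_nonneg (by rcases hκ with rfl | rfl <;> norm_num) L _
    have h7 : W.A (x s) * W.massTerm κ L (x s) ≤ 0 := mul_nonpos_of_nonpos_of_nonneg hA h3
    by_cases hE : E = 0
    · subst hE
      have h8 : W.V κ L (x s) = W.A (x s) * W.massTerm κ L (x s) / W.sigmaP (x s) := by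
        rw [V_eq, F]
        ring
      rw [h8, div_lt_iff₀ hσ] at hlt
      nlinarith
    · have : 0 < E ^ 2 := by positivity
      linarith
  · have hL : L = 0 := hc.resolve_right hA
    subst hL
    refine ⟨_, hlt, fun ξ hξ => ?_⟩
    rcases hκ with rfl | rfl
    · rw [V_zero_zero, V_zero_zero]
    · have hV : ∀ u, W.V 1 0 u = W.A u / W.sigmaP u := fun u => by simp [V, F]
      have h1 := A_le_A hm hξ.1 hξ.2
      have h5 := W.sigmaP_pos ξ
      have h6 := W.sigmaP_le_of_abs_le (x := ξ) (y := x s)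
        (by rw [abs_of_pos hξ.1, abs_of_pos hx]; exact hξ.2)
      rw [hV, hV, div_le_div_iff₀ h5 hσ]
      push Not at hA
      by_cases hAξ : W.A ξ ≤ 0
      · nlinarith
      · nlinarith

/-- If the potential ahead is bounded by some `η < E²`, the radial velocity keeps its sign. -/
lemma deriv_neg_of_barrier {x : ℝ → ℝ} {s₁ b η : ℝ} (h : ∀ s ∈ Icc s₁ b, W.RadialAt κ E L x s)
    (hpos : ∀ s ∈ Icc s₁ b, 0 < x s) (hd : deriv x s₁ < 0) (hη : η < E ^ 2)
    (hV : ∀ ξ ∈ Ioc 0 (x s₁), W.V κ L ξ ≤ η) : ∀ s ∈ Icc s₁ b, deriv x s < 0 := by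
  have hxc : ContinuousOn x (Icc s₁ b) := fun s hs => (h s hs).diff.continuousAt.continuousWithinAt
  have hdc : ∀ s ∈ Icc s₁ b, ContinuousAt (deriv x) s := by
    intro s hs
    have h1 := (h s hs).accel.continuousAt.mul
      (W.continuous_sigmaP.continuousAt.comp (h s hs).diff.continuousAt)
    refine h1.congr (Eventually.of_forall fun u => ?_)
    exact div_mul_cancel₀ _ (W.sigmaP_pos _).ne'
  by_contra! hcon
  obtain ⟨s, hs, hs0⟩ := hcon
  -- at the first zero of the velocity the potential would be equal to `E²`
  set Z := Icc s₁ b ∩ deriv x ⁻¹' Ici 0 with hZ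
  have hZc : IsClosed Z := ContinuousOn.preimage_isClosed_of_isClosed
    (fun u hu => (hdc u hu).continuousWithinAt) isClosed_Icc isClosed_Ici
  have hZb : BddBelow Z := ⟨s₁, fun u hu => hu.1.1⟩
  have hZn : Z.Nonempty := ⟨s, hs, hs0⟩
  have hm := hZc.csInf_mem hZn hZb
  set m := sInf Z
  have hlt : ∀ u, s₁ ≤ u → u < m → deriv x u < 0 := by
    intro u hu hum
    by_contra! h0
    exact absurd (csInf_le hZb (⟨⟨hu, hum.le.trans hm.1.2⟩, h0⟩ : u ∈ Z)) (not_le.2 hum)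
  have hs₁m : s₁ < m := lt_of_le_of_ne hm.1.1 fun h0 => by
    have h1 : 0 ≤ deriv x m := hm.2
    rw [← h0] at h1
    linarith
  have hsub : Icc s₁ m ⊆ Icc s₁ b := Icc_subset_Icc_right hm.1.2
  have hanti : StrictAntiOn x (Icc s₁ m) := by
    refine strictAntiOn_of_deriv_neg (convex_Icc _ _) (hxc.mono hsub) fun u hu => ?_
    rw [interior_Icc] at hu
    exact hlt u hu.1.le hu.2
  have hxm : x m ≤ x s₁ := (hanti ⟨le_rfl, hs₁m.le⟩ ⟨hs₁m.le, le_rfl⟩ hs₁m).le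
  have hzero : deriv x m = 0 := by
    refine le_antisymm ?_ hm.2
    refine le_of_tendsto ((hdc m hm.1).tendsto.mono_left (nhdsWithin_le_nhds (s := Iio m))) ?_
    filter_upwards [Ioo_mem_nhdsLT hs₁m] with u hu using (hlt u hu.1.le hu.2).le
  have hen := (h m hm.1).energy
  rw [hzero] at hen
  have := hV _ ⟨hpos m hm.1, hxm⟩
  norm_num at hen
  linarith

/-- An infalling geodesic without a potential barrier ahead has its speed bounded from below, so that it reaches the
throat in finite time, and it passes through the throat monotonically. -/
theorem exists_crossing_of_barrier {x : ℝ → ℝ} (h : ∀ s, W.MotionAt κ E L x s) {s₁ η : ℝ}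
    (hx : 0 < x s₁) (hd : deriv x s₁ < 0) (hη : η < E ^ 2)
    (hV : ∀ ξ ∈ Ioc 0 (x s₁), W.V κ L ξ ≤ η) :
    ∃ s₂ > s₁, x s₂ = 0 ∧ StrictAntiOn x (Icc s₁ s₂) ∧
      ∃ ε > 0, ∀ s ∈ Ioo s₂ (s₂ + ε), x s < 0 := by
  have hxc : Continuous x := continuous_iff_continuousAt.2 fun s => (h s).continuousAt
  have hrad : ∀ s, 0 < x s → W.RadialAt κ E L x s := fun s hs => (h s).radialAt (Or.inl hs.ne')
  set c := √(E ^ 2 - η) with hc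
  have hc0 : 0 < c := Real.sqrt_pos.2 (by linarith)
  have hc2 : c ^ 2 = E ^ 2 - η := Real.sq_sqrt (by linarith)
  have hneg : ∀ b, (∀ s ∈ Icc s₁ b, 0 < x s) → ∀ s ∈ Icc s₁ b, deriv x s < 0 := fun b hb =>
    deriv_neg_of_barrier (fun s hs => hrad s (hb s hs)) hb hd hη hV
  have hspeed : ∀ b, (∀ s ∈ Icc s₁ b, 0 < x s) → ∀ s ∈ Icc s₁ b, deriv x s ≤ -c := by
    intro b hb s hs
    have hanti : StrictAntiOn x (Icc s₁ b) := by
      refine strictAntiOn_of_deriv_neg (convex_Icc _ _) hxc.continuousOn fun u hu => ?_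
      exact hneg b hb u (interior_subset hu)
    have hxs : x s ≤ x s₁ := hanti.antitoneOn ⟨le_rfl, hs.1.trans hs.2⟩ hs hs.1
    have h1 := hneg b hb s hs
    have h2 := (hrad s (hb s hs)).energy
    have h3 := hV _ ⟨hb s hs, hxs⟩
    have h4 := W.one_le_sigmaP (x s)
    have h5 : c ^ 2 ≤ (-(deriv x s / W.sigmaP (x s))) ^ 2 := by
      rw [neg_sq, h2, hc2]
      linarith
    have h6 : 0 ≤ -(deriv x s / W.sigmaP (x s)) := by
      rw [← neg_div]
      exact div_nonneg (by linarith) (by linarith)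
    have h7 := (pow_le_pow_iff_left₀ hc0.le h6 two_ne_zero).1 h5
    rw [← neg_div, le_div_iff₀ (by linarith)] at h7
    nlinarith
  -- the throat is reached after the time `x s₁ / c`
  obtain ⟨b, hb, hxb⟩ : ∃ b ≥ s₁, x b ≤ 0 := by
    by_contra! hcon
    set b := s₁ + x s₁ / c with hb
    have hsb : s₁ < b := by
      have : 0 < x s₁ / c := div_pos hx hc0
      linarith
    have hpos : ∀ s ∈ Icc s₁ b, 0 < x s := fun s hs => hcon s hs.1
    have h1 := (convex_Icc s₁ b).image_sub_le_mul_sub_of_deriv_le hxc.continuousOn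
      (fun u hu => (hrad u (hpos u (interior_subset hu))).diff.differentiableWithinAt)
      (C := -c) (fun u hu => hspeed b hpos u (interior_subset hu))
      s₁ ⟨le_rfl, hsb.le⟩ b ⟨hsb.le, le_rfl⟩ hsb.le
    have h2 : -c * (b - s₁) = -x s₁ := by
      rw [hb]
      field_simp
      ring
    have h3 := hpos b ⟨hsb.le, le_rfl⟩
    linarith
  -- the first parameter at which the throat is reached
  set Z := Ici s₁ ∩ x ⁻¹' Iic 0 with hZ
  have hZc : IsClosed Z := isClosed_Ici.inter (isClosed_Iic.preimage hxc)
  have hZb : BddBelow Z := ⟨s₁, fun u hu => hu.1⟩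
  have hm := hZc.csInf_mem ⟨b, hb, hxb⟩ hZb
  set s₂ := sInf Z
  have hpos : ∀ u, s₁ ≤ u → u < s₂ → 0 < x u := by
    intro u hu hus
    by_contra! h0
    exact absurd (csInf_le hZb (⟨hu, h0⟩ : u ∈ Z)) (not_le.2 hus)
  have hs₁₂ : s₁ < s₂ := lt_of_le_of_ne hm.1 fun h0 => by
    have h1 : x s₂ ≤ 0 := hm.2
    rw [← h0] at h1
    linarith
  have hz : x s₂ = 0 := by
    refine le_antisymm hm.2 ?_
    refine ge_of_tendsto ((hxc.tendsto s₂).mono_left (nhdsWithin_le_nhds (s := Iio s₂))) ?_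
    filter_upwards [Ioo_mem_nhdsLT hs₁₂] with u hu using (hpos u hu.1.le hu.2).le
  have hsp : ∀ s ∈ Ico s₁ s₂, deriv x s ≤ -c := fun s hs =>
    hspeed s (fun u hu => hpos u hu.1 (hu.2.trans_lt hs.2)) s ⟨hs.1, le_rfl⟩
  refine ⟨s₂, hs₁₂, hz, ?_, ?_⟩
  · refine strictAntiOn_of_deriv_neg (convex_Icc _ _) hxc.continuousOn fun u hu => ?_
    rw [interior_Icc] at hu
    linarith [hsp u ⟨hu.1.le, hu.2⟩]
  · have hfin : ∃ ε > 0, StrictAntiOn x (Ioo (s₂ - ε) (s₂ + ε)) := by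
      -- a regular throat is crossed with non-zero velocity, a singular one monotonically by definition
      rcases h s₂ with hR | hT
      · have hdc : ContinuousAt (deriv x) s₂ := by
          have h1 := hR.accel.continuousAt.mul
            (W.continuous_sigmaP.continuousAt.comp hR.diff.continuousAt)
          refine h1.congr (Eventually.of_forall fun u => ?_)
          exact div_mul_cancel₀ _ (W.sigmaP_pos _).ne'
        have hd2 : deriv x s₂ ≤ -c := by
          refine le_of_tendsto (hdc.tendsto.mono_left (nhdsWithin_le_nhds (s := Iio s₂))) ?_
          filter_upwards [Ioo_mem_nhdsLT hs₁₂] with u hu using hsp u ⟨hu.1.le, hu.2⟩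
        obtain ⟨ε, hε, hsub⟩ := exists_Ioo_subset_of_eventually
          (hdc.eventually (gt_mem_nhds (by linarith : deriv x s₂ < 0)))
        refine ⟨ε, hε, strictAntiOn_of_deriv_neg (convex_Ioo _ _) hxc.continuousOn fun u hu => ?_⟩
        exact hsub u (interior_subset hu)
      · obtain ⟨ε, hε, -, m | m⟩ := hT.exists_nhds
        · exfalso
          obtain ⟨u, hu1, hu2⟩ := ((show ∀ᶠ u in 𝓝[<] s₂, u ∈ Ioo s₁ s₂ from
            Ioo_mem_nhdsLT hs₁₂).and (show ∀ᶠ u in 𝓝[<] s₂, u ∈ Ioo (s₂ - ε) s₂ from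
              Ioo_mem_nhdsLT (by linarith))).exists
          have := m (⟨hu2.1, by linarith [hu2.2]⟩ : u ∈ Ioo (s₂ - ε) (s₂ + ε))
            (⟨by linarith, by linarith⟩ : s₂ ∈ Ioo (s₂ - ε) (s₂ + ε)) hu1.2
          linarith [hpos u hu1.1.le hu1.2]
        · exact ⟨ε, hε, m⟩
    obtain ⟨ε, hε, m⟩ := hfin
    refine ⟨ε, hε, fun s hs => ?_⟩
    have := m (⟨by linarith, by linarith⟩ : s₂ ∈ Ioo (s₂ - ε) (s₂ + ε))
      (⟨by linarith [hs.1], hs.2⟩ : s ∈ Ioo (s₂ - ε) (s₂ + ε)) hs.1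
    linarith

/-! ### Extension of a geodesic through a singular throat -/

/-- A geodesic in the coordinates `(t, x)` that tends to a singular throat has no turning point: either
`V` is `0` and `E ≠ 0`, or `A` tends to `-∞` at the throat and cannot have changed its sign on the way, so
that `V < 0`. -/
lemma IsGeodesicOn.deriv_x_ne_zero_of_tendsto (hm : W.throatMass ≠ 0) (hκ : κ = 0 ∨ κ = 1)
    {t x : ℝ → ℝ} {n : ℝ → Vec3} {s₀ ε : ℝ} (hε : 0 < ε)
    (h : W.IsGeodesicOn W.static κ E t x n (Ioo (s₀ - ε) s₀))
    (hR : ∀ s ∈ Ioo (s₀ - ε) s₀, W.RadialAt κ E L x s) (hne : κ = 1 ∨ L ≠ 0 ∨ E ≠ 0)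
    (hx : ∀ s ∈ Ioo (s₀ - ε) s₀, 0 < x s) (lim : Tendsto x (𝓝[<] s₀) (𝓝 0)) :
    ∀ s ∈ Ioo (s₀ - ε) s₀, deriv x s ≠ 0 := by
  have hJ : ∀ᶠ s in 𝓝[<] s₀, s ∈ Ioo (s₀ - ε) s₀ := Ioo_mem_nhdsLT (by linarith)
  have lim' : Tendsto x (𝓝[<] s₀) (𝓝[≠] 0) :=
    tendsto_nhdsWithin_iff.2 ⟨lim, hJ.mono fun s hs => (hx s hs).ne'⟩
  suffices hpos : ∀ s ∈ Ioo (s₀ - ε) s₀, 0 < E ^ 2 - W.V κ L (x s) by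
    intro s hs h0
    have h1 := (hR s hs).energy
    rw [h0, zero_div] at h1
    have := hpos s hs
    rw [← h1] at this
    simp at this
  by_cases hκL : κ = 1 ∨ L ≠ 0
  · rcases hm.lt_or_gt with hm | hm
    · exfalso
      obtain ⟨s, hs, hV⟩ := (hJ.and
        ((tendsto_V_atTop hm hκ hκL).comp lim' |>.eventually_gt_atTop (E ^ 2))).exists
      have h1 := (hR s hs).energy
      have h2 := sq_nonneg (deriv x s / W.sigmaP (x s))
      simp only [Function.comp_apply] at hV
      linarith
    · obtain ⟨u, hu, hA⟩ := (hJ.and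
        ((tendsto_A_atBot hm).comp lim' |>.eventually_lt_atBot 0)).exists
      intro s hs
      have hcont : ContinuousOn (fun s => W.A (x s)) (Ioo (s₀ - ε) s₀) := fun v hv =>
        ((W.analyticAt_A (hR v hv).reg).continuousAt.comp
          (hR v hv).diff.continuousAt).continuousWithinAt
      have hAs : W.A (x s) < 0 := by
        by_contra! hge
        obtain ⟨v, hv, hv0⟩ :=
          isPreconnected_Ioo.intermediate_value hu hs hcont ⟨le_of_lt hA, hge⟩
        exact (h.mem v hv).2 hv0
      have h1 := W.V_eq_A_mul κ L (x s)
      have h2 : 0 < W.massTerm κ L (x s) / W.sigmaP (x s) :=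
        div_pos (W.massTerm_pos hκ hκL _) (W.sigmaP_pos _)
      have h3 := mul_neg_of_neg_of_pos hAs h2
      nlinarith [sq_nonneg E]
  · push Not at hκL
    have hκ0 : κ = 0 := hκ.resolve_right hκL.1
    have hE : E ≠ 0 := (hne.resolve_left hκL.1).resolve_left (not_not.2 hκL.2)
    intro s _
    rw [hκ0, hκL.2, V_zero_zero, sub_zero]
    positivity

/-- The continuation is the image of the geodesic under the point reflection at the throat; the angles and the
time are integrals along it. -/
theorem IsGeodesicOn.exists_throatCrossing (hm : W.throatMass ≠ 0) (hκ : κ = 0 ∨ κ = 1)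
    {t x : ℝ → ℝ} {n : ℝ → Vec3} {s₀ ε : ℝ} (hε : 0 < ε)
    (h : W.IsGeodesicOn W.static κ E t x n (Ioo (s₀ - ε) s₀))
    (hx : ∀ s ∈ Ioo (s₀ - ε) s₀, 0 < x s) (lim : Tendsto x (𝓝[<] s₀) (𝓝 0)) :
    ∃ (t₁ x₁ : ℝ → ℝ) (n₁ : ℝ → Vec3), W.IsThroatCrossing κ E t₁ x₁ n₁ s₀ ε ∧
      EqOn t₁ t (Ioo (s₀ - ε) s₀) ∧ EqOn x₁ x (Ioo (s₀ - ε) s₀) ∧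
      EqOn n₁ n (Ioo (s₀ - ε) s₀) ∧ ∀ s ∈ Ioo s₀ (s₀ + ε), x₁ s < 0 := by
  set J := Ioo (s₀ - ε) s₀ with hJdef
  set K := Ioo (s₀ - ε) (s₀ + ε) with hKdef
  have hJo : IsOpen J := isOpen_Ioo
  have hJc : IsPreconnected J := isPreconnected_Ioo
  have hJK : J ⊆ K := Ioo_subset_Ioo_right (by linarith)
  obtain ⟨s₁, hs₁⟩ : J.Nonempty := nonempty_Ioo.2 (by linarith)
  obtain ⟨L, hL⟩ : ∃ L, W.radius (x s₁) ^ 2 * ‖deriv n s₁‖ = L := ⟨_, rfl⟩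
  have hmom : ∀ s ∈ J, W.radius (x s) ^ 2 * ‖deriv n s‖ = L := fun s hs =>
    (h.momentum_eq hJo hJc hs hs₁).trans hL
  have hR : ∀ s ∈ J, W.RadialAt κ E L x s := fun s hs => h.radialAt_static hJo hs (hmom s hs)
  have hN : ∀ s ∈ J, W.AngularAt L x n s := fun s hs =>
    h.angularAt hs EventuallyEq.rfl (hmom s hs)
  have hne : κ = 1 ∨ L ≠ 0 ∨ E ≠ 0 := h.nontrivial (Or.inl rfl) hJo hs₁ hL (h.mem s₁ hs₁).2 hκ
  have hd := h.deriv_x_ne_zero_of_tendsto hm hκ hε hR hne hx lim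
  have hanti : StrictAntiOn x J := by
    refine (MotionAt.strictMonoOn_or_strictAntiOn (by linarith) (fun s hs => Or.inl (hR s hs))
      fun s hs _ => hd s hs).resolve_left fun hmono => ?_
    -- an increasing `x` would stay above a positive value and not tend to `0`
    have h1 : ∀ᶠ s in 𝓝[<] s₀, x s₁ ≤ x s := by
      filter_upwards [Ioo_mem_nhdsLT hs₁.2] with s hs
      exact (hmono hs₁ ⟨hs₁.1.trans hs.1, hs.2⟩ hs.1).le
    exact absurd (ge_of_tendsto lim h1) (not_le.2 (hx s₁ hs₁))
  obtain ⟨z, hz1, hz2, hz3, hz4, hz5, hz6⟩ := exists_reflection (x := fun s => -x s) hε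
    (fun s hs => (hR s hs).neg) hanti.neg (by simpa using lim.neg)
  set x₁ : ℝ → ℝ := fun s => -z s with hx₁
  have hx₁J : EqOn x₁ x J := fun s hs => by
    simp only [hx₁, hz1 (show s ∈ Iio s₀ from hs.2), neg_neg]
  have hx₁r : ∀ s, s₀ < s → x₁ s = -x (2 * s₀ - s) := fun s hs => by
    simp only [hx₁, hz4 s hs, neg_neg]
  have hx₁0 : x₁ s₀ = 0 := by simp only [hx₁, hz2, neg_zero]
  have hx₁c : ContinuousAt x₁ s₀ := hz3.neg
  have hx₁R : ∀ s ∈ K, s ≠ s₀ → W.RadialAt κ E L x₁ s := fun s hs h0 => (hz5 s hs h0).neg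
  have hx₁m : StrictAntiOn x₁ K := hz6.neg
  have hcont : ContinuousOn x₁ K := by
    intro s hs
    rcases eq_or_ne s s₀ with rfl | h0
    · exact hx₁c.continuousWithinAt
    · exact (hx₁R s hs h0).diff.continuousAt.continuousWithinAt
  have hAJ : ∀ s ∈ J, |x s| * W.regA (x s) - W.throatMass ≠ 0 := fun s hs => by
    rw [← W.abs_mul_A_eq (hx s hs).ne']
    exact mul_ne_zero (abs_ne_zero.2 (hx s hs).ne') (h.mem s hs).2
  have hA : ∀ s ∈ K, |x₁ s| * W.regA (x₁ s) - W.throatMass ≠ 0 := by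
    intro s hs
    rcases lt_trichotomy s s₀ with h0 | rfl | h0
    · rw [hx₁J ⟨hs.1, h0⟩]
      exact hAJ s ⟨hs.1, h0⟩
    · simpa [hx₁0] using hm
    · rw [hx₁r s h0, abs_neg, regA_neg]
      exact hAJ _ ⟨by linarith [hs.2], by linarith⟩
  have hgerm : ∀ s ∈ J, x₁ =ᶠ[𝓝 s] x := fun s hs => hx₁J.eventuallyEq_of_mem (hJo.mem_nhds hs)
  obtain ⟨n₁, hn1, hn2, hn3⟩ := exists_angularAt (W := W) (L := L) (J := K) isOpen_Ioo
    ordConnected_Ioo hcont (hJK hs₁) (hN s₁ hs₁).unit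
    (AngularAt.inner_deriv_eq_zero (Filter.eventually_of_mem (hJo.mem_nhds hs₁) hN))
    (by rw [hx₁J hs₁, hL])
  have hn₁J : EqOn n₁ n J := AngularAt.eqOn hJo hJc (fun s hs => hn3 s (hJK hs))
    (fun s hs => (hN s hs).congr (hgerm s hs) EventuallyEq.rfl) hs₁ hn1 hn2
  obtain ⟨t₀, ht0, htd⟩ := exists_throat_time isOpen_Ioo ordConnected_Ioo hcont hA (hJK hs₁) E
  have htd' : ∀ s ∈ K, HasDerivAt (fun s => t s₁ + t₀ s)
      (E * W.sigmaP (x₁ s) * |x₁ s| / (|x₁ s| * W.regA (x₁ s) - W.throatMass)) s :=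
    fun s hs => (htd s hs).const_add _
  refine ⟨fun s => t s₁ + t₀ s, x₁, n₁, isThroatCrossing_of_motion hne hε hx₁R hn3 hx₁0 hx₁c
    (Or.inr hx₁m) hA htd', ?_, hx₁J, hn₁J, fun s hs => ?_⟩
  · refine hJo.eqOn_of_deriv_eq hJc (fun s hs => (htd' s (hJK hs)).differentiableAt.differentiableWithinAt)
      (fun s hs => (h.diff_a s hs).differentiableWithinAt) (fun s hs => ?_) hs₁ (by simp [ht0])
    rw [(htd' s (hJK hs)).deriv, h.deriv_t hs, hx₁J hs, ← W.abs_mul_A_eq (hx s hs).ne']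
    have h1 := abs_ne_zero.2 (hx s hs).ne'
    have h2 := (h.mem s hs).2
    simp only at h2
    field_simp
  · have := hx₁m (⟨by linarith, by linarith⟩ : s₀ ∈ K) (⟨by linarith [hs.1], hs.2⟩ : s ∈ K) hs.1
    rwa [hx₁0] at this

/-- Functions that agree before `s₀`, are continuous at `s₀` and have the same derivative after `s₀` agree. -/
lemma eqOn_Ioo_of_eqOn_Ioo_left {f g : ℝ → ℝ} {s₀ ε : ℝ} (hε : 0 < ε)
    (hl : EqOn f g (Ioo (s₀ - ε) s₀)) (hf : ContinuousAt f s₀) (hg : ContinuousAt g s₀)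
    (hfd : ∀ s ∈ Ioo s₀ (s₀ + ε), DifferentiableAt ℝ f s)
    (hgd : ∀ s ∈ Ioo s₀ (s₀ + ε), DifferentiableAt ℝ g s)
    (hd : ∀ s ∈ Ioo s₀ (s₀ + ε), deriv f s = deriv g s) :
    EqOn f g (Ioo (s₀ - ε) (s₀ + ε)) := by
  have h0 : f s₀ = g s₀ := by
    refine hf.eq_of_frequently_eq hg ?_
    have h1 : ∀ᶠ s in 𝓝[<] s₀, f s = g s :=
      (show ∀ᶠ s in 𝓝[<] s₀, s ∈ Ioo (s₀ - ε) s₀ from Ioo_mem_nhdsLT (by linarith)).mono hl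
    exact h1.frequently.filter_mono nhdsWithin_le_nhds
  intro s hs
  rcases lt_trichotomy s s₀ with h | rfl | h
  · exact hl ⟨hs.1, h⟩
  · exact h0
  · have hsub : ∀ u ∈ Ioc s₀ s, u ∈ Ioo s₀ (s₀ + ε) := fun u hu => ⟨hu.1, hu.2.trans_lt hs.2⟩
    obtain ⟨c, hc, hc'⟩ := exists_deriv_eq_slope (fun u => f u - g u) h (fun u hu => by
      rcases hu.1.eq_or_lt with rfl | hlt
      · exact (hf.sub hg).continuousWithinAt
      · have hu' := hsub u ⟨hlt, hu.2⟩
        exact ((hfd u hu').continuousAt.sub (hgd u hu').continuousAt).continuousWithinAt)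
      (fun u hu => ((hfd u (hsub u ⟨hu.1, hu.2.le⟩)).sub
        (hgd u (hsub u ⟨hu.1, hu.2.le⟩))).differentiableWithinAt)
    have hcs := hsub c ⟨hc.1, hc.2.le⟩
    rw [deriv_fun_sub (hfd c hcs) (hgd c hcs), hd c hcs, sub_self, eq_comm, div_eq_zero_iff,
      or_iff_left (sub_pos.2 h).ne'] at hc'
    linarith

/-- The part before the throat determines `E` and `L`, and these the continuation. -/
theorem IsThroatCrossing.eqOn (hm : W.throatMass ≠ 0) {E₁ E₂ : ℝ} {t₁ t₂ x₁ x₂ : ℝ → ℝ}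
    {n₁ n₂ : ℝ → Vec3} {s₀ ε : ℝ} (h₁ : W.IsThroatCrossing κ E₁ t₁ x₁ n₁ s₀ ε)
    (h₂ : W.IsThroatCrossing κ E₂ t₂ x₂ n₂ s₀ ε) (ht : EqOn t₁ t₂ (Ioo (s₀ - ε) s₀))
    (hx : EqOn x₁ x₂ (Ioo (s₀ - ε) s₀)) (hn : EqOn n₁ n₂ (Ioo (s₀ - ε) s₀))
    (hpos : ∀ s ∈ Ioo (s₀ - ε) s₀, 0 < x₁ s) :
    EqOn t₁ t₂ (Ioo (s₀ - ε) (s₀ + ε)) ∧ EqOn x₁ x₂ (Ioo (s₀ - ε) (s₀ + ε)) ∧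
      EqOn n₁ n₂ (Ioo (s₀ - ε) (s₀ + ε)) := by
  have hε := h₁.pos
  have hsing : ¬W.Reg 0 := fun h => hm (W.reg_zero_iff.1 h)
  set J := Ioo (s₀ - ε) s₀ with hJdef
  set K := Ioo (s₀ - ε) (s₀ + ε) with hKdef
  have hJo : IsOpen J := isOpen_Ioo
  have hJK : J ⊆ K := Ioo_subset_Ioo_right (by linarith)
  have hs₀ : s₀ ∈ K := ⟨by linarith, by linarith⟩
  obtain ⟨s₁, hs₁⟩ : J.Nonempty := nonempty_Ioo.2 (by linarith)
  obtain ⟨L₁, R₁, N₁, T₁, gl₁, gr₁⟩ := h₁.exists_motion hsing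
  obtain ⟨L₂, R₂, N₂, T₂, gl₂, gr₂⟩ := h₂.exists_motion hsing
  have hng : n₁ =ᶠ[𝓝 s₁] n₂ := hn.eventuallyEq_of_mem (hJo.mem_nhds hs₁)
  have htg : t₁ =ᶠ[𝓝 s₁] t₂ := ht.eventuallyEq_of_mem (hJo.mem_nhds hs₁)
  have hE : E₁ = E₂ := by
    rw [← gl₁.F_mul_deriv_t hs₁, ← gl₂.F_mul_deriv_t hs₁, hx hs₁, htg.deriv_eq]
  have hL : L₁ = L₂ := by
    rw [← (N₁ s₁ (hJK hs₁)).momentum, ← (N₂ s₁ (hJK hs₁)).momentum, hx hs₁, hng.deriv_eq]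
  subst hE hL
  -- an increasing curve could not come from `x > 0`
  have hanti : ∀ y : ℝ → ℝ, y s₀ = 0 → 0 < y s₁ → (StrictMonoOn y K ∨ StrictAntiOn y K) →
      StrictAntiOn y K := fun y hy0 hy1 h => h.resolve_left fun hmono => by
    have := hmono (hJK hs₁) hs₀ hs₁.2
    linarith
  have hxK : EqOn x₁ x₂ K := eqOn_of_strictAntiOn hε R₁ R₂
    (hanti x₁ h₁.zero (hpos s₁ hs₁) h₁.crosses)
    (hanti x₂ h₂.zero (hx hs₁ ▸ hpos s₁ hs₁) h₂.crosses) h₁.zero h₂.zero h₁.cont_x h₂.cont_x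
  have hRK : Ioo s₀ (s₀ + ε) ⊆ K := Ioo_subset_Ioo_left (by linarith)
  refine ⟨eqOn_Ioo_of_eqOn_Ioo_left hε ht h₁.cont_t h₂.cont_t gr₁.diff_a gr₂.diff_a fun s hs => ?_,
    hxK, AngularAt.eqOn_of_eventuallyEq isOpen_Ioo isPreconnected_Ioo N₁ (fun s hs =>
      (N₂ s hs).congr (hxK.eventuallyEq_of_mem (isOpen_Ioo.mem_nhds hs)) EventuallyEq.rfl)
      (hJK hs₁) hng⟩
  rw [gr₁.deriv_t hs, gr₂.deriv_t hs, hxK (hRK hs)]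

end Geon

end

theorem mainTheorem3 (W : Geon) :
    -- through every causal initial condition there is a complete geodesic
    (∀ (κ x₀ t' x' : ℝ) (n₀ n' : Vec3), (κ = 0 ∨ κ = 1) → W.Reg x₀ → W.A x₀ ≠ 0 →
      ‖n₀‖ = 1 → inner ℝ n₀ n' = 0 → ¬(t' = 0 ∧ x' = 0 ∧ n' = 0) →
      -(W.A x₀ / W.sigmaP x₀) * t' ^ 2 + 1 / (W.A x₀ * W.sigmaP x₀) * x' ^ 2
        + W.radius x₀ ^ 2 * ‖n'‖ ^ 2 = -κ →
      ∃ (x : ℝ → ℝ) (n : ℝ → Vec3), W.IsCausalGeodesic κ (W.F x₀ * t') univ x n ∧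
        x 0 = x₀ ∧ deriv x 0 = x' ∧ n 0 = n₀ ∧ deriv n 0 = n') ∧
    -- every causal geodesic extends, in exactly one way, to all values of the affine parameter
    (∀ (κ E : ℝ) (I : Set ℝ) (x : ℝ → ℝ) (n : ℝ → Vec3), W.IsCausalGeodesic κ E I x n →
      ∃! p : (ℝ → ℝ) × (ℝ → Vec3),
        W.IsCausalGeodesic κ E univ p.1 p.2 ∧ EqOn p.1 x I ∧ EqOn p.2 n I) ∧
    -- the causal geodesics that lie in a horizon are complete as well
    (∀ (κ E h : ℝ) (c : Chart) (I : Set ℝ) (a b : ℝ → ℝ) (n : ℝ → Vec3),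
      (κ = 0 ∨ κ = 1) → W.IsHorizonChart h c → IsOpen I → I.OrdConnected → I.Nonempty →
      W.IsGeodesicOn c κ E a b n I → (∀ s ∈ I, c.X (a s, b s) = h) →
      ∃ (a₁ b₁ : ℝ → ℝ) (n₁ : ℝ → Vec3), W.IsGeodesicOn c κ E a₁ b₁ n₁ univ ∧
        (∀ s, c.X (a₁ s, b₁ s) = h) ∧ EqOn a₁ a I ∧ EqOn b₁ b I ∧ EqOn n₁ n I) ∧
    -- the behaviour at the throat
    (∀ (κ E : ℝ) (I : Set ℝ) (x : ℝ → ℝ) (n : ℝ → Vec3), W.IsCausalGeodesic κ E I x n →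
      ∃ L : ℝ, 0 ≤ L ∧
        -- conservation of angular momentum, and the radial equation
        (∀ s ∈ I, W.radius (x s) ^ 2 * ‖deriv n s‖ = L) ∧
        (∀ s ∈ I, W.Reg (x s) →
          (deriv x s / W.sigmaP (x s)) ^ 2 = E ^ 2 - W.V κ L (x s)) ∧
        -- radial null geodesics
        (κ = 0 → L = 0 → E ≠ 0 ∧
          (∃ e s₁ : ℝ, (e = 1 ∨ e = -1) ∧ ∀ s ∈ I, e * E * (s - s₁) = W.rayParam (x s)) ∧
          (I = univ → (StrictMono x ∨ StrictAnti x) ∧ Function.Surjective x)) ∧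
        -- Reissner-Nordström-like case
        (deltaC < W.delta1 → (κ = 1 ∨ L ≠ 0) →
          Tendsto (W.V κ L) (𝓝[≠] 0) atTop ∧
          ∃ ε > 0, (∀ ξ, 0 < |ξ| → |ξ| < ε → E ^ 2 < W.V κ L ξ) ∧ ∀ s ∈ I, ε ≤ |x s|) ∧
        -- Schwarzschild-like and smooth cases
        (W.delta1 ≤ deltaC → I = univ → ∀ s₁, 0 < x s₁ → deriv x s₁ < 0 →
          (L = 0 ∨ W.A (x s₁) ≤ 0 ∨ ∃ η < E ^ 2, ∀ ξ ∈ Ioc 0 (x s₁), W.V κ L ξ ≤ η) →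
          ∃ s₂ > s₁, x s₂ = 0 ∧ StrictAntiOn x (Icc s₁ s₂) ∧
            ∃ ε > 0, ∀ s ∈ Ioo s₂ (s₂ + ε), x s < 0)) ∧
    -- unique extension through a singular throat, including the time coordinate
    (W.delta1 ≠ deltaC → ∀ (κ E s₀ ε : ℝ) (t x : ℝ → ℝ) (n : ℝ → Vec3),
      (κ = 0 ∨ κ = 1) → 0 < ε → W.IsGeodesicOn W.static κ E t x n (Ioo (s₀ - ε) s₀) →
      (∀ s ∈ Ioo (s₀ - ε) s₀, 0 < x s) → Tendsto x (𝓝[<] s₀) (𝓝 0) →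
      (∃ (t₁ x₁ : ℝ → ℝ) (n₁ : ℝ → Vec3), W.IsThroatCrossing κ E t₁ x₁ n₁ s₀ ε ∧
        EqOn t₁ t (Ioo (s₀ - ε) s₀) ∧ EqOn x₁ x (Ioo (s₀ - ε) s₀) ∧
        EqOn n₁ n (Ioo (s₀ - ε) s₀) ∧ ∀ s ∈ Ioo s₀ (s₀ + ε), x₁ s < 0) ∧
      (∀ (E₁ E₂ : ℝ) (t₁ t₂ x₁ x₂ : ℝ → ℝ) (n₁ n₂ : ℝ → Vec3),
        W.IsThroatCrossing κ E₁ t₁ x₁ n₁ s₀ ε → W.IsThroatCrossing κ E₂ t₂ x₂ n₂ s₀ ε →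
        EqOn t₁ t (Ioo (s₀ - ε) s₀) → EqOn x₁ x (Ioo (s₀ - ε) s₀) →
        EqOn n₁ n (Ioo (s₀ - ε) s₀) → EqOn t₂ t (Ioo (s₀ - ε) s₀) →
        EqOn x₂ x (Ioo (s₀ - ε) s₀) → EqOn n₂ n (Ioo (s₀ - ε) s₀) →
        EqOn t₁ t₂ (Ioo (s₀ - ε) (s₀ + ε)) ∧ EqOn x₁ x₂ (Ioo (s₀ - ε) (s₀ + ε)) ∧
        EqOn n₁ n₂ (Ioo (s₀ - ε) (s₀ + ε)))) := by
  refine ⟨fun κ x₀ t' x' n₀ n' hκ hr hA hn₀ hnn hne hnorm =>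
      Geon.exists_complete_geodesic hκ hr hA hn₀ hnn hne hnorm,
    fun κ E I x n h => h.existsUnique_extension,
    fun κ E h c I a b n hκ hc hI hIc hIn hg hX =>
      Geon.exists_extension_of_horizon hκ hc hI hIc hIn hg hX,
    fun κ E I x n h => ?_, fun hne κ E s₀ ε t x n hκ hε hg hx lim => ?_⟩
  · obtain ⟨L, hnt, hM, hN⟩ := h.exists_motion
    obtain ⟨s₀, hs₀, -⟩ := h.meets
    have hIc : IsPreconnected I := h.ordConnected.isPreconnected
    refine ⟨L, (hN s₀ hs₀).nonneg, fun s hs => (hN s hs).momentum,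
      fun s hs hr => ((hM s hs).radialAt hr).energy, fun hκ hL => ?_, fun hδ hne => ?_,
      fun hδ hI s₁ hx hd hc => ?_⟩
    · subst hκ hL
      have hE : E ≠ 0 := by simpa using hnt
      refine ⟨hE, Geon.MotionAt.exists_rayParam_eq h.isOpen hIc hE hM hs₀, fun hI => ?_⟩
      obtain ⟨e, s₁, he, heq⟩ := Geon.MotionAt.exists_rayParam_eq h.isOpen hIc hE hM hs₀
      exact Geon.strictMono_or_strictAnti_of_rayParam he hE fun s => heq s (hI ▸ mem_univ s)
    · have hm := W.throatMass_neg_iff.2 hδ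
      exact ⟨Geon.tendsto_V_atTop hm h.causal hne, Geon.exists_le_abs_of_motion hm h.causal hne hM⟩
    · subst hI
      have hR := (hM s₁ (mem_univ _)).radialAt (Or.inl hx.ne')
      obtain ⟨η, hη, hV⟩ : ∃ η < E ^ 2, ∀ ξ ∈ Ioc 0 (x s₁), W.V κ L ξ ≤ η := by
        rcases hc with hc | hc | hc
        · exact Geon.exists_barrier_lt (W.throatMass_nonneg_iff.2 hδ) h.causal hnt hR hx hd (Or.inl hc)
        · exact Geon.exists_barrier_lt (W.throatMass_nonneg_iff.2 hδ) h.causal hnt hR hx hd (Or.inr hc)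
        · exact hc
      exact Geon.exists_crossing_of_barrier (fun s => hM s (mem_univ s)) hx hd hη hV
  · have hm : W.throatMass ≠ 0 := fun h => hne (W.throatMass_eq_zero_iff.1 h)
    refine ⟨hg.exists_throatCrossing hm hκ hε hx lim,
      fun E₁ E₂ t₁ t₂ x₁ x₂ n₁ n₂ h₁ h₂ ht₁ hx₁ hn₁ ht₂ hx₂ hn₂ => ?_⟩
    exact h₁.eqOn hm h₂ (ht₁.trans ht₂.symm) (hx₁.trans hx₂.symm) (hn₁.trans hn₂.symm)
      fun s hs => (hx₁ hs).symm ▸ hx s hs
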